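/- Let $n\ge 2$ and let $X_i,Y_i,Z_i$ ($1\le i\le n$) be the Pauli operators on qubit $i$ of an open chain of $n$ qubits. For $1\le i\le n-1$ and $\vec\theta=(a,b,c,d,f,g)\in\mathbb R^6$ put $$B_i(\vec\theta)=e^{-iaZ_i}e^{-ibZ_{i+1}}e^{-icX_iX_{i+1}}e^{-idY_iY_{i+1}}e^{-ifZ_i}e^{-igZ_{i+1}} .$$ Below, a product of $B$'s written without parameters stands for such a product with arbitrary, independent parameters. For a real Lie algebra $\mathfrak g$ of matrices, "the group of $\mathfrak g$" is the group generated by $\exp(\mathfrak g)$. The cascade is $C_{i,j}=B_iB_{i+1}\cdots B_j$; the triangle is $T_N=C_{N,N}C_{N-1,N}\cdots C_{1,N}$; the zigzag $L_N$ is the product of all odd-indexed $B_k$, $k\le N$, followed by all even-indexed ones; the square $S_N$ is the product of the $C_{k,N}$ over decreasing $k\in\{1,\dots,N\}$ of parity opposite to $N$, followed by the product of the $C_{1,k}$ over decreasing odd $k\le N$. 1. (Block.) For all parameters: (fusion) $B_i(\vec\alpha)B_i(\vec\beta)=B_i(\vec a)$ for some $\vec a$; (commutation) $B_i(\vec\alpha)B_j(\vec\beta)=B_j(\vec\beta)B_i(\vec\alpha)$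 if $|i-j|>1$; (turnover) $B_i(\vec\alpha)B_{i+1}(\vec\beta)B_i(\vec\gamma)=B_{i+1}(\vec a)B_i(\vec b)B_{i+1}(\vec c)$ for some $\vec a,\vec b,\vec c$, and likewise with $i$ and $i+1$ exchanged. 2. (Two sites.) For $1\le i\le n-1$ the real Lie algebra $\mathfrak g_2^{(i)}$ generated by $iZ_i,iZ_{i+1},iX_iX_{i+1},iY_iY_{i+1}$ has basis $i\{X_iX_{i+1},Y_iY_{i+1},X_iY_{i+1},Y_iX_{i+1},Z_i,Z_{i+1}\}$. It is the direct sum of the commuting Lie subalgebras $\mathfrak g_\pm$ spanned by $\tfrac i2(X_iX_{i+1}\pm Y_iY_{i+1})$, $\tfrac i2(Z_i\mp Z_{i+1})$, $\tfrac i2(X_iY_{i+1}\mp Y_iX_{i+1})$, each isomorphic to $\mathfrak{su}(2)$. The operators $B_i(\vec\theta)$, $\vec\theta\in\mathbb R^6$, are exactly the elements of the group of $\mathfrak g_2^{(i)}$. 3. (Three sites.) For $1\le i\le n-2$ the Lie algebra $\mathfrak g_3^{(i)}$ generated by $\mathfrak g_2^{(i)}$ and $\mathfrak g_2^{(i+1)}$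 has as basis the 15 elements $i\{P_iQ_{i+1},P_{i+1}Q_{i+2},P_iZ_{i+1}Q_{i+2}\ (P,Q\in\{X,Y\}),Z_i,Z_{i+1},Z_{i+2}\}$. The fixed points of $g\mapsto Z_{i+2}\,g\,Z_{i+2}$ on it are $\mathfrak k=\mathfrak g_2^{(i)}+\mathbb R\,iZ_{i+2}$, and every $G$ in its group is $e^{k_1}e^{h}e^{k_2}$ with $k_1,k_2\in\mathfrak k$ and $h\in\mathrm{span}_{\mathbb R}\,i\{X_{i+1}X_{i+2},Y_{i+1}Y_{i+2}\}$. The fixed points of $g\mapsto Z_i\,g\,Z_i$ are $\mathfrak k'=\mathfrak g_2^{(i+1)}+\mathbb R\,iZ_i$, and every $G$ is $e^{k_1}e^{h}e^{k_2}$ with $k_1,k_2\in\mathfrak k'$ and $h\in\mathrm{span}_{\mathbb R}\,i\{X_iX_{i+1},Y_iY_{i+1}\}$. The group of $\mathfrak g_3^{(i)}$ is exactly the set of products $B_iB_{i+1}B_i$, exactly the set of products $B_{i+1}B_iB_{i+1}$, and exactly the set of triangles $T_5$ formed from the five one-parameter TFIM rotations $e^{-i\theta Z_i},e^{-i\theta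 X_iX_{i+1}},e^{-i\theta Z_{i+1}},e^{-i\theta X_{i+1}X_{i+2}},e^{-i\theta Z_{i+2}}$ taken as blocks $1,\dots,5$. 4. (Compression.) Every finite product of blocks $B_k$, $1\le k\le n-1$, equals a triangle $T_{n-1}$ and equals a square $S_{n-1}$. Both have $n(n-1)/2$ blocks. Counting layers in which no two blocks share a qubit, $T_{n-1}$ has depth at most $2n-3$ and $S_{n-1}$ depth at most $n$. 5. (Generalized TFXY model.) Let $$\mathcal H=\sum_{i=1}^{n-1}(a_iX_iX_{i+1}+b_iY_iY_{i+1}+c_iX_iY_{i+1}+d_iY_iX_{i+1})+\sum_{i=1}^nf_iZ_i$$ with real coefficients. A first-order Trotter step is the product, in some order, of the exponentials $e^{-i\Delta t\,h_\sigma\sigma}$ over all Pauli strings $\sigma$ of $\mathcal H$, with $h_\sigma$ the coefficient of $\sigma$. There is an order, not depending on the coefficients or on $\Delta t$, for which this step is a zigzag $L_{n-1}$. For any number $r$ of steps, any coefficients, time steps and orders varying from step to step, the product of the $r$ Trotter steps equals a triangle $T_{n-1}$ and equals a square $S_{n-1}$. 6. (Free fermions.) Let $\hat c_j=Z_1\cdots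 Z_{j-1}(X_j+iY_j)/2$ (Jordan–Wigner). Up to adding a real multiple of the identity, the Hamiltonians of part 5 are exactly the Hamiltonians $$\mathcal H=\sum_{i=1}^{n-1}(\alpha_i\hat c_i^\dagger\hat c_{i+1}+\alpha_i^*\hat c_{i+1}^\dagger\hat c_i+\beta_i\hat c_i\hat c_{i+1}+\beta_i^*\hat c_{i+1}^\dagger\hat c_i^\dagger)+\sum_{i=1}^n\gamma_i\hat c_i^\dagger\hat c_i ,\qquad \alpha_i,\beta_i\in\mathbb C,\ \gamma_i\in\mathbb R .$$ Let $r$ such Hamiltonians $\mathcal H_1,\dots,\mathcal H_r$ be given, each written as a finite sum $\mathcal H_k=\sum_jh_{k,j}$ of Hamiltonians of this form supported on single bonds $(i,i+1)$. Then for all real $\Delta t_k$ the Trotter circuit $\prod_{k=r}^{1}\prod_je^{-i\Delta t_kh_{k,j}}$ equals, up to a global phase, a triangle $T_{n-1}$ and (with the same phase) a square $S_{n-1}$. Hence its depth in blocks is at most $n$, independently of $r$. -/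

import Mathlib

attribute [local instance 100] LieRing.ofAssociativeRing

namespace TFXY

/-! ### Operators on a chain of `n` qubits -/

/-- Operators on `n` qubits: matrices indexed by the computational basis `{0,1}^n`. -/
abbrev Op (n : ℕ) := Matrix (Fin n → Fin 2) (Fin n → Fin 2) ℂ

def pX : Matrix (Fin 2) (Fin 2) ℂ := !![0, 1; 1, 0]

def pY : Matrix (Fin 2) (Fin 2) ℂ := !![0, -Complex.I; Complex.I, 0]

def pZ : Matrix (Fin 2) (Fin 2) ℂ := !![1, 0; 0, -1]

/-- The tensor product `A₁ ⊗ ⋯ ⊗ Aₙ` of one-qubit operators. -/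
def tensorOp {n : ℕ} (A : Fin n → Matrix (Fin 2) (Fin 2) ℂ) : Op n :=
  fun s t => ∏ j, A j (s j) (t j)

/-- The one-qubit operator `A` acting on qubit `i`; qubits are numbered `1, …, n`. -/
def site (n i : ℕ) (A : Matrix (Fin 2) (Fin 2) ℂ) : Op n :=
  tensorOp fun j => if (j : ℕ) + 1 = i then A else 1

def X (n i : ℕ) : Op n := site n i pX

def Y (n i : ℕ) : Op n := site n i pY

def Z (n i : ℕ) : Op n := site n i pZ

/-- The rotation `exp(-iθP)`. -/
noncomputable def rot {n : ℕ} (P : Op n) (θ : ℝ) : Op n :=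
  NormedSpace.exp ((-(Complex.I * (θ : ℂ))) • P)

/-! ### Blocks and circuits made of blocks -/

/-- `B_1(θ), …, B_N(θ)` are blocks: fusion, commutation and turnover. -/
structure IsBlock {M P : Type*} [Monoid M] (N : ℕ) (B : ℕ → P → M) : Prop where
  fusion : ∀ i, 1 ≤ i → i ≤ N → ∀ α β : P, ∃ a : P, B i α * B i β = B i a
  commutation : ∀ i j, 1 ≤ i → i ≤ N → 1 ≤ j → j ≤ N → (i + 1 < j ∨ j + 1 < i) →
    ∀ α β : P, B i α * B j β = B j β * B i α
  turnover : ∀ i, 1 ≤ i → i + 1 ≤ N → ∀ α β γ : P, ∃ a b c : P,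
    B i α * B (i + 1) β * B i γ = B (i + 1) a * B i b * B (i + 1) c

/-- The set of all products `B_{k₁}(θ₁) B_{k₂}(θ₂) ⋯` whose sequence of block indices is the
list `idx = [k₁, k₂, …]`; every block carries its own parameters. -/
def blockProducts {M P : Type*} [Monoid M] (B : ℕ → P → M) (idx : List ℕ) : Set M :=
  {U | ∃ C : List (ℕ × P), C.map Prod.fst = idx ∧ (C.map fun g => B g.1 g.2).prod = U}

/-- Indices of the cascade `C_{i,j} = B_i B_{i+1} ⋯ B_j`. -/
def cascadeIdx (i j : ℕ) : List ℕ := List.range' i (j + 1 - i)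

/-- Indices of the triangle `T_N = C_{N,N} C_{N-1,N} ⋯ C_{1,N}`. -/
def triangleIdx (N : ℕ) : List ℕ :=
  (List.range' 1 N).reverse.flatMap fun k => cascadeIdx k N

/-- Indices of the zigzag: first all odd blocks `B_1 B_3 ⋯`, then all even ones `B_2 B_4 ⋯`. -/
def zigzagIdx (N : ℕ) : List ℕ :=
  (List.range' 1 N).filter (fun k => k % 2 = 1) ++ (List.range' 1 N).filter (fun k => k % 2 = 0)

/-- Indices of the square `S_N`: the cascades `C_{k,N}` over decreasing `k` of parity opposite to
that of `N`, followed by the cascades `C_{1,k}` over decreasing odd `k`. -/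
def squareIdx (N : ℕ) : List ℕ :=
  ((List.range' 1 N).reverse.filter fun k => k % 2 ≠ N % 2).flatMap (fun k => cascadeIdx k N) ++
    ((List.range' 1 N).reverse.filter fun k => k % 2 = 1).flatMap (fun k => cascadeIdx 1 k)

/-- A circuit whose blocks `B_k` act on qubits `k, k+1` can be executed in `d` time layers: one
can assign layers to the blocks so that of two blocks sharing a qubit the one that comes first in
the circuit is in a strictly earlier layer. -/
def HasDepthLE (idx : List ℕ) (d : ℕ) : Prop :=
  ∃ t : Fin idx.length → Fin d, ∀ p q, p < q →
    idx.get p ≤ idx.get q + 1 → idx.get q ≤ idx.get p + 1 → t p < t q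

/-- The six-parameter TFXY block on qubits `i, i+1`. -/
noncomputable def block (n i : ℕ) (θ : Fin 6 → ℝ) : Op n :=
  rot (Z n i) (θ 0) * rot (Z n (i + 1)) (θ 1) * rot (X n i * X n (i + 1)) (θ 2) *
    rot (Y n i * Y n (i + 1)) (θ 3) * rot (Z n i) (θ 4) * rot (Z n (i + 1)) (θ 5)

/-- The TFIM blocks: `B_{2i-1}(θ) = exp(-iθ Z_i)` and `B_{2i}(θ) = exp(-iθ X_i X_{i+1})`. -/
noncomputable def tfimBlock (n k : ℕ) (θ : ℝ) : Op n :=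
  if k % 2 = 1 then rot (Z n ((k + 1) / 2)) θ else rot (X n (k / 2) * X n (k / 2 + 1)) θ

/-! ### Hamiltonian algebras -/

/-- The real Lie algebra `su(2)`: traceless anti-Hermitian `2 × 2` matrices. -/
def su2 : LieSubalgebra ℝ (Matrix (Fin 2) (Fin 2) ℂ) where
  carrier := {A | A.conjTranspose = -A ∧ A.trace = 0}
  add_mem' := by
    rintro A B ⟨hA, hA'⟩ ⟨hB, hB'⟩
    refine ⟨?_, ?_⟩
    · rw [Matrix.conjTranspose_add, hA, hB, neg_add]
    · rw [Matrix.trace_add, hA', hB', add_zero]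
  zero_mem' := by simp
  smul_mem' := by
    rintro c A ⟨hA, hA'⟩
    refine ⟨?_, ?_⟩
    · rw [Matrix.conjTranspose_smul, hA]; simp
    · rw [Matrix.trace_smul, hA', smul_zero]
  lie_mem' := by
    rintro A B ⟨hA, hA'⟩ ⟨hB, hB'⟩
    refine ⟨?_, ?_⟩
    · rw [Ring.lie_def, Matrix.conjTranspose_sub, Matrix.conjTranspose_mul,
        Matrix.conjTranspose_mul, hA, hB]
      simp
    · rw [Ring.lie_def, Matrix.trace_sub, Matrix.trace_mul_comm, sub_self]

/-- The group with Lie algebra `g`: all finite products of exponentials of elements of `g`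
(closed under inverses because `g = -g`). -/
noncomputable def expGroup {n : ℕ} (g : LieSubalgebra ℝ (Op n)) : Submonoid (Op n) :=
  Submonoid.closure {U | ∃ x ∈ g, NormedSpace.exp x = U}

/-- `i` times each of the exponents of the block on qubits `i, i+1`. -/
def exponents (n i : ℕ) : Set (Op n) :=
  {Complex.I • Z n i, Complex.I • Z n (i + 1), Complex.I • (X n i * X n (i + 1)),
    Complex.I • (Y n i * Y n (i + 1))}

/-- `g(TFXY₂)` on qubits `i, i+1`: the Lie algebra generated by the exponents of one block. -/
noncomputable def g2 (n i : ℕ) : LieSubalgebra ℝ (Op n) :=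
  LieSubalgebra.lieSpan ℝ (Op n) (exponents n i)

/-- `g(TFXY₃)` on qubits `i, i+1, i+2`: generated by the exponents of two adjacent blocks. -/
noncomputable def g3 (n i : ℕ) : LieSubalgebra ℝ (Op n) :=
  LieSubalgebra.lieSpan ℝ (Op n) (exponents n i ∪ exponents n (i + 1))

def g2Basis (n i : ℕ) : Fin 6 → Op n :=
  ![Complex.I • (X n i * X n (i + 1)), Complex.I • (Y n i * Y n (i + 1)),
    Complex.I • (X n i * Y n (i + 1)), Complex.I • (Y n i * X n (i + 1)),
    Complex.I • Z n i, Complex.I • Z n (i + 1)]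

def g3Basis (n i : ℕ) : Fin 15 → Op n :=
  ![Complex.I • (X n i * X n (i + 1)), Complex.I • (Y n i * Y n (i + 1)),
    Complex.I • (X n i * Y n (i + 1)), Complex.I • (Y n i * X n (i + 1)),
    Complex.I • (X n (i + 1) * X n (i + 2)), Complex.I • (Y n (i + 1) * Y n (i + 2)),
    Complex.I • (X n (i + 1) * Y n (i + 2)), Complex.I • (Y n (i + 1) * X n (i + 2)),
    Complex.I • Z n i, Complex.I • Z n (i + 1), Complex.I • Z n (i + 2),
    Complex.I • (X n i * Z n (i + 1) * X n (i + 2)),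
    Complex.I • (X n i * Z n (i + 1) * Y n (i + 2)),
    Complex.I • (Y n i * Z n (i + 1) * X n (i + 2)),
    Complex.I • (Y n i * Z n (i + 1) * Y n (i + 2))]

noncomputable def gPlusBasis (n i : ℕ) : Fin 3 → Op n :=
  ![(Complex.I / 2) • (X n i * X n (i + 1) + Y n i * Y n (i + 1)),
    (Complex.I / 2) • (Z n i - Z n (i + 1)),
    (Complex.I / 2) • (X n i * Y n (i + 1) - Y n i * X n (i + 1))]

noncomputable def gMinusBasis (n i : ℕ) : Fin 3 → Op n :=
  ![(Complex.I / 2) • (X n i * X n (i + 1) - Y n i * Y n (i + 1)),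
    (Complex.I / 2) • (Z n i + Z n (i + 1)),
    (Complex.I / 2) • (X n i * Y n (i + 1) + Y n i * X n (i + 1))]

noncomputable def gPlus (n i : ℕ) : LieSubalgebra ℝ (Op n) :=
  LieSubalgebra.lieSpan ℝ (Op n) (Set.range (gPlusBasis n i))

noncomputable def gMinus (n i : ℕ) : LieSubalgebra ℝ (Op n) :=
  LieSubalgebra.lieSpan ℝ (Op n) (Set.range (gMinusBasis n i))

/-! ### The generalized TFXY Hamiltonian and its Trotter circuits -/

/-- The kinds of Pauli strings `X_i X_{i+1}`, `Y_i Y_{i+1}`, `X_i Y_{i+1}`, `Y_i X_{i+1}`, `Z_i`. -/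
inductive Kind
  | xx | yy | xy | yx | z

def pauliTerm (n : ℕ) : Kind × ℕ → Op n
  | (Kind.xx, i) => X n i * X n (i + 1)
  | (Kind.yy, i) => Y n i * Y n (i + 1)
  | (Kind.xy, i) => X n i * Y n (i + 1)
  | (Kind.yx, i) => Y n i * X n (i + 1)
  | (Kind.z, i) => Z n i

/-- The Pauli strings present in the open chain of `n` qubits. -/
def IsTerm (n : ℕ) : Kind × ℕ → Prop
  | (Kind.z, i) => 1 ≤ i ∧ i ≤ n
  | (_, i) => 1 ≤ i ∧ i + 1 ≤ n

/-- The generalized TFXY Hamiltonian with real coefficients `h kind i` and open boundaries; the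
TFXY Hamiltonian is the case `h xy = h yx = 0`. -/
noncomputable def tfxyHamiltonian (n : ℕ) (h : Kind × ℕ → ℝ) : Op n :=
  ∑ i ∈ Finset.Icc 1 (n - 1),
      (h (Kind.xx, i) • (X n i * X n (i + 1)) + h (Kind.yy, i) • (Y n i * Y n (i + 1)) +
        h (Kind.xy, i) • (X n i * Y n (i + 1)) + h (Kind.yx, i) • (Y n i * X n (i + 1))) +
    ∑ i ∈ Finset.Icc 1 n, h (Kind.z, i) • Z n i

/-- An order of multiplication for a Trotter step: every Pauli string of the chain once. -/
def IsTermOrder (n : ℕ) (l : List (Kind × ℕ)) : Prop :=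
  l.Nodup ∧ ∀ τ, τ ∈ l ↔ IsTerm n τ

/-- One first-order Trotter step of `tfxyHamiltonian n h`, multiplied in the order `l`. -/
noncomputable def trotterStep (n : ℕ) (h : Kind × ℕ → ℝ) (dt : ℝ) (l : List (Kind × ℕ)) : Op n :=
  (l.map fun τ => rot (pauliTerm n τ) (dt * h τ)).prod

/-! ### Free fermions -/

/-- The fermion annihilation operator on site `j` in the Jordan–Wigner representation,
`c_j = Z_1 ⋯ Z_{j-1} (X_j + i Y_j)/2`. -/
noncomputable def annih (n j : ℕ) : Op n :=
  tensorOp fun k =>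
    if (k : ℕ) + 1 < j then pZ
    else if (k : ℕ) + 1 = j then (1 / 2 : ℂ) • (pX + Complex.I • pY) else 1

noncomputable def creat (n j : ℕ) : Op n := (annih n j).conjTranspose

/-- Hopping and pairing between the sites `i` and `i+1`. -/
noncomputable def hopPair (n i : ℕ) (α β : ℂ) : Op n :=
  α • (creat n i * annih n (i + 1)) + star α • (creat n (i + 1) * annih n i) +
    β • (annih n i * annih n (i + 1)) + star β • (creat n (i + 1) * creat n i)

/-- The general free-fermion Hamiltonian on an open chain with nearest-neighbour terms. -/
noncomputable def fermionHamiltonian (n : ℕ) (α β : ℕ → ℂ) (γ : ℕ → ℝ) : Op n :=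
  ∑ i ∈ Finset.Icc 1 (n - 1), hopPair n i (α i) (β i) +
    ∑ i ∈ Finset.Icc 1 n, γ i • (creat n i * annih n i)

/-- A free-fermion Hamiltonian supported on one bond `(bond, bond + 1)`. -/
structure BondTerm where
  bond : ℕ
  hop : ℂ
  pair : ℂ
  occL : ℝ
  occR : ℝ

noncomputable def BondTerm.op (n : ℕ) (p : BondTerm) : Op n :=
  hopPair n p.bond p.hop p.pair + p.occL • (creat n p.bond * annih n p.bond) +
    p.occR • (creat n (p.bond + 1) * annih n (p.bond + 1))

/-- `l` splits the Hamiltonian `H` on `n` sites into free-fermion terms on single bonds. -/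
def IsBondSplitting (n : ℕ) (l : List BondTerm) (H : Op n) : Prop :=
  (∀ p ∈ l, 1 ≤ p.bond ∧ p.bond + 1 ≤ n) ∧ (l.map (BondTerm.op n)).sum = H

/-- The first-order Trotter step belonging to such a splitting. -/
noncomputable def fermionTrotterStep (n : ℕ) (dt : ℝ) (l : List BondTerm) : Op n :=
  (l.map fun p => rot (p.op n) dt).prod

end TFXY

open TFXY

/-!
The Jordan–Wigner Majoranas `maj n 1, …, maj n (2 * n)` are generators of a Clifford algebra, and
every Pauli string that occurs is, up to a factor `±i`, a product of two of them: `iZ_j`,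
`iX_jX_{j+1}` and `iY_jY_{j+1}` are products of neighbouring or outermost Majoranas among the four
of a bond. So the two- and three-site algebras are the Lie algebras of bivectors of four and six
consecutive Majoranas, and their groups are copies of `Spin(4)` and `Spin(6)`.

If `J` and `K` anticommute and `J² = K² = -1`, Euler angles for unit quaternions say that the
rotations `e^{sJ}` and `e^{tK}` have the same products in the order `JKJ` as in the order `KJK`. The
rotations in the planes of neighbouring Majoranas are therefore idempotent sets that obey the braid
relations, and as in a `0`-Hecke monoid a full triangle of them absorbs every further generator: by
the Lie product formula and compactness it is the whole Spin group. On one bond,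
`Spin(4) = SU(2) × SU(2)` shows that the blocks are exactly the group of the bond; on two bonds,
`B₁B₂B₁ = Spin(6) = B₂B₁B₂`. Blocks thus satisfy the same relations, which compress any circuit to
the triangle and identify the triangle with the square.
-/

namespace TFXY

open Filter NormedSpace
open scoped Topology Quaternion

/-! ### Exponentials in Banach algebras -/

theorem pow_sub_pow_eq_sum {R : Type*} [Ring R] (a b : R) (m : ℕ) :
    a ^ m - b ^ m = ∑ k ∈ Finset.range m, a ^ k * (a - b) * b ^ (m - 1 - k) := by
  induction m with
  | zero => simp
  | succ m ih =>
    have hsum : (a ^ m - b ^ m) * b =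
        ∑ k ∈ Finset.range m, a ^ k * (a - b) * b ^ (m - k) := by
      rw [ih, Finset.sum_mul]
      refine Finset.sum_congr rfl fun k hk => ?_
      have hk' := Finset.mem_range.1 hk
      rw [mul_assoc, ← pow_succ, show m - 1 - k + 1 = m - k by omega]
    rw [Finset.sum_range_succ, Nat.add_sub_cancel, Nat.sub_self, pow_zero, mul_one, ← hsum,
      pow_succ, pow_succ]
    noncomm_ring

theorem norm_pow_sub_pow_le {𝔸 : Type*} [NormedRing 𝔸] {a b : 𝔸} {m : ℕ} {K L : ℝ}
    (ha : ∀ k ≤ m, ‖a ^ k‖ ≤ K) (hb : ∀ k ≤ m, ‖b ^ k‖ ≤ L) :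
    ‖a ^ m - b ^ m‖ ≤ K * L * (m * ‖a - b‖) := by
  have hK : 0 ≤ K := (norm_nonneg _).trans (ha 0 m.zero_le)
  have hterm : ∀ k ∈ Finset.range m,
      ‖a ^ k * (a - b) * b ^ (m - 1 - k)‖ ≤ K * ‖a - b‖ * L := fun k hk => by
    have hk' := Finset.mem_range.1 hk
    refine (norm_mul_le _ _).trans (mul_le_mul ((norm_mul_le _ _).trans ?_) (hb _ (by omega))
      (norm_nonneg _) (by positivity))
    exact mul_le_mul_of_nonneg_right (ha k hk'.le) (norm_nonneg _)
  rw [pow_sub_pow_eq_sum]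
  refine (norm_sum_le_of_le _ hterm).trans_eq ?_
  rw [Finset.sum_const, Finset.card_range, nsmul_eq_mul]
  ring

section BanachAlgebra

variable {𝔸 : Type*} [NormedRing 𝔸]

theorem norm_pow_le_exp_of_le [NormOneClass 𝔸] {a : 𝔸} {r : ℝ} {k m : ℕ} (hr : 0 ≤ r)
    (ha : ‖a‖ ≤ Real.exp (r / m)) (hk : k ≤ m) : ‖a ^ k‖ ≤ Real.exp r := by
  calc ‖a ^ k‖ ≤ Real.exp (r / m) ^ k :=
        (norm_pow_le a k).trans (pow_le_pow_left₀ (norm_nonneg _) ha k)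
    _ = Real.exp (r * (k / m)) := by rw [← Real.exp_nat_mul]; ring_nf
    _ ≤ Real.exp r := by
        refine Real.exp_le_exp.2 (mul_le_of_le_one_right hr (div_le_one_of_le₀ ?_ m.cast_nonneg))
        exact_mod_cast hk

variable [NormedAlgebra ℝ 𝔸]

theorem norm_exp_le_exp_norm [NormOneClass 𝔸] (x : 𝔸) : ‖exp x‖ ≤ Real.exp ‖x‖ := by
  rw [exp_eq_tsum ℝ, Real.exp_eq_exp_ℝ, exp_eq_tsum ℝ]
  refine tsum_of_norm_bounded (expSeries_summable' (𝕂 := ℝ) ‖x‖).hasSum fun k => ?_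
  rw [norm_smul, smul_eq_mul, Real.norm_of_nonneg (by positivity)]
  gcongr
  exact norm_pow_le x k

theorem exp_smul_of_mul_self_eq_neg_one {J : 𝔸} (hJ : J * J = -1) (t : ℝ) :
    exp (t • J) = Real.cos t • (1 : 𝔸) + Real.sin t • J := by
  let _ : NormedAlgebra ℚ 𝔸 := .restrictScalars ℚ ℝ 𝔸
  let f : ℂ →ₐ[ℝ] 𝔸 := Complex.lift ⟨J, hJ⟩
  have hf : Continuous f := f.toLinearMap.continuous_of_finiteDimensional
  have hI : f Complex.I = J := Complex.liftAux_apply_I J hJ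
  have h := map_exp f hf (t • Complex.I)
  rw [map_smul, hI, Complex.real_smul, ← Complex.exp_eq_exp_ℂ, Complex.exp_mul_I,
    ← Complex.ofReal_cos, ← Complex.ofReal_sin, ← Complex.real_smul, map_add, map_smul, hI] at h
  rw [← h, ← Complex.coe_algebraMap, AlgHom.commutes, Algebra.algebraMap_eq_smul_one]

theorem isCompact_range_exp_smul {J : 𝔸} (hJ : J * J = -1) :
    IsCompact (Set.range fun t : ℝ => exp (t • J)) := by
  have hform : (fun t : ℝ => exp (t • J)) = fun t => Real.cos t • (1 : 𝔸) + Real.sin t • J :=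
    funext (exp_smul_of_mul_self_eq_neg_one hJ)
  have hper : Function.Periodic (fun t : ℝ => Real.cos t • (1 : 𝔸) + Real.sin t • J)
      (2 * Real.pi) := fun t => by
    simp only [Real.cos_add_two_pi, Real.sin_add_two_pi]
  rw [hform, ← hper.image_Icc Real.two_pi_pos 0]
  exact isCompact_Icc.image (by fun_prop)

variable [CompleteSpace 𝔸]

theorem tendsto_nat_mul_norm_exp_mul_exp_sub_exp (x y : 𝔸) :
    Tendsto (fun m : ℕ => (m : ℝ) * ‖exp ((1 / m : ℝ) • x) * exp ((1 / m : ℝ) • y) -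
      exp ((1 / m : ℝ) • (x + y))‖) atTop (𝓝 0) := by
  have hderiv : ∀ z : 𝔸, HasDerivAt (fun t : ℝ => exp (t • z)) z 0 := fun z => by
    simpa using hasDerivAt_exp_smul_const (𝕂 := ℝ) z (0 : ℝ)
  have hdiff : HasDerivAt (fun t : ℝ => exp (t • x) * exp (t • y) - exp (t • (x + y))) 0 0 := by
    have h := ((hderiv x).mul (hderiv y)).sub (hderiv (x + y))
    simp only [zero_smul, exp_zero, one_mul, mul_one, sub_self] at h
    exact h
  have hseq : Tendsto (fun m : ℕ => 1 / (m : ℝ)) atTop (𝓝[≠] 0) := by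
    refine tendsto_nhdsWithin_iff.2 ⟨tendsto_one_div_atTop_nhds_zero_nat, ?_⟩
    filter_upwards [eventually_gt_atTop 0] with m hm
    exact one_div_ne_zero (Nat.cast_ne_zero.2 hm.ne')
  have hslope := (hasDerivAt_iff_tendsto_slope_zero.1 hdiff).norm.comp hseq
  rw [norm_zero] at hslope
  refine hslope.congr fun m => ?_
  simp [norm_smul]

theorem tendsto_exp_mul_exp_pow [NormOneClass 𝔸] (x y : 𝔸) :
    Tendsto (fun m : ℕ => (exp ((1 / m : ℝ) • x) * exp ((1 / m : ℝ) • y)) ^ m) atTop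
      (𝓝 (exp (x + y))) := by
  let _ : NormedAlgebra ℚ 𝔸 := .restrictScalars ℚ ℝ 𝔸
  set r := ‖x‖ + ‖y‖ with hr
  have hr0 : 0 ≤ r := by positivity
  have hexp : ∀ (m : ℕ) (z : 𝔸), ‖exp ((1 / m : ℝ) • z)‖ ≤ Real.exp (‖z‖ / m) := fun m z => by
    refine (norm_exp_le_exp_norm _).trans_eq ?_
    rw [norm_smul, Real.norm_of_nonneg (by positivity), one_div_mul_eq_div]
  have hprod : ∀ m : ℕ,
      ‖exp ((1 / m : ℝ) • x) * exp ((1 / m : ℝ) • y)‖ ≤ Real.exp (r / m) := fun m => by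
    rw [hr, add_div, Real.exp_add]
    exact (norm_mul_le _ _).trans
      (mul_le_mul (hexp m x) (hexp m y) (norm_nonneg _) (Real.exp_nonneg _))
  have hsum : ∀ m : ℕ, ‖exp ((1 / m : ℝ) • (x + y))‖ ≤ Real.exp (r / m) := fun m =>
    (hexp m _).trans (Real.exp_le_exp.2 (div_le_div_of_nonneg_right (norm_add_le x y)
      m.cast_nonneg))
  have hlim := (tendsto_nat_mul_norm_exp_mul_exp_sub_exp x y).const_mul
    (Real.exp r * Real.exp r)
  rw [mul_zero] at hlim
  rw [tendsto_iff_norm_sub_tendsto_zero]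
  refine squeeze_zero' (.of_forall fun _ => norm_nonneg _) ?_ hlim
  filter_upwards [eventually_gt_atTop 0] with m hm
  have hpow : exp ((1 / m : ℝ) • (x + y)) ^ m = exp (x + y) := by
    rw [← exp_nsmul, ← Nat.cast_smul_eq_nsmul ℝ, smul_smul,
      mul_one_div_cancel (Nat.cast_ne_zero.2 hm.ne'), one_smul]
  rw [← hpow]
  exact norm_pow_sub_pow_le (fun k hk => norm_pow_le_exp_of_le hr0 (hprod m) hk)
    (fun k hk => norm_pow_le_exp_of_le hr0 (hsum m) hk)

theorem exp_mem_of_mem_span [NormOneClass 𝔸] {S : Submonoid 𝔸} (hS : IsClosed (S : Set 𝔸))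
    {s : Set 𝔸} (hs : ∀ x ∈ s, ∀ t : ℝ, exp (t • x) ∈ S) {x : 𝔸}
    (hx : x ∈ Submodule.span ℝ s) : exp x ∈ S := by
  suffices h : ∀ t : ℝ, exp (t • x) ∈ S by simpa using h 1
  induction hx using Submodule.span_induction with
  | mem x hx => exact hs x hx
  | zero => intro t; simp
  | add x y _ _ hx hy =>
    intro t
    rw [smul_add]
    refine hS.mem_of_tendsto (tendsto_exp_mul_exp_pow _ _) (.of_forall fun m => ?_)
    rw [smul_smul, smul_smul]
    exact pow_mem (mul_mem (hx _) (hy _)) m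
  | smul c x _ hx => intro t; rw [smul_smul]; exact hx _

end BanachAlgebra

/-! ### Quaternions and quaternion pairs -/

theorem exists_sqrt_mul_cos_sin (x y : ℝ) :
    ∃ φ : ℝ, √(x ^ 2 + y ^ 2) * Real.cos φ = x ∧ √(x ^ 2 + y ^ 2) * Real.sin φ = y := by
  refine ⟨Complex.arg (x + y * Complex.I), ?_, ?_⟩
  · rw [← Complex.norm_add_mul_I, Complex.norm_mul_cos_arg]; simp
  · rw [← Complex.norm_add_mul_I, Complex.norm_mul_sin_arg]; simp

theorem sq_add_sq_add_sq_add_sq_of_norm_eq_one {q : ℍ[ℝ]} (hq : ‖q‖ = 1) :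
    q.re ^ 2 + q.imI ^ 2 + (q.imJ ^ 2 + q.imK ^ 2) = 1 := by
  have h := Quaternion.normSq_eq_norm_mul_self q
  rw [hq, Quaternion.normSq_def'] at h
  linarith

/-- The quaternion unit `i`. -/
def quaternionI : ℍ[ℝ] := ⟨0, 1, 0, 0⟩

/-- The quaternion unit `j`. -/
def quaternionJ : ℍ[ℝ] := ⟨0, 0, 1, 0⟩

@[simp] theorem quaternionI_components : quaternionI.re = 0 ∧ quaternionI.imI = 1 ∧
    quaternionI.imJ = 0 ∧ quaternionI.imK = 0 := ⟨rfl, rfl, rfl, rfl⟩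

@[simp] theorem quaternionJ_components : quaternionJ.re = 0 ∧ quaternionJ.imI = 0 ∧
    quaternionJ.imJ = 1 ∧ quaternionJ.imK = 0 := ⟨rfl, rfl, rfl, rfl⟩

theorem quaternionI_mul_self : quaternionI * quaternionI = -1 := by ext <;> simp

theorem quaternionJ_mul_self : quaternionJ * quaternionJ = -1 := by ext <;> simp

theorem exists_exp_eq_of_norm_eq_one {q : ℍ[ℝ]} (hq : ‖q‖ = 1) :
    ∃ u : ℍ[ℝ], u.re = 0 ∧ exp u = q := by
  set r := √(q.imI ^ 2 + q.imJ ^ 2 + q.imK ^ 2)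
  have hr : r ^ 2 = q.imI ^ 2 + q.imJ ^ 2 + q.imK ^ 2 := Real.sq_sqrt (by positivity)
  obtain ⟨N, hre, hN, him⟩ : ∃ N : ℍ[ℝ], N.re = 0 ∧ N * N = -1 ∧ q.im = r • N := by
    by_cases h0 : r = 0
    · rw [h0] at hr
      refine ⟨quaternionI, rfl, quaternionI_mul_self, ?_⟩
      ext <;> simp [h0] <;> nlinarith [sq_nonneg q.imI, sq_nonneg q.imJ, sq_nonneg q.imK]
    · refine ⟨r⁻¹ • q.im, by simp, ?_, by rw [smul_inv_smul₀ h0]⟩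
      have hsq : q.im * q.im = -(r ^ 2 : ℝ) • (1 : ℍ[ℝ]) := by
        rw [hr]; ext <;> simp <;> ring
      rw [smul_mul_smul_comm, hsq, smul_smul]
      rw [show r⁻¹ * r⁻¹ * -r ^ 2 = -1 by field_simp, neg_one_smul]
  obtain ⟨φ, hcos, hsin⟩ := exists_sqrt_mul_cos_sin q.re r
  have hone : q.re ^ 2 + r ^ 2 = 1 := by
    have := sq_add_sq_add_sq_add_sq_of_norm_eq_one hq; linarith
  rw [hone, Real.sqrt_one, one_mul] at hcos hsin
  refine ⟨φ • N, by simp [hre], ?_⟩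
  rw [exp_smul_of_mul_self_eq_neg_one hN, hcos, hsin, ← him]
  ext <;> simp

/-- The unit quaternion `e^{ai} e^{bj} e^{ci}` with Euler angles `a`, `b`, `c`. -/
noncomputable def eulerQuaternion (a b c : ℝ) : ℍ[ℝ] :=
  exp (a • quaternionI) * exp (b • quaternionJ) * exp (c • quaternionI)

theorem eulerQuaternion_eq (a b c : ℝ) :
    eulerQuaternion a b c = ⟨Real.cos b * Real.cos (a + c), Real.cos b * Real.sin (a + c),
      Real.sin b * Real.cos (a - c), Real.sin b * Real.sin (a - c)⟩ := by
  rw [eulerQuaternion, exp_smul_of_mul_self_eq_neg_one quaternionI_mul_self,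
    exp_smul_of_mul_self_eq_neg_one quaternionJ_mul_self,
    exp_smul_of_mul_self_eq_neg_one quaternionI_mul_self]
  ext <;> simp [Real.cos_add, Real.sin_add, Real.cos_sub, Real.sin_sub] <;> ring

theorem norm_exp_of_re_eq_zero {u : ℍ[ℝ]} (hu : u.re = 0) : ‖exp u‖ = 1 := by
  rw [Quaternion.norm_exp, hu, exp_zero, norm_one]

theorem norm_eulerQuaternion (a b c : ℝ) : ‖eulerQuaternion a b c‖ = 1 := by
  rw [eulerQuaternion, norm_mul, norm_mul, norm_exp_of_re_eq_zero (by simp),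
    norm_exp_of_re_eq_zero (by simp), norm_exp_of_re_eq_zero (by simp), one_mul, one_mul]

theorem exists_eulerQuaternion_eq {q : ℍ[ℝ]} (hq : ‖q‖ = 1) :
    ∃ a b c : ℝ, eulerQuaternion a b c = q := by
  obtain ⟨φ, hre, hi⟩ := exists_sqrt_mul_cos_sin q.re q.imI
  obtain ⟨ψ, hj, hk⟩ := exists_sqrt_mul_cos_sin q.imJ q.imK
  obtain ⟨b, hcos, hsin⟩ :=
    exists_sqrt_mul_cos_sin √(q.re ^ 2 + q.imI ^ 2) √(q.imJ ^ 2 + q.imK ^ 2)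
  rw [Real.sq_sqrt (by positivity), Real.sq_sqrt (by positivity),
    sq_add_sq_add_sq_add_sq_of_norm_eq_one hq, Real.sqrt_one, one_mul] at hcos hsin
  refine ⟨(φ + ψ) / 2, b, (φ - ψ) / 2, ?_⟩
  rw [eulerQuaternion_eq, hcos, hsin, show (φ + ψ) / 2 + (φ - ψ) / 2 = φ by ring,
    show (φ + ψ) / 2 - (φ - ψ) / 2 = ψ by ring, hre, hi, hj, hk]
  rfl

/-- `J` and `K` are anticommuting square roots of `-1`. -/
structure IsQuaternionPair {𝔸 : Type*} [Ring 𝔸] (J K : 𝔸) : Prop where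
  left_mul_self : J * J = -1
  right_mul_self : K * K = -1
  anticomm : K * J = -(J * K)

/-- A quaternion pair together with a commuting involution `c`, the chirality. Its eigenspaces
carry two independent copies of the quaternions. -/
structure IsChiralPair {𝔸 : Type*} [Ring 𝔸] (J K c : 𝔸) : Prop extends IsQuaternionPair J K where
  chirality_mul_self : c * c = 1
  commute_left : Commute c J
  commute_right : Commute c K

section Lift

variable {𝔸 : Type*} [Ring 𝔸] {J K c : 𝔸}

theorem IsQuaternionPair.symm (h : IsQuaternionPair J K) : IsQuaternionPair K J :=
  ⟨h.right_mul_self, h.left_mul_self, by rw [h.anticomm, neg_neg]⟩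

variable [Algebra ℝ 𝔸]

/-- The algebra homomorphism from the quaternions with `i ↦ J` and `j ↦ K`. -/
noncomputable def IsQuaternionPair.lift (h : IsQuaternionPair J K) : ℍ[ℝ] →ₐ[ℝ] 𝔸 :=
  QuaternionAlgebra.lift
    { i := J, j := K, k := J * K
      i_mul_i := by simp [h.left_mul_self]
      j_mul_j := by simp [h.right_mul_self]
      i_mul_j := rfl
      j_mul_i := by simp [h.anticomm] }

theorem IsQuaternionPair.lift_apply (h : IsQuaternionPair J K) (q : ℍ[ℝ]) :
    h.lift q = algebraMap ℝ 𝔸 q.re + q.imI • J + q.imJ • K + q.imK • (J * K) := rfl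

theorem IsQuaternionPair.lift_quaternionI (h : IsQuaternionPair J K) :
    h.lift quaternionI = J := by
  simp [h.lift_apply]

theorem IsQuaternionPair.lift_quaternionJ (h : IsQuaternionPair J K) :
    h.lift quaternionJ = K := by
  simp [h.lift_apply]

theorem IsChiralPair.commute_lift (h : IsChiralPair J K c) (q : ℍ[ℝ]) :
    Commute c (h.lift q) := by
  rw [h.lift_apply]
  exact ((Algebra.commute_algebraMap_right q.re c
    |>.add_right (h.commute_left.smul_right _)).add_right (h.commute_right.smul_right _)).add_right
      ((h.commute_left.mul_right h.commute_right).smul_right _)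

/-- The algebra homomorphism from pairs of quaternions that lets the first component act on the
`+1`-eigenspace of `c` and the second one on the `-1`-eigenspace. -/
noncomputable def IsChiralPair.chiralLift (h : IsChiralPair J K c) :
    ℍ[ℝ] × ℍ[ℝ] →ₐ[ℝ] 𝔸 :=
  AlgHom.ofLinearMap
    ((LinearMap.mulLeft ℝ ((1 / 2 : ℝ) • (1 + c))) ∘ₗ h.lift.toLinearMap ∘ₗ .fst ℝ ℍ[ℝ] ℍ[ℝ] +
      (LinearMap.mulLeft ℝ ((1 / 2 : ℝ) • (1 - c))) ∘ₗ h.lift.toLinearMap ∘ₗ .snd ℝ ℍ[ℝ] ℍ[ℝ])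
    (by
      simp only [LinearMap.add_apply, LinearMap.comp_apply, LinearMap.mulLeft_apply,
        LinearMap.fst_apply, LinearMap.snd_apply, AlgHom.toLinearMap_apply, Prod.fst_one,
        Prod.snd_one, map_one, mul_one]
      module)
    (by
      intro p q
      have hcc : ∀ z, c * (c * z) = z := fun z => by
        rw [← mul_assoc, h.chirality_mul_self, one_mul]
      have hc : ∀ (r : ℍ[ℝ]) (z : 𝔸), h.lift r * (c * z) = c * (h.lift r * z) := fun r z => by
        rw [← mul_assoc, ← (h.commute_lift r).eq, mul_assoc]
      simp only [LinearMap.add_apply, LinearMap.comp_apply, LinearMap.mulLeft_apply,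
        LinearMap.fst_apply, LinearMap.snd_apply, AlgHom.toLinearMap_apply, Prod.fst_mul,
        Prod.snd_mul, map_mul, smul_mul_assoc, mul_smul_comm, add_mul, sub_mul, mul_add, mul_sub,
        one_mul, mul_assoc, hc, hcc, smul_add, smul_sub]
      module)

theorem IsChiralPair.chiralLift_apply (h : IsChiralPair J K c) (p q : ℍ[ℝ]) :
    h.chiralLift (p, q) = h.lift ((1 / 2 : ℝ) • (p + q)) + c * h.lift ((1 / 2 : ℝ) • (p - q)) := by
  change ((1 / 2 : ℝ) • (1 + c)) * h.lift p + ((1 / 2 : ℝ) • (1 - c)) * h.lift q = _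
  simp only [map_smul, map_add, map_sub, smul_mul_assoc, mul_smul_comm, add_mul, sub_mul, mul_sub,
    one_mul]
  module

end Lift

section ExpLift

variable {𝔸 : Type*} [NormedRing 𝔸] [NormedAlgebra ℝ 𝔸] {J K c : 𝔸}

theorem IsQuaternionPair.lift_exp (h : IsQuaternionPair J K) (q : ℍ[ℝ]) :
    h.lift (exp q) = exp (h.lift q) := by
  let _ : NormedAlgebra ℚ ℍ[ℝ] := .restrictScalars ℚ ℝ ℍ[ℝ]
  let _ : NormedAlgebra ℚ 𝔸 := .restrictScalars ℚ ℝ 𝔸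
  exact map_exp h.lift h.lift.toLinearMap.continuous_of_finiteDimensional q

theorem IsQuaternionPair.lift_eulerQuaternion (h : IsQuaternionPair J K) (a b d : ℝ) :
    h.lift (eulerQuaternion a b d) = exp (a • J) * exp (b • K) * exp (d • J) := by
  simp only [eulerQuaternion, map_mul, h.lift_exp, map_smul, h.lift_quaternionI,
    h.lift_quaternionJ]

theorem IsQuaternionPair.exists_exp_mul_exp_mul_exp_eq (h : IsQuaternionPair J K) (α β γ : ℝ) :
    ∃ a b d : ℝ, exp (α • J) * exp (β • K) * exp (γ • J) =
      exp (a • K) * exp (b • J) * exp (d • K) := by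
  have hnorm : ‖exp (α • quaternionJ) * exp (β • quaternionI) * exp (γ • quaternionJ)‖ = 1 := by
    rw [norm_mul, norm_mul, norm_exp_of_re_eq_zero (by simp), norm_exp_of_re_eq_zero (by simp),
      norm_exp_of_re_eq_zero (by simp), one_mul, one_mul]
  obtain ⟨a, b, d, habd⟩ := exists_eulerQuaternion_eq hnorm
  refine ⟨a, b, d, ?_⟩
  rw [← h.symm.lift_eulerQuaternion, habd]
  simp only [map_mul, h.symm.lift_exp, map_smul, h.symm.lift_quaternionI,
    h.symm.lift_quaternionJ]

/-- The six-parameter block built from a chiral pair. -/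
noncomputable def chiralBlock (J K c : 𝔸) (θ : Fin 6 → ℝ) : 𝔸 :=
  exp (θ 0 • J) * exp (θ 1 • (c * J)) * exp (θ 2 • K) * exp (θ 3 • -(c * K)) * exp (θ 4 • J) *
    exp (θ 5 • (c * J))

theorem exp_smul_mem_range_chiralBlock (J K c : 𝔸) (t : ℝ) :
    exp (t • J) ∈ Set.range (chiralBlock J K c) ∧ exp (t • K) ∈ Set.range (chiralBlock J K c) ∧
      exp (t • (c * J)) ∈ Set.range (chiralBlock J K c) :=
  ⟨⟨![t, 0, 0, 0, 0, 0], by simp [chiralBlock]⟩, ⟨![0, 0, t, 0, 0, 0], by simp [chiralBlock]⟩,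
    ⟨![0, t, 0, 0, 0, 0], by simp [chiralBlock]⟩⟩

namespace IsChiralPair

theorem chiralLift_exp (h : IsChiralPair J K c) (p q : ℍ[ℝ]) :
    h.chiralLift (exp p, exp q) = exp (h.chiralLift (p, q)) := by
  let _ : NormedAlgebra ℚ ℍ[ℝ] := .restrictScalars ℚ ℝ ℍ[ℝ]
  let _ : NormedAlgebra ℚ 𝔸 := .restrictScalars ℚ ℝ 𝔸
  have hexp : exp (p, q) = (exp p, exp q) := Prod.ext (Prod.fst_exp _) (Prod.snd_exp _)
  rw [← hexp]
  exact map_exp h.chiralLift h.chiralLift.toLinearMap.continuous_of_finiteDimensional (p, q)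

theorem exp_smul_left (h : IsChiralPair J K c) (t : ℝ) :
    exp (t • J) = h.chiralLift (exp (t • quaternionI), exp (t • quaternionI)) := by
  rw [chiralLift_exp, chiralLift_apply, sub_self, smul_zero, map_zero, mul_zero, add_zero,
    ← two_smul ℝ, smul_smul, one_div, inv_mul_cancel₀ two_ne_zero, one_smul, map_smul,
    h.lift_quaternionI]

theorem exp_smul_right (h : IsChiralPair J K c) (t : ℝ) :
    exp (t • K) = h.chiralLift (exp (t • quaternionJ), exp (t • quaternionJ)) := by
  rw [chiralLift_exp, chiralLift_apply, sub_self, smul_zero, map_zero, mul_zero, add_zero,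
    ← two_smul ℝ, smul_smul, one_div, inv_mul_cancel₀ two_ne_zero, one_smul, map_smul,
    h.lift_quaternionJ]

theorem exp_smul_chirality_mul_left (h : IsChiralPair J K c) (t : ℝ) :
    exp (t • (c * J)) =
      h.chiralLift (exp (t • quaternionI), exp (-t • quaternionI)) := by
  rw [chiralLift_exp, chiralLift_apply, ← add_smul, ← sub_smul, add_neg_cancel, zero_smul,
    smul_zero, map_zero, zero_add, smul_smul, map_smul, h.lift_quaternionI, mul_smul_comm]
  ring_nf

theorem exp_smul_neg_chirality_mul_right (h : IsChiralPair J K c) (t : ℝ) :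
    exp (t • -(c * K)) =
      h.chiralLift (exp (-t • quaternionJ), exp (t • quaternionJ)) := by
  rw [chiralLift_exp, chiralLift_apply, ← add_smul, ← sub_smul, neg_add_cancel, zero_smul,
    smul_zero, map_zero, zero_add, smul_smul, map_smul, h.lift_quaternionJ, mul_smul_comm,
    smul_neg, ← neg_smul]
  ring_nf

theorem chiralBlock_eq_chiralLift (h : IsChiralPair J K c) (θ : Fin 6 → ℝ) :
    chiralBlock J K c θ = h.chiralLift
      (eulerQuaternion (θ 0 + θ 1) (θ 2 - θ 3) (θ 4 + θ 5),
        eulerQuaternion (θ 0 - θ 1) (θ 2 + θ 3) (θ 4 - θ 5)) := by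
  let _ : NormedAlgebra ℚ ℍ[ℝ] := .restrictScalars ℚ ℝ ℍ[ℝ]
  have hadd : ∀ (s t : ℝ) (x : ℍ[ℝ]), exp ((s + t) • x) = exp (s • x) * exp (t • x) :=
    fun s t x => by
      rw [add_smul, exp_add_of_commute (((Commute.refl x).smul_left s).smul_right t)]
  rw [chiralBlock, h.exp_smul_left, h.exp_smul_right, h.exp_smul_chirality_mul_left,
    h.exp_smul_neg_chirality_mul_right, h.exp_smul_left, h.exp_smul_chirality_mul_left]
  simp only [← map_mul, Prod.mk_mul_mk, eulerQuaternion, sub_eq_add_neg, hadd, mul_assoc]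

/-- The image of pairs of unit quaternions, a copy of a quotient of `SU(2) × SU(2)`. -/
noncomputable def unitGroup (h : IsChiralPair J K c) : Submonoid 𝔸 :=
  ((Submonoid.unitSphere ℍ[ℝ]).prod (Submonoid.unitSphere ℍ[ℝ])).map h.chiralLift

theorem mem_unitGroup (h : IsChiralPair J K c) {x : 𝔸} :
    x ∈ h.unitGroup ↔ ∃ p q : ℍ[ℝ], ‖p‖ = 1 ∧ ‖q‖ = 1 ∧ h.chiralLift (p, q) = x := by
  simp [unitGroup, Submonoid.mem_map, Submonoid.mem_prod, Submonoid.unitSphere, and_assoc]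

theorem range_chiralBlock (h : IsChiralPair J K c) :
    Set.range (chiralBlock J K c) = h.unitGroup := by
  ext x
  rw [SetLike.mem_coe, h.mem_unitGroup]
  constructor
  · rintro ⟨θ, rfl⟩
    exact ⟨_, _, norm_eulerQuaternion _ _ _, norm_eulerQuaternion _ _ _,
      (h.chiralBlock_eq_chiralLift θ).symm⟩
  · rintro ⟨p, q, hp, hq, rfl⟩
    obtain ⟨a, b, d, rfl⟩ := exists_eulerQuaternion_eq hp
    obtain ⟨a', b', d', rfl⟩ := exists_eulerQuaternion_eq hq
    refine ⟨![(a + a') / 2, (a - a') / 2, (b + b') / 2, (b' - b) / 2, (d + d') / 2,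
      (d - d') / 2], ?_⟩
    rw [h.chiralBlock_eq_chiralLift]
    congr 3 <;> simp <;> ring

theorem chiralLift_mem_span (h : IsChiralPair J K c) {u v : ℍ[ℝ]} (hu : u.re = 0)
    (hv : v.re = 0) :
    h.chiralLift (u, v) ∈
      Submodule.span ℝ {J, c * J, K, c * K, J * K, c * (J * K)} := by
  have hmem : ∀ x ∈ ({J, c * J, K, c * K, J * K, c * (J * K)} : Set 𝔸), ∀ r : ℝ,
      r • x ∈ Submodule.span ℝ {J, c * J, K, c * K, J * K, c * (J * K)} :=
    fun x hx r => Submodule.smul_mem _ r (Submodule.subset_span hx)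
  rw [h.chiralLift_apply, h.lift_apply, h.lift_apply]
  simp only [Quaternion.re_smul, Quaternion.re_add, Quaternion.re_sub, hu, hv, add_zero, sub_self,
    smul_zero, map_zero, zero_add, mul_add, mul_smul_comm]
  refine add_mem (add_mem (add_mem ?_ ?_) ?_) (add_mem (add_mem ?_ ?_) ?_) <;>
    exact hmem _ (by simp) _

theorem exists_chiralBlock_eq_exp (h : IsChiralPair J K c) (θ : Fin 6 → ℝ) :
    ∃ k ∈ Submodule.span ℝ {J, c * J, K, c * K, J * K, c * (J * K)},
      chiralBlock J K c θ = exp k := by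
  obtain ⟨u, hu, hue⟩ :=
    exists_exp_eq_of_norm_eq_one (norm_eulerQuaternion (θ 0 + θ 1) (θ 2 - θ 3) (θ 4 + θ 5))
  obtain ⟨v, hv, hve⟩ :=
    exists_exp_eq_of_norm_eq_one (norm_eulerQuaternion (θ 0 - θ 1) (θ 2 + θ 3) (θ 4 - θ 5))
  exact ⟨_, h.chiralLift_mem_span hu hv, by
    rw [h.chiralBlock_eq_chiralLift, ← hue, ← hve, h.chiralLift_exp]⟩

end IsChiralPair

end ExpLift

/-! ### Words in `0`-Hecke generators -/

/-- The relations of the `0`-Hecke monoid for the generators `r_1, …, r_N`. -/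
structure IsHecke {W : Type*} [Monoid W] (N : ℕ) (r : ℕ → W) : Prop where
  idem : ∀ i, 1 ≤ i → i ≤ N → r i * r i = r i
  comm : ∀ i j, 1 ≤ i → i + 1 < j → j ≤ N → r i * r j = r j * r i
  braid : ∀ i, 1 ≤ i → i + 1 ≤ N → r i * r (i + 1) * r i = r (i + 1) * r i * r (i + 1)

/-- The product of the generators along a list of indices. -/
def word {W : Type*} [Monoid W] (r : ℕ → W) (l : List ℕ) : W := (l.map r).prod

section Word

variable {W : Type*} [Monoid W] {r : ℕ → W} {N : ℕ}

@[simp] theorem word_nil : word r [] = 1 := rfl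

@[simp] theorem word_cons (k : ℕ) (l : List ℕ) : word r (k :: l) = r k * word r l := by
  simp [word]

@[simp] theorem word_append (l l' : List ℕ) : word r (l ++ l') = word r l * word r l' := by
  simp [word]

theorem word_congr {r' : ℕ → W} {l : List ℕ} (h : ∀ k ∈ l, r k = r' k) :
    word r l = word r' l := by
  rw [word, word, List.map_congr_left h]

theorem commute_word {x : W} {l : List ℕ} (h : ∀ k ∈ l, Commute x (r k)) :
    Commute x (word r l) := by
  induction l with
  | nil => exact Commute.one_right x
  | cons k l ih =>
    rw [word_cons]
    exact (h k (by simp)).mul_right (ih fun j hj => h j (by simp [hj]))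

theorem IsHecke.commute (H : IsHecke N r) {i j : ℕ} (hi : 1 ≤ i) (hi' : i ≤ N) (hj : 1 ≤ j)
    (hj' : j ≤ N) (h : i + 1 < j ∨ j + 1 < i) : Commute (r i) (r j) := by
  rcases h with h | h
  · exact H.comm i j hi h hj'
  · exact (H.comm j i hj h hi').symm

theorem IsHecke.cascade_mul_last (H : IsHecke N r) {j : ℕ} (hj : 1 ≤ j) (hjN : j ≤ N) :
    word r (cascadeIdx j N) * r N = word r (cascadeIdx j N) := by
  have h : cascadeIdx j N = List.range' j (N - j) ++ [N] := by
    rw [cascadeIdx, show N + 1 - j = (N - j) + 1 by omega, List.range'_concat]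
    simp; omega
  rw [h, word_append, word_cons, word_nil, mul_one, mul_assoc, H.idem N (by omega) le_rfl]

theorem IsHecke.cascade_mul (H : IsHecke N r) {j k : ℕ} (hj : 1 ≤ j) (hjk : j ≤ k) (hk : k < N) :
    word r (cascadeIdx j N) * r k = r (k + 1) * word r (cascadeIdx j N) := by
  have h : cascadeIdx j N = List.range' j (k - j) ++ k :: (k + 1) :: List.range' (k + 2) (N - k - 1)
      := by
    rw [cascadeIdx, show N + 1 - j = (k - j) + ((N - k - 1) + 1 + 1) by omega,
      ← List.range'_append_1, List.range'_succ, List.range'_succ]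
    simp only [show j + (k - j) = k by omega]
  have h1 : Commute (r k) (word r (List.range' (k + 2) (N - k - 1))) := by
    refine commute_word fun l hl => ?_
    rw [List.mem_range'_1] at hl
    exact H.commute (by omega) (by omega) (by omega) (by omega) (by omega)
  have h2 : Commute (r (k + 1)) (word r (List.range' j (k - j))) := by
    refine commute_word fun l hl => ?_
    rw [List.mem_range'_1] at hl
    exact H.commute (by omega) (by omega) (by omega) (by omega) (by omega)
  rw [h]
  simp only [word_append, word_cons]
  calc word r (List.range' j (k - j)) *
        (r k * (r (k + 1) * word r (List.range' (k + 2) (N - k - 1)))) * r k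
      = word r (List.range' j (k - j)) * (r k * r (k + 1) *
          (word r (List.range' (k + 2) (N - k - 1)) * r k)) := by simp only [mul_assoc]
    _ = word r (List.range' j (k - j)) * (r k * r (k + 1) * r k) *
          word r (List.range' (k + 2) (N - k - 1)) := by rw [← h1.eq]; simp only [mul_assoc]
    _ = word r (List.range' j (k - j)) * r (k + 1) * (r k * r (k + 1) *
          word r (List.range' (k + 2) (N - k - 1))) := by
        rw [H.braid k (by omega) (by omega)]; simp only [mul_assoc]
    _ = _ := by rw [← h2.eq]; simp only [mul_assoc]

theorem IsHecke.triangle_suffix_mul (H : IsHecke N r) (d : ℕ) : ∀ m k, m + d = N → 1 ≤ m → m ≤ k →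
    k ≤ N → word r ((List.range' m (d + 1)).reverse.flatMap fun k => cascadeIdx k N) * r k =
      word r ((List.range' m (d + 1)).reverse.flatMap fun k => cascadeIdx k N) := by
  induction d with
  | zero =>
    intro m k hm h1 hmk hk
    obtain rfl : k = N := by omega
    simpa using H.cascade_mul_last h1 (by omega)
  | succ d ih =>
    intro m k hm h1 hmk hk
    rw [List.range'_succ, List.reverse_cons, List.flatMap_append, word_append, mul_assoc]
    simp only [List.flatMap_cons, List.flatMap_nil, List.append_nil]
    rcases hk.lt_or_eq with hk' | rfl
    · rw [H.cascade_mul h1 hmk hk', ← mul_assoc,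
        ih (m + 1) (k + 1) (by omega) (by omega) (by omega) (by omega)]
    · rw [H.cascade_mul_last h1 (by omega)]

theorem IsHecke.triangle_mul (H : IsHecke N r) {k : ℕ} (hk : 1 ≤ k) (hk' : k ≤ N) :
    word r (triangleIdx N) * r k = word r (triangleIdx N) := by
  have := H.triangle_suffix_mul (N - 1) 1 k (by omega) le_rfl hk hk'
  rwa [show N - 1 + 1 = N by omega] at this

theorem IsHecke.shift_mul_cascade (H : IsHecke N r) {j s : ℕ} (hj : 1 ≤ j) (hs : j ≤ s) (L : ℕ)
    (hL : s + L ≤ N) : word r (List.range' (s + 1) L) * word r (cascadeIdx j N) =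
      word r (cascadeIdx j N) * word r (List.range' s L) := by
  induction L with
  | zero => simp
  | succ L ih =>
    rw [List.range'_concat, List.range'_concat, word_append, word_append, word_cons, word_cons,
      word_nil, mul_one, mul_one, one_mul, mul_assoc, show s + 1 + L = s + L + 1 by ring,
      ← H.cascade_mul hj (by omega) (by omega), ← mul_assoc, ih (by omega), mul_assoc]

/-- The cascades `C_{j,N} ⋯ C_{1,N}`. -/
def cascadesIdx (N j : ℕ) : List ℕ := (List.range' 1 j).reverse.flatMap fun k => cascadeIdx k N

theorem cascadesIdx_succ (N j : ℕ) :
    cascadesIdx N (j + 1) = cascadeIdx (j + 1) N ++ cascadesIdx N j := by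
  rw [cascadesIdx, List.range'_concat, List.reverse_append]
  simp [cascadesIdx, add_comm]

theorem IsHecke.shift_mul_cascades (H : IsHecke N r) {a : ℕ} (ha : 1 ≤ a) (L j : ℕ)
    (h : a + j + L ≤ N + 1) : word r (List.range' (a + j) L) * word r (cascadesIdx N j) =
      word r (cascadesIdx N j) * word r (List.range' a L) := by
  induction j with
  | zero => simp [cascadesIdx]
  | succ j ih =>
    rw [cascadesIdx_succ, word_append, ← mul_assoc, ← add_assoc,
      H.shift_mul_cascade (by omega) (by omega) L (by omega), mul_assoc, ih (by omega), mul_assoc]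

/-- The cascades `C_{k,N}` over decreasing `k ≤ j` of parity opposite to that of `N`. -/
def squareLeft (N j : ℕ) : List ℕ :=
  ((List.range' 1 j).reverse.filter fun k => k % 2 ≠ N % 2).flatMap (fun k => cascadeIdx k N)

/-- The cascades `C_{1,m}` over decreasing odd `m` with `N - j < m ≤ N`. -/
def squareRight (N j : ℕ) : List ℕ :=
  ((List.range' (N + 1 - j) j).reverse.filter fun k => k % 2 = 1).flatMap (fun k => cascadeIdx 1 k)

theorem squareIdx_eq (N : ℕ) : squareIdx N = squareLeft N N ++ squareRight N N := by
  rw [squareIdx, squareLeft, squareRight, show N + 1 - N = 1 by omega]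

theorem squareLeft_succ (N j : ℕ) : squareLeft N (j + 1) =
    (if (j + 1) % 2 ≠ N % 2 then cascadeIdx (j + 1) N else []) ++ squareLeft N j := by
  rw [squareLeft, List.range'_concat, List.reverse_append, squareLeft, add_comm 1]
  by_cases h : (j + 1) % 2 = N % 2 <;> simp [h]

theorem squareRight_succ {N j : ℕ} (h : j < N) : squareRight N (j + 1) =
    squareRight N j ++ (if (j + 1) % 2 ≠ N % 2 then [] else cascadeIdx 1 (N - j)) := by
  rw [squareRight, show N + 1 - (j + 1) = N - j by omega, List.range'_succ, List.reverse_cons,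
    List.filter_append, List.flatMap_append, squareRight, show N - j + 1 = N + 1 - j by omega]
  congr 1
  by_cases h' : (j + 1) % 2 = N % 2
  · simp [h', show (N - j) % 2 = 1 by omega]
  · simp [h', show (N - j) % 2 ≠ 1 by omega]

theorem IsHecke.cascades_eq (H : IsHecke N r) {j : ℕ} (hj : j ≤ N) :
    word r (cascadesIdx N j) = word r (squareLeft N j) * word r (squareRight N j) := by
  induction j with
  | zero => simp [cascadesIdx, squareLeft, squareRight]
  | succ j ih =>
    rw [squareLeft_succ, squareRight_succ (by omega)]
    split_ifs with h
    · rw [cascadesIdx_succ, word_append, ih (by omega)]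
      simp [mul_assoc]
    · have hs := H.shift_mul_cascades le_rfl (N - j) j (by omega)
      have e1 : cascadeIdx (j + 1) N = List.range' (1 + j) (N - j) := by
        rw [cascadeIdx, add_comm j]; congr 1; omega
      rw [cascadesIdx_succ, word_append, e1, hs, ih (by omega)]
      simp [cascadeIdx, mul_assoc]

theorem IsHecke.triangle_eq_square (H : IsHecke N r) :
    word r (triangleIdx N) = word r (squareIdx N) := by
  rw [squareIdx_eq, word_append, ← H.cascades_eq le_rfl, triangleIdx, cascadesIdx]

theorem IsHecke.reflect (H : IsHecke N r) : IsHecke N fun k => r (N + 1 - k) where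
  idem i h1 h2 := H.idem _ (by omega) (by omega)
  comm i j h1 h2 h3 := H.commute (by omega) (by omega) (by omega) (by omega) (by omega)
  braid i h1 h2 := by
    have := H.braid (N - i) (by omega) (by omega)
    rw [show N + 1 - i = N - i + 1 by omega, show N + 1 - (i + 1) = N - i by omega]
    exact this.symm

theorem IsHecke.triangle_five (H : IsHecke 5 r) : word r (triangleIdx 5) =
    word r [5, 4, 5, 3, 4, 5] * word r [2, 3, 1, 2] * word r [4, 3, 5, 4, 5] := by
  have h : triangleIdx 5 = [5, 4, 5, 3, 4, 5] ++ [2, 3] ++ [4, 5] ++ [1, 2, 3, 4, 5] := by decide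
  have h15 := H.comm 1 5 (by omega) (by omega) (by omega)
  have h14 := H.comm 1 4 (by omega) (by omega) (by omega)
  have h25 := H.comm 2 5 (by omega) (by omega) (by omega)
  have h24 := H.comm 2 4 (by omega) (by omega) (by omega)
  have h35 := H.comm 3 5 (by omega) (by omega) (by omega)
  have e : word r [4, 5] * word r [1, 2, 3, 4, 5] = word r [1, 2] * word r [4, 3, 5, 4, 5] := by
    simp only [word_cons, word_nil, mul_one]
    calc r 4 * r 5 * (r 1 * (r 2 * (r 3 * (r 4 * r 5))))
        = r 4 * (r 5 * r 1) * (r 2 * (r 3 * (r 4 * r 5))) := by simp only [mul_assoc]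
      _ = r 4 * r 1 * (r 5 * r 2) * (r 3 * (r 4 * r 5)) := by
          rw [← h15]; simp only [mul_assoc]
      _ = r 4 * r 1 * (r 2 * r 5) * (r 3 * (r 4 * r 5)) := by rw [h25]
      _ = r 1 * (r 4 * r 2) * (r 5 * r 3) * (r 4 * r 5) := by
          rw [← h14]; simp only [mul_assoc]
      _ = _ := by rw [← h24, ← h35]; simp only [mul_assoc]
  rw [h, word_append, word_append, mul_assoc, e, word_append]
  simp only [word_cons, word_nil, mul_one, mul_assoc]

end Word

section Blocks

open scoped Pointwise

variable {M P : Type*} [Monoid M] {B : ℕ → P → M} {N : ℕ}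

theorem blockProducts_eq_word (B : ℕ → P → M) (idx : List ℕ) :
    blockProducts B idx = word (fun k => Set.range (B k)) idx := by
  induction idx with
  | nil =>
    ext U
    simp only [blockProducts, List.map_eq_nil_iff, Set.mem_ofPred_eq, exists_eq_left, word_nil,
      List.map_nil, List.prod_nil, Set.mem_one]
    exact eq_comm
  | cons k l ih =>
    rw [word_cons, ← ih]
    ext U
    simp only [blockProducts, Set.mem_ofPred_eq, Set.mem_mul, Set.mem_range]
    constructor
    · rintro ⟨C, hC, rfl⟩
      cases C with
      | nil => simp at hC
      | cons g C =>
        simp only [List.map_cons, List.cons.injEq] at hC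
        exact ⟨B k g.2, ⟨g.2, rfl⟩, (C.map fun g => B g.1 g.2).prod, ⟨C, hC.2, rfl⟩,
          by simp [hC.1]⟩
    · rintro ⟨_, ⟨θ, rfl⟩, _, ⟨C, hC, rfl⟩, rfl⟩
      exact ⟨(k, θ) :: C, by simp [hC], by simp⟩

theorem one_mem_word {r : ℕ → Set M} {idx : List ℕ} (h : ∀ k ∈ idx, (1 : M) ∈ r k) :
    (1 : M) ∈ word r idx := by
  induction idx with
  | nil => simp
  | cons k l ih =>
    rw [word_cons]
    exact ⟨1, h k (by simp), 1, ih fun j hj => h j (by simp [hj]), one_mul 1⟩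

theorem word_subset_submonoid {r : ℕ → Set M} {idx : List ℕ} (S : Submonoid M)
    (h : ∀ k ∈ idx, r k ⊆ S) : word r idx ⊆ S := by
  induction idx with
  | nil => simp
  | cons k l ih =>
    rw [word_cons]
    rintro _ ⟨x, hx, y, hy, rfl⟩
    exact S.mul_mem (h k (by simp) hx) (ih (fun j hj => h j (by simp [hj])) hy)

theorem isCompact_word [TopologicalSpace M] [ContinuousMul M] {r : ℕ → Set M} {idx : List ℕ}
    (h : ∀ k ∈ idx, IsCompact (r k)) : IsCompact (word r idx) := by
  induction idx with
  | nil => simp [word]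
  | cons k l ih =>
    rw [word_cons]
    exact (h k (by simp)).mul (ih fun j hj => h j (by simp [hj]))

theorem set_mul_comm_of_commute {s t : Set M} (h : ∀ x ∈ s, ∀ y ∈ t, Commute x y) :
    s * t = t * s := by
  ext z
  constructor
  · rintro ⟨x, hx, y, hy, rfl⟩
    exact ⟨y, hy, x, hx, (h x hx y hy).symm⟩
  · rintro ⟨y, hy, x, hx, rfl⟩
    exact ⟨x, hx, y, hy, h x hx y hy⟩

theorem blockProducts_three (B : ℕ → P → M) (i k l : ℕ) :
    blockProducts B [i, k, l] = Set.range (B i) * Set.range (B k) * Set.range (B l) := by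
  rw [blockProducts_eq_word]
  simp only [word_cons, word_nil, mul_one, mul_assoc]

theorem mem_triangleIdx {N k : ℕ} (h : k ∈ triangleIdx N) : 1 ≤ k ∧ k ≤ N := by
  simp only [triangleIdx, cascadeIdx, List.mem_flatMap, List.mem_reverse, List.mem_range'_1] at h
  omega

theorem IsHecke.word_subset_triangle {r : ℕ → Set M} (H : IsHecke N r)
    (h1 : ∀ k, 1 ≤ k → k ≤ N → (1 : M) ∈ r k) {idx : List ℕ} (h : ∀ k ∈ idx, 1 ≤ k ∧ k ≤ N) :
    word r idx ⊆ word r (triangleIdx N) := by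
  have habs : word r (triangleIdx N) * word r idx = word r (triangleIdx N) := by
    induction idx with
    | nil => simp
    | cons k l ih =>
      rw [word_cons, ← mul_assoc, H.triangle_mul (h k (by simp)).1 (h k (by simp)).2,
        ih fun j hj => h j (by simp [hj])]
  intro x hx
  rw [← habs]
  exact ⟨1, one_mem_word fun k hk => h1 k (mem_triangleIdx hk).1 (mem_triangleIdx hk).2, x, hx,
    one_mul x⟩

theorem exists_mem_word_of_mem_closure {r : ℕ → Set M} {x : M}
    (hx : x ∈ Submonoid.closure {x | ∃ k, 1 ≤ k ∧ k ≤ N ∧ x ∈ r k}) :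
    ∃ idx : List ℕ, (∀ k ∈ idx, 1 ≤ k ∧ k ≤ N) ∧ x ∈ word r idx := by
  obtain ⟨l, hl, rfl⟩ := Submonoid.exists_list_of_mem_closure hx
  clear hx
  induction l with
  | nil => exact ⟨[], by simp⟩
  | cons y l ih =>
    obtain ⟨idx, hidx, hprod⟩ := ih fun z hz => hl z (by simp [hz])
    obtain ⟨k, hk1, hkN, hk⟩ := hl y (by simp)
    refine ⟨k :: idx, by simpa [hk1, hkN] using hidx, ?_⟩
    rw [word_cons, List.prod_cons]
    exact Set.mul_mem_mul hk hprod

theorem IsHecke.closure_eq_triangle {r : ℕ → Set M} (H : IsHecke N r)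
    (h1 : ∀ k, 1 ≤ k → k ≤ N → (1 : M) ∈ r k) :
    (Submonoid.closure {x | ∃ k, 1 ≤ k ∧ k ≤ N ∧ x ∈ r k} : Set M) = word r (triangleIdx N) := by
  apply Set.Subset.antisymm
  · intro x hx
    obtain ⟨idx, hidx, hword⟩ := exists_mem_word_of_mem_closure hx
    exact H.word_subset_triangle h1 hidx hword
  · exact word_subset_submonoid _ fun k hk x hx =>
      Submonoid.subset_closure ⟨k, (mem_triangleIdx hk).1, (mem_triangleIdx hk).2, hx⟩

end Blocks

/-! ### Size and depth of the triangle and of the square -/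

theorem length_cascadeIdx (i j : ℕ) : (cascadeIdx i j).length = j + 1 - i := by
  simp [cascadeIdx]

theorem length_cascadesIdx {N j : ℕ} (hj : j ≤ N) :
    2 * (cascadesIdx N j).length + j * j = j * (2 * N + 1) := by
  induction j with
  | zero => simp [cascadesIdx]
  | succ j ih =>
    rw [cascadesIdx_succ, List.length_append, length_cascadeIdx]
    have h1 := ih (by omega)
    obtain ⟨m, rfl⟩ : ∃ m, N = j + 1 + m := ⟨N - (j + 1), by omega⟩
    rw [show j + 1 + m + 1 - (j + 1) = m + 1 by omega]
    linarith

theorem length_triangleIdx (N : ℕ) : (triangleIdx N).length = (N + 1) * N / 2 := by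
  have h := length_cascadesIdx (le_refl N)
  have h2 : 2 * (triangleIdx N).length = (N + 1) * N := by
    change 2 * (cascadesIdx N N).length = _
    linarith
  omega

theorem length_square_parts {N j : ℕ} (hj : j ≤ N) :
    (squareLeft N j).length + (squareRight N j).length = (cascadesIdx N j).length := by
  induction j with
  | zero => simp [cascadesIdx, squareLeft, squareRight]
  | succ j ih =>
    have h1 := ih (by omega)
    rw [cascadesIdx_succ, squareLeft_succ, squareRight_succ (by omega)]
    simp only [List.length_append]
    split_ifs
    · simp only [length_cascadeIdx, List.length_nil]; omega
    · simp only [length_cascadeIdx, List.length_nil]; omega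

theorem length_squareIdx (N : ℕ) : (squareIdx N).length = (N + 1) * N / 2 := by
  rw [squareIdx_eq, List.length_append, length_square_parts le_rfl, ← length_triangleIdx]
  rfl

/-- For blocks encoded as pairs (index, layer): if `p` and `q` share a qubit, then `p` is in a
strictly earlier layer. -/
def LayerOrder (p q : ℕ × ℕ) : Prop := p.1 ≤ q.1 + 1 → q.1 ≤ p.1 + 1 → p.2 < q.2

theorem hasDepthLE_of_pairwise {L : List (ℕ × ℕ)} {d : ℕ} (h : L.Pairwise LayerOrder)
    (hd : ∀ p ∈ L, p.2 < d) : HasDepthLE (L.map Prod.fst) d := by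
  refine ⟨fun p => ⟨(L[p.1]'(by simpa using p.2)).2, hd _ (List.getElem_mem _)⟩, ?_⟩
  intro p q hpq h1 h2
  have hp : p.1 < L.length := by simpa using p.2
  have hq : q.1 < L.length := by simpa using q.2
  simp only [List.get_eq_getElem, List.getElem_map] at h1 h2
  exact List.pairwise_iff_getElem.1 h p.1 q.1 hp hq hpq h1 h2

theorem HasDepthLE.mono {idx : List ℕ} {d e : ℕ} (h : HasDepthLE idx d) (hde : d ≤ e) :
    HasDepthLE idx e := by
  obtain ⟨t, ht⟩ := h
  exact ⟨fun p => (t p).castLE hde, ht⟩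

theorem map_fst_labelled_flatMap (l : List ℕ) (f : ℕ → List ℕ) (t : ℕ → ℕ → ℕ) :
    (l.flatMap fun k => (f k).map fun j => (j, t k j)).map Prod.fst = l.flatMap f := by
  rw [List.map_flatMap]
  congr 1; funext k
  simp [Function.comp_def]

theorem pairwise_labelled_cascade {i j : ℕ} {t : ℕ → ℕ}
    (ht : ∀ a b, i ≤ a → a < b → b ≤ j → t a < t b) :
    ((cascadeIdx i j).map fun a => (a, t a)).Pairwise LayerOrder := by
  rw [List.pairwise_map, cascadeIdx]
  refine (List.pairwise_lt_range' (s := i) (n := j + 1 - i) 1).imp_of_mem ?_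
  intro a b ha hb hab _ _
  rw [List.mem_range'_1] at ha hb
  exact ht a b (by omega) hab (by omega)

theorem pairwise_gt_reverse_range' (s n : ℕ) :
    (List.range' s n).reverse.Pairwise fun a b => b < a :=
  List.pairwise_reverse.2 (List.pairwise_lt_range' 1)

theorem pairwise_labelled_flatMap {l : List ℕ} {f : ℕ → List ℕ} {t : ℕ → ℕ → ℕ}
    (hl : l.Pairwise fun a b => b < a)
    (hf : ∀ k ∈ l, ((f k).map fun a => (a, t k a)).Pairwise LayerOrder)
    (ht : ∀ k ∈ l, ∀ m ∈ l, m < k → ∀ a ∈ f k, ∀ b ∈ f m, LayerOrder (a, t k a) (b, t m b)) :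
    (l.flatMap fun k => (f k).map fun a => (a, t k a)).Pairwise LayerOrder := by
  refine List.pairwise_flatMap.2 ⟨hf, hl.imp_of_mem fun {k m} hk hm hkm => ?_⟩
  simp only [List.mem_map]
  rintro _ ⟨a, ha, rfl⟩ _ ⟨b, hb, rfl⟩
  exact ht k hk m hm hkm a ha b hb

theorem mem_cascadeIdx {i j k : ℕ} : k ∈ cascadeIdx i j ↔ i ≤ k ∧ k ≤ j := by
  rw [cascadeIdx, List.mem_range'_1]
  omega

-- Block `j` of the cascade `C_{k,N}` is executed in layer `N + j - 2k`.
theorem hasDepthLE_triangleIdx (N : ℕ) : HasDepthLE (triangleIdx N) (2 * N - 1) := by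
  rw [triangleIdx, ← map_fst_labelled_flatMap _ _ fun k j => N + j - 2 * k]
  apply hasDepthLE_of_pairwise
  · refine pairwise_labelled_flatMap (pairwise_gt_reverse_range' 1 N) ?_ ?_
    · intro k hk
      rw [List.mem_reverse, List.mem_range'_1] at hk
      exact pairwise_labelled_cascade fun a b _ _ _ => by omega
    · simp only [List.mem_reverse, List.mem_range'_1, mem_cascadeIdx, LayerOrder]
      omega
  · simp only [List.mem_flatMap, List.mem_reverse, List.mem_range'_1, List.mem_map, mem_cascadeIdx]
    rintro _ ⟨k, hk, a, ha, rfl⟩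
    dsimp only
    omega

-- Block `j` is executed in layer `j - k` of the cascade `C_{k,N}` in the left half of the square
-- and in layer `N - k + j` of the cascade `C_{1,k}` in the right half.
theorem hasDepthLE_squareIdx (N : ℕ) : HasDepthLE (squareIdx N) (N + 1) := by
  rw [squareIdx, ← map_fst_labelled_flatMap _ (fun k => cascadeIdx k N) fun k j => j - k,
    ← map_fst_labelled_flatMap _ (fun k => cascadeIdx 1 k) fun k j => N - k + j, ← List.map_append]
  apply hasDepthLE_of_pairwise
  · refine List.pairwise_append.2 ⟨?_, ?_, ?_⟩
    · refine pairwise_labelled_flatMap ((pairwise_gt_reverse_range' 1 N).filter _)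
        (fun k _ => pairwise_labelled_cascade fun a b _ _ _ => by omega) ?_
      simp only [List.mem_filter, List.mem_reverse, List.mem_range'_1, mem_cascadeIdx,
        decide_eq_true_eq, LayerOrder]
      omega
    · refine pairwise_labelled_flatMap ((pairwise_gt_reverse_range' 1 N).filter _)
        (fun k _ => pairwise_labelled_cascade fun a b _ _ _ => by omega) ?_
      simp only [List.mem_filter, List.mem_reverse, List.mem_range'_1, mem_cascadeIdx,
        decide_eq_true_eq, LayerOrder]
      omega
    · simp only [List.mem_flatMap, List.mem_filter, List.mem_reverse, List.mem_range'_1,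
        List.mem_map, mem_cascadeIdx, decide_eq_true_eq]
      rintro _ ⟨k, hk, a, ha, rfl⟩ _ ⟨m, hm, b, _, rfl⟩
      simp only [LayerOrder]
      omega
  · simp only [List.mem_append, List.mem_flatMap, List.mem_filter, List.mem_reverse,
      List.mem_range'_1, List.mem_map, mem_cascadeIdx]
    rintro _ (⟨k, hk, a, ha, rfl⟩ | ⟨k, hk, a, ha, rfl⟩) <;>
    · dsimp only
      omega

/-! ### Clifford generators and their bivectors -/

section Clifford

variable {𝔸 ι : Type*} [Ring 𝔸] {γ : ι → 𝔸} {S T W : Set ι} {a b c d u : ι}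

/-- The elements `γ a`, `a ∈ S`, are anticommuting involutions: generators of a Clifford algebra,
or Majorana operators. -/
structure IsClifford (γ : ι → 𝔸) (S : Set ι) : Prop where
  mul_self : ∀ {a}, a ∈ S → γ a * γ a = 1
  anticomm : ∀ {a b}, a ∈ S → b ∈ S → a ≠ b → γ a * γ b = -(γ b * γ a)

/-- The products `γ a * γ b` of distinct generators with labels in `W`. -/
def bivectors (γ : ι → 𝔸) (W : Set ι) : Set 𝔸 :=
  {x | ∃ a ∈ W, ∃ b ∈ W, a ≠ b ∧ γ a * γ b = x}

theorem mul_mem_bivectors (ha : a ∈ W) (hb : b ∈ W) (hab : a ≠ b) :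
    γ a * γ b ∈ bivectors γ W :=
  ⟨a, ha, b, hb, hab, rfl⟩

theorem bivectors_mono (h : S ⊆ T) : bivectors γ S ⊆ bivectors γ T := by
  rintro x ⟨a, ha, b, hb, hab, rfl⟩
  exact mul_mem_bivectors (h ha) (h hb) hab

theorem bivectors_union : bivectors γ (S ∪ T) = (bivectors γ S ∪ bivectors γ T) ∪
    {x | ∃ a b, (a ∈ S ∧ b ∈ T ∨ a ∈ T ∧ b ∈ S) ∧ a ≠ b ∧ γ a * γ b = x} := by
  ext x
  constructor
  · rintro ⟨a, ha | ha, b, hb | hb, hab, rfl⟩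
    · exact .inl (.inl (mul_mem_bivectors ha hb hab))
    · exact .inr ⟨a, b, .inl ⟨ha, hb⟩, hab, rfl⟩
    · exact .inr ⟨a, b, .inr ⟨ha, hb⟩, hab, rfl⟩
    · exact .inl (.inr (mul_mem_bivectors ha hb hab))
  · rintro ((hx | hx) | ⟨a, b, ⟨ha, hb⟩ | ⟨ha, hb⟩, hab, rfl⟩)
    · exact bivectors_mono Set.subset_union_left hx
    · exact bivectors_mono Set.subset_union_right hx
    · exact mul_mem_bivectors (.inl ha) (.inr hb) hab
    · exact mul_mem_bivectors (.inr ha) (.inl hb) hab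

namespace IsClifford

theorem mono (h : IsClifford γ T) (hST : S ⊆ T) : IsClifford γ S :=
  ⟨fun ha => h.mul_self (hST ha), fun ha hb => h.anticomm (hST ha) (hST hb)⟩

theorem mul_mul_cancel (h : IsClifford γ S) (ha : a ∈ S) (x : 𝔸) : γ a * (γ a * x) = x := by
  rw [← mul_assoc, h.mul_self ha, one_mul]

theorem commute_bivector (h : IsClifford γ S) (ha : a ∈ S) (hb : b ∈ S) (hc : c ∈ S)
    (hac : a ≠ c) (hbc : b ≠ c) : Commute (γ a * γ b) (γ c) := by
  rw [Commute, SemiconjBy, mul_assoc, h.anticomm hb hc hbc, mul_neg, ← mul_assoc,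
    h.anticomm ha hc hac, neg_mul, neg_neg, mul_assoc]

theorem commute_bivectors (h : IsClifford γ S) (ha : a ∈ S) (hb : b ∈ S) (hc : c ∈ S)
    (hd : d ∈ S) (hac : a ≠ c) (had : a ≠ d) (hbc : b ≠ c) (hbd : b ≠ d) :
    Commute (γ a * γ b) (γ c * γ d) :=
  (h.commute_bivector ha hb hc hac hbc).mul_right (h.commute_bivector ha hb hd had hbd)

theorem bivector_mul_left (h : IsClifford γ S) (ha : a ∈ S) (hb : b ∈ S) (hab : a ≠ b) :
    γ a * γ b * γ a = -γ b := by
  rw [h.anticomm ha hb hab, neg_mul, mul_assoc, h.mul_self ha, mul_one]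

theorem bivector_mul_right (h : IsClifford γ S) (hb : b ∈ S) : γ a * γ b * γ b = γ a := by
  rw [mul_assoc, h.mul_self hb, mul_one]

theorem bivector_mul_bivector (h : IsClifford γ S) (hb : b ∈ S) :
    γ a * γ b * (γ b * γ c) = γ a * γ c := by
  rw [mul_assoc, h.mul_mul_cancel hb]

theorem bivector_mul_self (h : IsClifford γ S) (ha : a ∈ S) (hb : b ∈ S) (hab : a ≠ b) :
    γ a * γ b * (γ a * γ b) = -1 := by
  rw [← mul_assoc, h.bivector_mul_left ha hb hab, neg_mul, h.mul_self hb]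

theorem isQuaternionPair (h : IsClifford γ S) (ha : a ∈ S) (hb : b ∈ S) (hc : c ∈ S)
    (hab : a ≠ b) (hbc : b ≠ c) (hac : a ≠ c) : IsQuaternionPair (γ a * γ b) (γ b * γ c) where
  left_mul_self := h.bivector_mul_self ha hb hab
  right_mul_self := h.bivector_mul_self hb hc hbc
  anticomm := by
    rw [h.bivector_mul_bivector hb, (h.commute_bivector hb hc ha hab.symm hac.symm).left_comm,
      h.bivector_mul_left hb hc hbc, mul_neg]

end IsClifford

theorem IsQuaternionPair.lie_eq {J K : 𝔸} (h : IsQuaternionPair J K) :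
    ⁅J, K⁆ = (2 : ℕ) • (J * K) := by
  rw [Ring.lie_def, h.anticomm, sub_neg_eq_add, two_nsmul]

end Clifford

section LieSpan

variable {L : Type*} [LieRing L] [LieAlgebra ℝ L] {s t : Set L}

theorem lie_mem_span (h : ∀ x ∈ s, ∀ y ∈ s, ⁅x, y⁆ ∈ Submodule.span ℝ s) {x y : L}
    (hx : x ∈ Submodule.span ℝ s) (hy : y ∈ Submodule.span ℝ s) :
    ⁅x, y⁆ ∈ Submodule.span ℝ s :=
  LinearMap.BilinMap.apply_apply_mem_of_mem_span (Submodule.span ℝ s) s s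
    (LieModule.toEnd ℝ L L).toLinearMap h x y hx hy

theorem lieSpan_toSubmodule_eq_span (h : ∀ x ∈ s, ∀ y ∈ s, ⁅x, y⁆ ∈ Submodule.span ℝ s)
    (hts : t ⊆ Submodule.span ℝ s) (hst : s ⊆ LieSubalgebra.lieSpan ℝ L t) :
    (LieSubalgebra.lieSpan ℝ L t).toSubmodule = Submodule.span ℝ s :=
  le_antisymm
    ((LieSubalgebra.lieSpan_le
      (K := { Submodule.span ℝ s with lie_mem' := fun hx hy => lie_mem_span h hx hy })).2 hts)
    (Submodule.span_le.2 hst)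

end LieSpan

section BivSpan

variable {𝔸 ι : Type*} [Ring 𝔸] [Algebra ℝ 𝔸] {γ : ι → 𝔸} {S V W : Set ι} {a b c d u : ι}

/-- The real span of the bivectors with labels in `W`, a copy of `𝔰𝔬(W)`. -/
def bivSpan (γ : ι → 𝔸) (W : Set ι) : Submodule ℝ 𝔸 :=
  Submodule.span ℝ (bivectors γ W)

theorem mul_mem_bivSpan (ha : a ∈ W) (hb : b ∈ W) (hab : a ≠ b) : γ a * γ b ∈ bivSpan γ W :=
  Submodule.subset_span (mul_mem_bivectors ha hb hab)

theorem bivSpan_mono (h : V ⊆ W) : bivSpan γ V ≤ bivSpan γ W :=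
  Submodule.span_mono (bivectors_mono h)

theorem bivSpan_pair (h : IsClifford γ {a, b}) (hab : a ≠ b) :
    bivSpan γ {a, b} = Submodule.span ℝ {γ a * γ b} := by
  have ha : a ∈ ({a, b} : Set ι) := .inl rfl
  have hb : b ∈ ({a, b} : Set ι) := .inr rfl
  refine le_antisymm (Submodule.span_le.2 ?_)
    (Submodule.span_le.2 (Set.singleton_subset_iff.2 (mul_mem_bivSpan ha hb hab)))
  have hmem := Submodule.mem_span_singleton_self (R := ℝ) (γ a * γ b)
  rintro _ ⟨c, rfl | rfl, d, rfl | rfl, hcd, rfl⟩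
  · exact absurd rfl hcd
  · exact hmem
  · rw [h.anticomm hb ha hcd]
    exact neg_mem hmem
  · exact absurd rfl hcd

namespace IsClifford

theorem lie_bivector_mem (h : IsClifford γ W) (ha : a ∈ W) (hb : b ∈ W) (hc : c ∈ W)
    (hab : a ≠ b) (hbc : b ≠ c) : ⁅γ a * γ b, γ b * γ c⁆ ∈ bivSpan γ W := by
  by_cases hac : a = c
  · subst hac
    rw [h.anticomm hb ha hbc, lie_neg, lie_self, neg_zero]
    exact zero_mem _
  · rw [(h.isQuaternionPair ha hb hc hab hbc hac).lie_eq, h.bivector_mul_bivector hb]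
    exact nsmul_mem (mul_mem_bivSpan ha hc hac) 2

theorem lie_bivectors_mem (h : IsClifford γ W) {x y : 𝔸} (hx : x ∈ bivectors γ W)
    (hy : y ∈ bivectors γ W) : ⁅x, y⁆ ∈ bivSpan γ W := by
  obtain ⟨a, ha, b, hb, hab, rfl⟩ := hx
  obtain ⟨c, hc, d, hd, hcd, rfl⟩ := hy
  by_cases hbc : b = c
  · subst hbc
    exact h.lie_bivector_mem ha hb hd hab hcd
  by_cases hbd : b = d
  · subst hbd
    rw [h.anticomm hc hb hcd, lie_neg]
    exact neg_mem (h.lie_bivector_mem ha hb hc hab hbc)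
  by_cases hac : a = c
  · subst hac
    rw [h.anticomm ha hb hab, neg_lie]
    exact neg_mem (h.lie_bivector_mem hb ha hd hab.symm hcd)
  by_cases had : a = d
  · subst had
    rw [h.anticomm ha hb hab, h.anticomm hc ha hcd, neg_lie, lie_neg, neg_neg]
    exact h.lie_bivector_mem hb ha hc hab.symm hac
  rw [(h.commute_bivectors ha hb hc hd hac had hbc hbd).lie_eq]
  exact zero_mem _

theorem bivectors_subset [LinearOrder ι] (h : IsClifford γ W) {M : Submodule ℝ 𝔸}
    (hM : ∀ a ∈ W, ∀ b ∈ W, a < b → γ a * γ b ∈ M) : bivectors γ W ⊆ M := by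
  rintro _ ⟨a, ha, b, hb, hab, rfl⟩
  rcases hab.lt_or_gt with hlt | hlt
  · exact hM a ha b hb hlt
  · rw [h.anticomm ha hb hab]
    exact neg_mem (hM b hb a ha hlt)

end IsClifford

end BivSpan

section Interval

variable {𝔸 : Type*} [Ring 𝔸] [Algebra ℝ 𝔸] {γ : ℕ → 𝔸} {p q : ℕ}

theorem IsClifford.bivector_mem_of_adjacent (h : IsClifford γ (Set.Icc p q))
    {L : LieSubalgebra ℝ 𝔸} (hL : ∀ k, p ≤ k → k + 1 ≤ q → γ k * γ (k + 1) ∈ L) {a b : ℕ}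
    (ha : p ≤ a) (hab : a < b) (hb : b ≤ q) : γ a * γ b ∈ L := by
  induction b, hab using Nat.le_induction with
  | base => exact hL a ha hb
  | succ b hab ih =>
    have haW : a ∈ Set.Icc p q := ⟨ha, by omega⟩
    have hbW : b ∈ Set.Icc p q := ⟨by omega, by omega⟩
    have hlie := L.lie_mem (ih (by omega)) (hL b hbW.1 hb)
    rw [(h.isQuaternionPair haW hbW ⟨by omega, hb⟩ (by omega) (by omega) (by omega)).lie_eq,
      h.bivector_mul_bivector hbW, ← Nat.cast_smul_eq_nsmul ℝ] at hlie
    exact (L.toSubmodule.smul_mem_iff (by norm_num)).1 hlie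

theorem IsClifford.lieSpan_eq_bivSpan (h : IsClifford γ (Set.Icc p q)) {t : Set 𝔸}
    (ht : t ⊆ bivSpan γ (Set.Icc p q))
    (hadj : ∀ k, p ≤ k → k + 1 ≤ q → γ k * γ (k + 1) ∈ t) :
    (LieSubalgebra.lieSpan ℝ 𝔸 t).toSubmodule = bivSpan γ (Set.Icc p q) :=
  lieSpan_toSubmodule_eq_span (fun _ hx _ hy => h.lie_bivectors_mem hx hy) ht <|
    h.bivectors_subset fun _ ha _ hb hab => h.bivector_mem_of_adjacent
      (fun k hk hk' => LieSubalgebra.subset_lieSpan (hadj k hk hk')) ha.1 hab hb.2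

end Interval

section Basis

variable {𝔸 ι κ : Type*} [Ring 𝔸] [Algebra ℝ 𝔸] {γ : ι → 𝔸} {S W : Set ι} {a b u : ι}

theorem IsClifford.sub_conj_bivector_eq_ite [DecidableEq ι] (h : IsClifford γ S) (ha : a ∈ S)
    (hb : b ∈ S) (hu : u ∈ S) (hab : a ≠ b) :
    γ a * γ b - γ u * (γ a * γ b) * γ u =
      if u = a ∨ u = b then (2 : ℝ) • (γ a * γ b) else 0 := by
  by_cases hua : u = a
  · subst hua
    rw [if_pos (.inl rfl), h.mul_mul_cancel hu, h.anticomm hb hu hab.symm, sub_neg_eq_add, two_smul]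
  by_cases hub : u = b
  · subst hub
    rw [if_pos (.inr rfl), mul_assoc, h.bivector_mul_right hu, h.anticomm hu ha hua,
      sub_neg_eq_add, two_smul]
  · rw [if_neg (by tauto), ← (h.commute_bivector ha hb hu (Ne.symm hua) (Ne.symm hub)).eq,
      mul_assoc, h.mul_self hu, mul_one, sub_self]

/-- Twice the projection onto the elements that anticommute with the involution `e`. -/
def oddPart (e : 𝔸) : 𝔸 →ₗ[ℝ] 𝔸 :=
  LinearMap.id - (LinearMap.mulRight ℝ e).comp (LinearMap.mulLeft ℝ e)

theorem oddPart_apply (e x : 𝔸) : oddPart e x = x - e * x * e := rfl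

theorem IsClifford.linearIndependent [Nontrivial 𝔸] (h : IsClifford γ S) {p q : κ → ι}
    (hp : ∀ k, p k ∈ S) (hq : ∀ k, q k ∈ S) (hpq : ∀ k, p k ≠ q k)
    (hinj : ∀ k l, (p l = p k ∨ p l = q k) → (q l = p k ∨ q l = q k) → k = l) :
    LinearIndependent ℝ fun k => γ (p k) * γ (q k) := by
  classical
  have hodd (k l) : oddPart (γ (q l)) (oddPart (γ (p l)) (γ (p k) * γ (q k))) =
      if k = l then (4 : ℝ) • (γ (p k) * γ (q k)) else 0 := by
    rw [oddPart_apply (γ (p l)), h.sub_conj_bivector_eq_ite (hp k) (hq k) (hp l) (hpq k)]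
    split_ifs with h₁ h₂ h₂
    · subst h₂
      rw [map_smul, oddPart_apply, h.sub_conj_bivector_eq_ite (hp k) (hq k) (hq k) (hpq k),
        if_pos (.inr rfl), smul_smul]
      norm_num
    · rw [map_smul, oddPart_apply, h.sub_conj_bivector_eq_ite (hp k) (hq k) (hq l) (hpq k),
        if_neg fun h₃ => h₂ (hinj k l h₁ h₃), smul_zero]
    · exact absurd (.inl (congrArg p h₂.symm)) h₁
    · exact map_zero _
  rw [linearIndependent_iff']
  intro s g hg l hl
  have hl' := congrArg (fun x => oddPart (γ (q l)) (oddPart (γ (p l)) x)) hg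
  simp only [map_sum, map_smul, hodd, map_zero, smul_ite, smul_zero, Finset.sum_ite_eq', hl,
    if_true, smul_smul] at hl'
  have hne : γ (p l) * γ (q l) ≠ 0 := fun h0 => by
    simpa [h0] using (h.bivector_mul_self (hp l) (hq l) (hpq l)).symm
  simpa [hne] using hl'

/-- The vectors `v` are, up to the signs `s`, the bivectors `γ a * γ b` with `a < b` in `W`. -/
structure IsBivBasis [LT ι] (γ : ι → 𝔸) (W : Set ι) (v : κ → 𝔸) (p q : κ → ι) (s : κ → ℝˣ) :
    Prop where
  eq : ∀ k, v k = s k • (γ (p k) * γ (q k))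
  left_mem : ∀ k, p k ∈ W
  right_mem : ∀ k, q k ∈ W
  lt : ∀ k, p k < q k
  inj : ∀ k l, p k = p l → q k = q l → k = l
  surj : ∀ a ∈ W, ∀ b ∈ W, a < b → ∃ k, p k = a ∧ q k = b

namespace IsBivBasis

variable [LinearOrder ι] {v : κ → 𝔸} {p q : κ → ι} {s : κ → ℝˣ}

theorem span_eq (hv : IsBivBasis γ W v p q s) (h : IsClifford γ W) :
    Submodule.span ℝ (Set.range v) = bivSpan γ W := by
  refine le_antisymm (Submodule.span_le.2 ?_) (Submodule.span_le.2 (h.bivectors_subset ?_))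
  · rintro _ ⟨k, rfl⟩
    rw [hv.eq]
    exact Submodule.smul_mem _ _ (mul_mem_bivSpan (hv.left_mem k) (hv.right_mem k) (hv.lt k).ne)
  · intro a ha b hb hab
    obtain ⟨k, rfl, rfl⟩ := hv.surj a ha b hb hab
    rw [← inv_smul_smul (s k) (γ (p k) * γ (q k)), ← hv.eq]
    exact Submodule.smul_mem _ _ (Submodule.subset_span ⟨k, rfl⟩)

theorem linearIndependent [Nontrivial 𝔸] (hv : IsBivBasis γ W v p q s) (h : IsClifford γ W) :
    LinearIndependent ℝ v := by
  have hinj (k l) (h₁ : p l = p k ∨ p l = q k) (h₂ : q l = p k ∨ q l = q k) : k = l := by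
    have hk := hv.lt k
    have hl := hv.lt l
    rcases h₁ with h₁ | h₁ <;> rcases h₂ with h₂ | h₂
    · exact absurd (h₁.trans h₂.symm) hl.ne
    · exact hv.inj k l h₁.symm h₂.symm
    · exact absurd (h₁ ▸ h₂ ▸ hl) hk.not_gt
    · exact absurd (h₁.trans h₂.symm) hl.ne
  have hvs : v = s • fun k => γ (p k) * γ (q k) := funext hv.eq
  rw [hvs]
  exact (h.linearIndependent hv.left_mem hv.right_mem (fun k => (hv.lt k).ne) hinj).units_smul s

end IsBivBasis

end Basis

theorem mem_span_union_and_apply_eq_iff {M : Type*} [AddCommGroup M] [Module ℝ M] (σ : M →ₗ[ℝ] M)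
    {s t : Set M} (hs : ∀ x ∈ s, σ x = x) (ht : ∀ x ∈ t, σ x = -x) (x : M) :
    (x ∈ Submodule.span ℝ (s ∪ t) ∧ σ x = x) ↔ x ∈ Submodule.span ℝ s := by
  constructor
  · rintro ⟨hx, hfix⟩
    have hle : Submodule.span ℝ (s ∪ t) ≤
        (Submodule.span ℝ s).comap (LinearMap.id + σ) := by
      refine Submodule.span_le.2 (Set.union_subset (fun y hy => ?_) fun y hy => ?_)
      · have hy' := Submodule.subset_span (R := ℝ) hy
        simpa [hs y hy] using add_mem hy' hy'
      · simp [ht y hy]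
    have hxx : x + x ∈ Submodule.span ℝ s := by simpa [hfix] using hle hx
    rw [← two_smul ℝ x] at hxx
    exact (Submodule.smul_mem_iff _ two_ne_zero).1 hxx
  · intro hx
    have hle : Submodule.span ℝ s ≤ LinearMap.eqLocus σ LinearMap.id := Submodule.span_le.2 hs
    exact ⟨Submodule.span_mono Set.subset_union_left hx, hle hx⟩

section Fixed

variable {𝔸 ι : Type*} [Ring 𝔸] [Algebra ℝ 𝔸] {γ : ι → 𝔸} {V W : Set ι} {T : 𝔸}

theorem mem_bivSpan_union_and_conj_eq_iff (hT : T * T = 1) (hV : ∀ a ∈ V, T * γ a * T = γ a)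
    (hW : ∀ a ∈ W, T * γ a * T = -γ a) (x : 𝔸) :
    (x ∈ bivSpan γ (V ∪ W) ∧ T * x * T = x) ↔ x ∈ bivSpan γ V ⊔ bivSpan γ W := by
  have hconj (y z : 𝔸) : T * (y * z) * T = T * y * T * (T * z * T) := by
    simp only [mul_assoc, ← mul_assoc T T, hT, one_mul]
  rw [bivSpan, bivectors_union, bivSpan, bivSpan, ← Submodule.span_union]
  refine mem_span_union_and_apply_eq_iff
    ((LinearMap.mulRight ℝ T).comp (LinearMap.mulLeft ℝ T)) ?_ ?_ x
  · rintro _ (⟨a, ha, b, hb, -, rfl⟩ | ⟨a, ha, b, hb, -, rfl⟩)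
    · exact (hconj _ _).trans (by rw [hV a ha, hV b hb])
    · exact (hconj _ _).trans (by rw [hW a ha, hW b hb, neg_mul_neg])
  · rintro _ ⟨a, b, ⟨ha, hb⟩ | ⟨ha, hb⟩, -, rfl⟩
    · exact (hconj _ _).trans (by rw [hV a ha, hW b hb, mul_neg])
    · exact (hconj _ _).trans (by rw [hW a ha, hV b hb, neg_mul])

end Fixed

/-! ### Pauli and Majorana operators -/

theorem tensorOp_mul {n : ℕ} (A B : Fin n → Matrix (Fin 2) (Fin 2) ℂ) :
    tensorOp A * tensorOp B = tensorOp fun j => A j * B j := by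
  ext s t
  simp only [tensorOp, Matrix.mul_apply, ← Finset.prod_mul_distrib]
  rw [Finset.prod_univ_sum]
  simp

theorem tensorOp_one {n : ℕ} : (tensorOp fun _ => 1 : Op n) = 1 := by
  ext s t
  simp only [tensorOp, Matrix.one_apply]
  by_cases h : s = t
  · simp [h]
  · obtain ⟨j, hj⟩ := Function.ne_iff.1 h
    rw [if_neg h]
    exact Finset.prod_eq_zero (Finset.mem_univ j) (if_neg hj)

theorem tensorOp_conjTranspose {n : ℕ} (A : Fin n → Matrix (Fin 2) (Fin 2) ℂ) :
    (tensorOp A).conjTranspose = tensorOp fun j => (A j).conjTranspose := by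
  ext s t
  simp [tensorOp, Matrix.conjTranspose_apply]

theorem tensorOp_commute {n : ℕ} {A B : Fin n → Matrix (Fin 2) (Fin 2) ℂ}
    (h : ∀ j, Commute (A j) (B j)) : Commute (tensorOp A) (tensorOp B) := by
  rw [Commute, SemiconjBy, tensorOp_mul, tensorOp_mul]
  exact congrArg tensorOp (funext fun j => h j)

theorem site_mul (n i : ℕ) (A B : Matrix (Fin 2) (Fin 2) ℂ) :
    site n i A * site n i B = site n i (A * B) := by
  rw [site, site, tensorOp_mul, site]
  congr 1; funext j; split_ifs <;> simp

theorem site_one (n i : ℕ) : site n i 1 = 1 := by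
  rw [site, ← tensorOp_one]
  congr 1; funext j; split_ifs <;> rfl

theorem site_commute {n i j : ℕ} (h : i ≠ j) (A B : Matrix (Fin 2) (Fin 2) ℂ) :
    Commute (site n i A) (site n j B) := by
  apply tensorOp_commute
  intro k
  split_ifs with h1 h2
  · omega
  · exact Commute.one_right _
  · exact Commute.one_left _
  · exact Commute.one_left _

theorem site_apply {n i : ℕ} (h1 : 1 ≤ i) (h2 : i ≤ n) (A : Matrix (Fin 2) (Fin 2) ℂ)
    (s t : Fin n → Fin 2) :
    site n i A s t = A (s ⟨i - 1, by omega⟩) (t ⟨i - 1, by omega⟩) *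
      ∏ j ∈ Finset.univ.erase (⟨i - 1, by omega⟩ : Fin n),
        (1 : Matrix (Fin 2) (Fin 2) ℂ) (s j) (t j) := by
  rw [site, tensorOp, ← Finset.mul_prod_erase _ _ (Finset.mem_univ (⟨i - 1, by omega⟩ : Fin n))]
  congr 1
  · rw [if_pos]; simp; omega
  · refine Finset.prod_congr rfl fun j hj => ?_
    rw [if_neg]
    intro h
    apply Finset.ne_of_mem_erase hj
    ext; simp; omega

theorem site_add {n i : ℕ} (h1 : 1 ≤ i) (h2 : i ≤ n) (A B : Matrix (Fin 2) (Fin 2) ℂ) :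
    site n i (A + B) = site n i A + site n i B := by
  ext s t
  simp only [site_apply h1 h2, Matrix.add_apply, add_mul]

theorem site_smul {n i : ℕ} (h1 : 1 ≤ i) (h2 : i ≤ n) (c : ℂ) (A : Matrix (Fin 2) (Fin 2) ℂ) :
    site n i (c • A) = c • site n i A := by
  ext s t
  simp only [site_apply h1 h2, Matrix.smul_apply, smul_eq_mul, mul_assoc]

theorem site_conjTranspose (n i : ℕ) (A : Matrix (Fin 2) (Fin 2) ℂ) :
    (site n i A).conjTranspose = site n i A.conjTranspose := by
  rw [site, tensorOp_conjTranspose, site]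
  congr 1; funext j; split_ifs <;> simp

theorem pX_mul_pX : pX * pX = 1 := by
  ext i j; fin_cases i <;> fin_cases j <;> simp [pX, Matrix.mul_apply]

theorem pY_mul_pY : pY * pY = 1 := by
  ext i j; fin_cases i <;> fin_cases j <;> simp [pY, Matrix.mul_apply]

theorem pZ_mul_pZ : pZ * pZ = 1 := by
  ext i j; fin_cases i <;> fin_cases j <;> simp [pZ, Matrix.mul_apply]

theorem pX_mul_pY : pX * pY = Complex.I • pZ := by
  ext i j; fin_cases i <;> fin_cases j <;> simp [pX, pY, pZ, Matrix.mul_apply]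

theorem pY_mul_pX : pY * pX = (-Complex.I) • pZ := by
  ext i j; fin_cases i <;> fin_cases j <;> simp [pX, pY, pZ, Matrix.mul_apply]

theorem pY_mul_pZ : pY * pZ = Complex.I • pX := by
  ext i j; fin_cases i <;> fin_cases j <;> simp [pX, pY, pZ, Matrix.mul_apply]

theorem pZ_mul_pY : pZ * pY = (-Complex.I) • pX := by
  ext i j; fin_cases i <;> fin_cases j <;> simp [pX, pY, pZ, Matrix.mul_apply]

theorem pX_mul_pZ : pX * pZ = (-Complex.I) • pY := by
  ext i j; fin_cases i <;> fin_cases j <;> simp [pX, pY, pZ, Matrix.mul_apply]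

theorem pZ_mul_pX : pZ * pX = Complex.I • pY := by
  ext i j; fin_cases i <;> fin_cases j <;> simp [pX, pY, pZ, Matrix.mul_apply]

theorem pX_conjTranspose : pX.conjTranspose = pX := by
  ext i j; fin_cases i <;> fin_cases j <;> simp [pX, Matrix.conjTranspose_apply]

theorem pY_conjTranspose : pY.conjTranspose = pY := by
  ext i j; fin_cases i <;> fin_cases j <;> simp [pY, Matrix.conjTranspose_apply]

theorem pZ_conjTranspose : pZ.conjTranspose = pZ := by
  ext i j; fin_cases i <;> fin_cases j <;> simp [pZ, Matrix.conjTranspose_apply]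

/-- The Jordan–Wigner string `Z_1 ⋯ Z_{j-1}`. -/
def zString (n j : ℕ) : Op n := tensorOp fun k => if (k : ℕ) + 1 < j then pZ else 1

theorem zString_mul_self (n j : ℕ) : zString n j * zString n j = 1 := by
  rw [zString, tensorOp_mul, ← tensorOp_one]
  congr 1; funext k; split_ifs
  · exact pZ_mul_pZ
  · exact one_mul 1

theorem zString_commute (n i j : ℕ) : Commute (zString n i) (zString n j) := by
  apply tensorOp_commute
  intro k
  split_ifs
  · exact Commute.refl _
  · exact Commute.one_right _
  · exact Commute.one_left _
  · exact Commute.one_left _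

theorem zString_commute_site {n i j : ℕ} (h : j ≤ i) (A : Matrix (Fin 2) (Fin 2) ℂ) :
    Commute (zString n j) (site n i A) := by
  apply tensorOp_commute
  intro k
  split_ifs
  · omega
  · exact Commute.one_right _
  · exact Commute.one_left _
  · exact Commute.one_left _

theorem zString_succ (n j : ℕ) : zString n (j + 1) = zString n j * Z n j := by
  rw [Z, site, zString, zString, tensorOp_mul]
  congr 1; funext k
  split_ifs <;> first | omega | simp

theorem zString_conjTranspose (n j : ℕ) : (zString n j).conjTranspose = zString n j := by
  rw [zString, tensorOp_conjTranspose]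
  congr 1; funext k; split_ifs
  · exact pZ_conjTranspose
  · simp

theorem site_mul_zString {n i j : ℕ} (h1 : 1 ≤ i) (h2 : i ≤ n) (h : i < j)
    {A : Matrix (Fin 2) (Fin 2) ℂ} (hA : A * pZ = (-1 : ℂ) • (pZ * A)) :
    site n i A * zString n j = -(zString n j * site n i A) := by
  induction j, h using Nat.le_induction with
  | base =>
    rw [zString_succ, ← mul_assoc, ← (zString_commute_site le_rfl A).eq, mul_assoc, Z, site_mul, hA,
      site_smul h1 h2, ← site_mul]
    simp [mul_assoc]
  | succ j hj ih =>
    rw [zString_succ, ← mul_assoc, ih, neg_mul, mul_assoc, mul_assoc, Z,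
      (site_commute (by omega : i ≠ j) A pZ).eq]

/-- The string operator `Z_1 ⋯ Z_{j-1} A_j`. -/
def strOp (n j : ℕ) (A : Matrix (Fin 2) (Fin 2) ℂ) : Op n := zString n j * site n j A

theorem strOp_mul_strOp_self (n j : ℕ) (A B : Matrix (Fin 2) (Fin 2) ℂ) :
    strOp n j A * strOp n j B = site n j (A * B) := by
  rw [strOp, strOp, (zString_commute_site le_rfl A).eq, mul_assoc, ← mul_assoc (zString n j),
    zString_mul_self, one_mul, site_mul]

theorem strOp_anticomm {n i j : ℕ} (h1 : 1 ≤ i) (h2 : i ≤ n) (h : i < j)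
    {A B : Matrix (Fin 2) (Fin 2) ℂ} (hA : A * pZ = (-1 : ℂ) • (pZ * A)) :
    strOp n i A * strOp n j B = -(strOp n j B * strOp n i A) := by
  calc strOp n i A * strOp n j B
      = zString n i * (site n i A * zString n j) * site n j B := by simp only [strOp, mul_assoc]
    _ = -(zString n i * zString n j * (site n i A * site n j B)) := by
        rw [site_mul_zString h1 h2 h hA]; simp [mul_assoc]
    _ = -(zString n j * (zString n i * site n j B) * site n i A) := by
        rw [(zString_commute n i j).eq, (site_commute h.ne A B).eq]; simp only [mul_assoc]
    _ = _ := by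
        rw [(zString_commute_site h.le B).eq]; simp only [strOp, mul_assoc]

/-- The Majorana operators `γ_1, …, γ_{2n}`: `γ_{2j-1} = Z_1 ⋯ Z_{j-1} X_j` and
`γ_{2j} = Z_1 ⋯ Z_{j-1} Y_j`. -/
def maj (n a : ℕ) : Op n := if a % 2 = 1 then strOp n ((a + 1) / 2) pX else strOp n (a / 2) pY

theorem maj_odd (n j : ℕ) : maj n (2 * j + 1) = strOp n (j + 1) pX := by
  rw [maj, if_pos (by omega)]; congr 1; omega

theorem maj_even (n j : ℕ) : maj n (2 * j + 2) = strOp n (j + 1) pY := by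
  rw [maj, if_neg (by omega)]; congr 1; omega

theorem maj_mul_self (n a : ℕ) : maj n a * maj n a = 1 := by
  rw [maj]
  split_ifs
  · rw [strOp_mul_strOp_self, pX_mul_pX, site_one]
  · rw [strOp_mul_strOp_self, pY_mul_pY, site_one]

theorem maj_mul_maj_of_lt {n a b : ℕ} (h1 : 1 ≤ a) (h : a < b) (h2 : b ≤ 2 * n) :
    maj n a * maj n b = -(maj n b * maj n a) := by
  have hX : pX * pZ = (-1 : ℂ) • (pZ * pX) := by rw [pX_mul_pZ, pZ_mul_pX]; simp
  have hY : pY * pZ = (-1 : ℂ) • (pZ * pY) := by rw [pY_mul_pZ, pZ_mul_pY]; simp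
  rw [maj, maj]
  split_ifs with ha hb hb
  · exact strOp_anticomm (by omega) (by omega) (by omega) hX
  · rcases Nat.lt_or_ge ((a + 1) / 2) (b / 2) with h' | h'
    · exact strOp_anticomm (by omega) (by omega) h' hX
    · have : (a + 1) / 2 = b / 2 := by omega
      rw [this, strOp_mul_strOp_self, strOp_mul_strOp_self, pX_mul_pY, pY_mul_pX,
        site_smul (by omega) (by omega), site_smul (by omega) (by omega)]
      simp
  · exact strOp_anticomm (by omega) (by omega) (by omega) hY
  · exact strOp_anticomm (by omega) (by omega) (by omega) hY

theorem isClifford_maj (n : ℕ) : IsClifford (maj n) (Set.Icc 1 (2 * n)) where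
  mul_self _ := maj_mul_self n _
  anticomm := by
    intro a b ha hb hab
    rcases hab.lt_or_gt with hlt | hlt
    · exact maj_mul_maj_of_lt ha.1 hlt hb.2
    · rw [maj_mul_maj_of_lt hb.1 hlt ha.2, neg_neg]

theorem isClifford_maj_Icc {n p q : ℕ} (hp : 1 ≤ p) (hq : q ≤ 2 * n) :
    IsClifford (maj n) (Set.Icc p q) :=
  (isClifford_maj n).mono (Set.Icc_subset_Icc hp hq)

theorem strOp_mul_strOp_succ (n j : ℕ) (A B : Matrix (Fin 2) (Fin 2) ℂ) :
    strOp n j A * strOp n (j + 1) B = site n j (A * pZ) * site n (j + 1) B := by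
  rw [strOp, strOp, zString_succ, (zString_commute_site le_rfl A).eq, ← site_mul, Z]
  simp only [mul_assoc]
  rw [← mul_assoc (zString n j) (zString n j), zString_mul_self, one_mul]

theorem strOp_mul_strOp_add_two (n j : ℕ) (A B : Matrix (Fin 2) (Fin 2) ℂ) :
    strOp n j A * strOp n (j + 2) B = site n j (A * pZ) * Z n (j + 1) * site n (j + 2) B := by
  rw [strOp, strOp, zString_succ, zString_succ, (zString_commute_site le_rfl A).eq, ← site_mul, Z,
    Z]
  simp only [mul_assoc]
  rw [← mul_assoc (zString n j) (zString n j), zString_mul_self, one_mul]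

variable {n j : ℕ}

theorem I_smul_Z (hj : j < n) :
    Complex.I • Z n (j + 1) = maj n (2 * j + 1) * maj n (2 * j + 2) := by
  rw [maj_odd, maj_even, strOp_mul_strOp_self, pX_mul_pY, site_smul (by omega) (by omega), Z]

theorem I_smul_XX (hj : j + 1 < n) : Complex.I • (X n (j + 1) * X n (j + 2)) =
    maj n (2 * j + 2) * maj n (2 * j + 3) := by
  rw [maj_even, show 2 * j + 3 = 2 * (j + 1) + 1 by ring, maj_odd, strOp_mul_strOp_succ, pY_mul_pZ,
    site_smul (by omega) (by omega), smul_mul_assoc, X, X]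

theorem I_smul_XY (hj : j + 1 < n) : Complex.I • (X n (j + 1) * Y n (j + 2)) =
    maj n (2 * j + 2) * maj n (2 * j + 4) := by
  rw [maj_even, show 2 * j + 4 = 2 * (j + 1) + 2 by ring, maj_even, strOp_mul_strOp_succ, pY_mul_pZ,
    site_smul (by omega) (by omega), smul_mul_assoc, X, Y]

theorem I_smul_YX (hj : j + 1 < n) : Complex.I • (Y n (j + 1) * X n (j + 2)) =
    -(maj n (2 * j + 1) * maj n (2 * j + 3)) := by
  rw [maj_odd, show 2 * j + 3 = 2 * (j + 1) + 1 by ring, maj_odd, strOp_mul_strOp_succ, pX_mul_pZ,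
    site_smul (by omega) (by omega), smul_mul_assoc, X, Y, neg_smul, neg_neg]

theorem I_smul_YY (hj : j + 1 < n) : Complex.I • (Y n (j + 1) * Y n (j + 2)) =
    -(maj n (2 * j + 1) * maj n (2 * j + 4)) := by
  rw [maj_odd, show 2 * j + 4 = 2 * (j + 1) + 2 by ring, maj_even, strOp_mul_strOp_succ, pX_mul_pZ,
    site_smul (by omega) (by omega), smul_mul_assoc, Y, Y, neg_smul, neg_neg]

theorem I_smul_XZX (hj : j + 2 < n) : Complex.I • (X n (j + 1) * Z n (j + 2) * X n (j + 3)) =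
    maj n (2 * j + 2) * maj n (2 * j + 5) := by
  rw [maj_even, show 2 * j + 5 = 2 * (j + 2) + 1 by ring, maj_odd, strOp_mul_strOp_add_two,
    pY_mul_pZ, site_smul (by omega) (by omega), smul_mul_assoc, smul_mul_assoc, X, X]

theorem I_smul_XZY (hj : j + 2 < n) : Complex.I • (X n (j + 1) * Z n (j + 2) * Y n (j + 3)) =
    maj n (2 * j + 2) * maj n (2 * j + 6) := by
  rw [maj_even, show 2 * j + 6 = 2 * (j + 2) + 2 by ring, maj_even, strOp_mul_strOp_add_two,
    pY_mul_pZ, site_smul (by omega) (by omega), smul_mul_assoc, smul_mul_assoc, X, Y]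

theorem I_smul_YZX (hj : j + 2 < n) : Complex.I • (Y n (j + 1) * Z n (j + 2) * X n (j + 3)) =
    -(maj n (2 * j + 1) * maj n (2 * j + 5)) := by
  rw [maj_odd, show 2 * j + 5 = 2 * (j + 2) + 1 by ring, maj_odd, strOp_mul_strOp_add_two,
    pX_mul_pZ, site_smul (by omega) (by omega), smul_mul_assoc, smul_mul_assoc, X, Y, neg_smul,
    neg_neg]

theorem I_smul_YZY (hj : j + 2 < n) : Complex.I • (Y n (j + 1) * Z n (j + 2) * Y n (j + 3)) =
    -(maj n (2 * j + 1) * maj n (2 * j + 6)) := by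
  rw [maj_odd, show 2 * j + 6 = 2 * (j + 2) + 2 by ring, maj_even, strOp_mul_strOp_add_two,
    pX_mul_pZ, site_smul (by omega) (by omega), smul_mul_assoc, smul_mul_assoc, Y, Y, neg_smul,
    neg_neg]

theorem isBivBasis_of_offset {𝔸 : Type*} [Ring 𝔸] [Algebra ℝ 𝔸] {γ : ℕ → 𝔸} {o w m : ℕ}
    {v : Fin m → 𝔸} {p q : Fin m → ℕ} {s : Fin m → ℝˣ}
    (heq : ∀ k, v k = s k • (γ (o + p k) * γ (o + q k)))
    (hlt : ∀ k, 1 ≤ p k ∧ p k < q k ∧ q k ≤ w) (hinj : ∀ k l, p k = p l → q k = q l → k = l)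
    (hsurj : ∀ b < w + 1, ∀ a < b, 1 ≤ a → ∃ k, p k = a ∧ q k = b) :
    IsBivBasis γ (Set.Icc (o + 1) (o + w)) v (fun k => o + p k) (fun k => o + q k) s where
  eq := heq
  left_mem k := by have := hlt k; exact ⟨by omega, by omega⟩
  right_mem k := by have := hlt k; exact ⟨by omega, by omega⟩
  lt k := by have := hlt k; omega
  inj k l hp hq := hinj k l (by omega) (by omega)
  surj := by
    rintro a ⟨ha, -⟩ b ⟨-, hb⟩ hab
    obtain ⟨k, hp, hq⟩ := hsurj (b - o) (by omega) (a - o) (by omega) (by omega)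
    exact ⟨k, by omega, by omega⟩

theorem isBivBasis_g2Basis (hj : j + 1 < n) :
    IsBivBasis (maj n) (Set.Icc (2 * j + 1) (2 * j + 4)) (g2Basis n (j + 1))
      (fun k => 2 * j + ![2, 1, 2, 1, 1, 3] k) (fun k => 2 * j + ![3, 4, 4, 3, 2, 4] k)
      ![1, -1, 1, -1, 1, 1] := by
  refine isBivBasis_of_offset (fun k => ?_) (by decide) (by decide) (by decide)
  have hZ := I_smul_Z (n := n) (j := j + 1) (by omega)
  simp only [mul_add, add_assoc, Nat.reduceAdd, Nat.reduceMul] at hZ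
  fin_cases k <;> simp [g2Basis, I_smul_XX hj, I_smul_YY hj, I_smul_XY hj, I_smul_YX hj,
    I_smul_Z (show j < n by omega), hZ]

theorem isBivBasis_g3Basis (hj : j + 2 < n) :
    IsBivBasis (maj n) (Set.Icc (2 * j + 1) (2 * j + 6)) (g3Basis n (j + 1))
      (fun k => 2 * j + ![2, 1, 2, 1, 4, 3, 4, 3, 1, 3, 5, 2, 2, 1, 1] k)
      (fun k => 2 * j + ![3, 4, 4, 3, 5, 6, 6, 5, 2, 4, 6, 5, 6, 5, 6] k)
      ![1, -1, 1, -1, 1, -1, 1, -1, 1, 1, 1, 1, 1, -1, -1] := by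
  refine isBivBasis_of_offset (fun k => ?_) (by decide) (by decide) (by decide)
  have hj' : j + 1 < n := by omega
  have hZ := I_smul_Z (n := n) (j := j + 1) (by omega)
  have hZ' := I_smul_Z (n := n) (j := j + 2) (by omega)
  have hXX := I_smul_XX (n := n) (j := j + 1) (by omega)
  have hYY := I_smul_YY (n := n) (j := j + 1) (by omega)
  have hXY := I_smul_XY (n := n) (j := j + 1) (by omega)
  have hYX := I_smul_YX (n := n) (j := j + 1) (by omega)
  simp only [mul_add, add_assoc, Nat.reduceAdd, Nat.reduceMul] at hZ hZ' hXX hYY hXY hYX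
  fin_cases k <;> simp [g3Basis, I_smul_XX hj', I_smul_YY hj', I_smul_XY hj', I_smul_YX hj',
    I_smul_Z (show j < n by omega), hZ, hZ', hXX, hYY, hXY, hYX, I_smul_XZX hj, I_smul_XZY hj,
    I_smul_YZX hj, I_smul_YZY hj, add_assoc]

theorem linearIndependent_g2Basis (hj : j + 1 < n) : LinearIndependent ℝ (g2Basis n (j + 1)) :=
  (isBivBasis_g2Basis hj).linearIndependent (isClifford_maj_Icc (by omega) (by omega))

theorem linearIndependent_g3Basis (hj : j + 2 < n) : LinearIndependent ℝ (g3Basis n (j + 1)) :=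
  (isBivBasis_g3Basis hj).linearIndependent (isClifford_maj_Icc (by omega) (by omega))

theorem exponents_subset_bivSpan (hj : j + 1 < n) :
    exponents n (j + 1) ⊆ bivSpan (maj n) (Set.Icc (2 * j + 1) (2 * j + 4)) := by
  rw [← (isBivBasis_g2Basis hj).span_eq (isClifford_maj_Icc (by omega) (by omega))]
  have hmem (k) : g2Basis n (j + 1) k ∈ Submodule.span ℝ (Set.range (g2Basis n (j + 1))) :=
    Submodule.subset_span ⟨k, rfl⟩
  rintro x (rfl | rfl | rfl | rfl)
  · exact hmem 4
  · exact hmem 5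
  · exact hmem 0
  · exact hmem 1

theorem maj_mul_maj_succ_mem_exponents (hj : j + 1 < n) {k : ℕ} (h1 : 2 * j + 1 ≤ k)
    (h2 : k + 1 ≤ 2 * j + 4) : maj n k * maj n (k + 1) ∈ exponents n (j + 1) := by
  obtain rfl | rfl | rfl : k = 2 * j + 1 ∨ k = 2 * j + 2 ∨ k = 2 * (j + 1) + 1 := by omega
  · rw [← I_smul_Z (by omega)]; simp [exponents]
  · rw [← I_smul_XX hj]; simp [exponents]
  · rw [← I_smul_Z (by omega)]; simp [exponents]

theorem g2_toSubmodule (hj : j + 1 < n) :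
    (g2 n (j + 1)).toSubmodule = bivSpan (maj n) (Set.Icc (2 * j + 1) (2 * j + 4)) :=
  (isClifford_maj_Icc (by omega) (by omega)).lieSpan_eq_bivSpan (exponents_subset_bivSpan hj)
    fun _ h1 h2 => maj_mul_maj_succ_mem_exponents hj h1 h2

theorem g3_toSubmodule (hj : j + 2 < n) :
    (g3 n (j + 1)).toSubmodule = bivSpan (maj n) (Set.Icc (2 * j + 1) (2 * j + 6)) := by
  refine (isClifford_maj_Icc (by omega) (by omega)).lieSpan_eq_bivSpan
    (Set.union_subset ?_ ?_) fun k h1 h2 => ?_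
  · exact (exponents_subset_bivSpan (by omega)).trans
      (bivSpan_mono (Set.Icc_subset_Icc le_rfl (by omega)))
  · exact (exponents_subset_bivSpan (j := j + 1) (by omega)).trans
      (bivSpan_mono (Set.Icc_subset_Icc (by omega) (by omega)))
  · rcases Nat.lt_or_ge k (2 * j + 4) with h | h
    · exact .inl (maj_mul_maj_succ_mem_exponents (by omega) h1 (by omega))
    · exact .inr (maj_mul_maj_succ_mem_exponents (j := j + 1) (by omega) (by omega) (by omega))

theorem g2_toSubmodule_eq_span (hj : j + 1 < n) :
    (g2 n (j + 1)).toSubmodule = Submodule.span ℝ (Set.range (g2Basis n (j + 1))) := by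
  rw [g2_toSubmodule hj,
    (isBivBasis_g2Basis hj).span_eq (isClifford_maj_Icc (by omega) (by omega))]

theorem g3_toSubmodule_eq_span (hj : j + 2 < n) :
    (g3 n (j + 1)).toSubmodule = Submodule.span ℝ (Set.range (g3Basis n (j + 1))) := by
  rw [g3_toSubmodule hj,
    (isBivBasis_g3Basis hj).span_eq (isClifford_maj_Icc (by omega) (by omega))]

theorem g2Basis_mem_g2 (hj : j + 1 < n) (k : Fin 6) : g2Basis n (j + 1) k ∈ g2 n (j + 1) := by
  rw [← LieSubalgebra.mem_toSubmodule, g2_toSubmodule_eq_span hj]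
  exact Submodule.subset_span ⟨k, rfl⟩

theorem mem_bivSpan_insert_and_conj_eq_iff {V : Set ℕ} {u v : ℕ}
    (h : IsClifford (maj n) (V ∪ {u, v})) (hu : u ∉ V) (hv : v ∉ V) (huv : u ≠ v) {T : Op n}
    (hT : Complex.I • T = maj n u * maj n v) (x : Op n) :
    (x ∈ bivSpan (maj n) (V ∪ {u, v}) ∧ T * x * T = x) ↔
      x ∈ bivSpan (maj n) V ⊔ Submodule.span ℝ {Complex.I • T} := by
  have hu' : u ∈ V ∪ {u, v} := .inr (.inl rfl)
  have hv' : v ∈ V ∪ {u, v} := .inr (.inr rfl)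
  have hconj (y : Op n) : T * y * T = -(maj n u * maj n v * y * (maj n u * maj n v)) := by
    simp [← hT, smul_smul]
  rw [hT, ← bivSpan_pair (h.mono Set.subset_union_right) huv]
  refine mem_bivSpan_union_and_conj_eq_iff ?_ (fun a ha => ?_) (fun a ha => ?_) x
  · simpa [h.bivector_mul_self hu' hv' huv] using hconj 1
  · rw [hconj, (h.commute_bivector hu' hv' (.inl ha) (ne_of_mem_of_not_mem ha hu).symm
      (ne_of_mem_of_not_mem ha hv).symm).eq, mul_assoc, h.bivector_mul_self hu' hv' huv, mul_neg,
      mul_one, neg_neg]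
  · rw [hconj]
    rcases ha with rfl | rfl
    · rw [h.bivector_mul_left hu' hv' huv, neg_mul, h.anticomm hu' hv' huv, mul_neg,
        h.mul_mul_cancel hv', neg_neg]
    · rw [h.bivector_mul_right hv', h.mul_mul_cancel hu']

theorem fixedPoints_g3_right (hj : j + 2 < n) (x : Op n) :
    (x ∈ g3 n (j + 1) ∧ Z n (j + 3) * x * Z n (j + 3) = x) ↔
      x ∈ (g2 n (j + 1)).toSubmodule ⊔ Submodule.span ℝ {Complex.I • Z n (j + 3)} := by
  have hW : Set.Icc (2 * j + 1) (2 * j + 6) =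
      Set.Icc (2 * j + 1) (2 * j + 4) ∪ {2 * j + 5, 2 * j + 6} := by
    ext a
    simp only [Set.mem_union, Set.mem_Icc, Set.mem_insert_iff, Set.mem_singleton_iff]
    omega
  rw [← LieSubalgebra.mem_toSubmodule, g3_toSubmodule hj, g2_toSubmodule (by omega), hW]
  exact mem_bivSpan_insert_and_conj_eq_iff (hW ▸ isClifford_maj_Icc (by omega) (by omega))
    (by simp only [Set.mem_Icc]; omega) (by simp only [Set.mem_Icc]; omega) (by omega)
    (I_smul_Z (j := j + 2) (by omega)) x

theorem fixedPoints_g3_left (hj : j + 2 < n) (x : Op n) :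
    (x ∈ g3 n (j + 1) ∧ Z n (j + 1) * x * Z n (j + 1) = x) ↔
      x ∈ (g2 n (j + 2)).toSubmodule ⊔ Submodule.span ℝ {Complex.I • Z n (j + 1)} := by
  have hW : Set.Icc (2 * j + 1) (2 * j + 6) =
      Set.Icc (2 * (j + 1) + 1) (2 * (j + 1) + 4) ∪ {2 * j + 1, 2 * j + 2} := by
    ext a
    simp only [Set.mem_union, Set.mem_Icc, Set.mem_insert_iff, Set.mem_singleton_iff]
    omega
  rw [← LieSubalgebra.mem_toSubmodule, g3_toSubmodule hj, g2_toSubmodule (j := j + 1) (by omega),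
    hW]
  exact mem_bivSpan_insert_and_conj_eq_iff (hW ▸ isClifford_maj_Icc (by omega) (by omega))
    (by simp only [Set.mem_Icc]; omega) (by simp only [Set.mem_Icc]; omega) (by omega)
    (I_smul_Z (by omega)) x

/-! ### The two copies of `su(2)` on a bond -/

theorem su2_entries (A : su2) : (A.1 0 0).re = 0 ∧ (A.1 1 1).re = 0 ∧
    (A.1 1 1).im = -(A.1 0 0).im ∧ (A.1 1 0).re = -(A.1 0 1).re ∧
      (A.1 1 0).im = (A.1 0 1).im := by
  obtain ⟨A, hA, ht⟩ := A
  have h00 := congrFun (congrFun hA 0) 0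
  have h01 := congrFun (congrFun hA 0) 1
  have h11 := congrFun (congrFun hA 1) 1
  rw [Matrix.trace_fin_two] at ht
  simp only [Matrix.conjTranspose_apply, Matrix.neg_apply, Complex.ext_iff, Complex.star_def,
    Complex.conj_re, Complex.conj_im, Complex.neg_re, Complex.neg_im, Complex.add_re,
    Complex.add_im, Complex.zero_re, Complex.zero_im] at h00 h01 h11 ht
  refine ⟨?_, ?_, ?_, ?_, ?_⟩ <;> linarith [h00.1, h01.1, h01.2, h11.1, ht.1, ht.2]

theorem exists_su2_entries (x y z : ℝ) :
    ∃ A : su2, (A.1 0 1).im = x ∧ (A.1 0 0).im = y ∧ (A.1 0 1).re = z := by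
  refine ⟨⟨!![y * Complex.I, z + x * Complex.I; -z + x * Complex.I, -(y * Complex.I)], ?_, ?_⟩,
    by simp, by simp, by simp⟩
  · ext i j
    fin_cases i <;> fin_cases j <;> simp [Matrix.conjTranspose_apply, add_comm]
  · simp [Matrix.trace_fin_two]

/-- The commutation relations of `su(2)`, up to the sign `ε` that reversing the orientation of
the triple `u` introduces. -/
structure IsSu2Triple {L : Type*} [LieRing L] [LieAlgebra ℝ L] (u : Fin 3 → L) (ε : ℝ) :
    Prop where
  sign_mul_self : ε * ε = 1
  lie_zero_one : ⁅u 0, u 1⁆ = (2 * ε) • u 2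
  lie_one_two : ⁅u 1, u 2⁆ = (2 * ε) • u 0
  lie_two_zero : ⁅u 2, u 0⁆ = (2 * ε) • u 1

namespace IsSu2Triple

variable {L : Type*} [LieRing L] [LieAlgebra ℝ L] {u : Fin 3 → L} {ε : ℝ}

/-- The homomorphism from `su(2)` that sends `iX`, `iZ` and `iεY` to `u 0`, `u 1` and `u 2`. -/
noncomputable def hom (h : IsSu2Triple u ε) : su2 →ₗ⁅ℝ⁆ L where
  toFun A := (A.1 0 1).im • u 0 + (A.1 0 0).im • u 1 + (ε * (A.1 0 1).re) • u 2
  map_add' A B := by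
    change (A.1 0 1 + B.1 0 1).im • u 0 + (A.1 0 0 + B.1 0 0).im • u 1 +
      (ε * (A.1 0 1 + B.1 0 1).re) • u 2 = _
    simp only [Complex.add_im, Complex.add_re]
    module
  map_smul' c A := by
    change (c • A.1 0 1).im • u 0 + (c • A.1 0 0).im • u 1 + (ε * (c • A.1 0 1).re) • u 2 = _
    simp only [Complex.smul_im, Complex.smul_re, RingHom.id_apply, smul_eq_mul]
    module
  map_lie' := by
    intro A B
    obtain ⟨a1, a2, a3, a4, a5⟩ := su2_entries A
    obtain ⟨b1, b2, b3, b4, b5⟩ := su2_entries B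
    have h10 : ⁅u 1, u 0⁆ = -((2 * ε) • u 2) := by rw [← h.lie_zero_one, lie_skew]
    have h21 : ⁅u 2, u 1⁆ = -((2 * ε) • u 0) := by rw [← h.lie_one_two, lie_skew]
    have h02 : ⁅u 0, u 2⁆ = -((2 * ε) • u 1) := by rw [← h.lie_two_zero, lie_skew]
    simp only [lie_add, add_lie, lie_smul, smul_lie, lie_self, h.lie_zero_one, h.lie_one_two,
      h.lie_two_zero, h10, h21, h02]
    simp only [LieSubalgebra.coe_bracket, Ring.lie_def, Matrix.sub_apply, Matrix.mul_apply,
      Fin.sum_univ_two, Complex.add_re, Complex.add_im, Complex.sub_re, Complex.sub_im,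
      Complex.mul_re, Complex.mul_im, a1, a2, a3, a4, a5, b1, b2, b3, b4, b5]
    match_scalars
    · linear_combination (-2 * (A.1 0 0).im * (B.1 0 1).re + 2 * (A.1 0 1).re * (B.1 0 0).im) *
        h.sign_mul_self
    · linear_combination (2 * (A.1 0 1).im * (B.1 0 1).re - 2 * (A.1 0 1).re * (B.1 0 1).im) *
        h.sign_mul_self
    · ring

theorem hom_apply (h : IsSu2Triple u ε) (A : su2) :
    h.hom A = (A.1 0 1).im • u 0 + (A.1 0 0).im • u 1 + (ε * (A.1 0 1).re) • u 2 := rfl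

theorem hom_injective (h : IsSu2Triple u ε) (hu : LinearIndependent ℝ u) :
    Function.Injective h.hom := by
  have hε : ε ≠ 0 := left_ne_zero_of_mul_eq_one h.sign_mul_self
  refine (injective_iff_map_eq_zero _).2 fun A hA => ?_
  have hcoeff := Fintype.linearIndependent_iff.1 hu
    ![(A.1 0 1).im, (A.1 0 0).im, ε * (A.1 0 1).re]
    (by rw [Fin.sum_univ_three]; exact (h.hom_apply A).symm.trans hA)
  have e0 : (A.1 0 1).im = 0 := hcoeff 0
  have e1 : (A.1 0 0).im = 0 := hcoeff 1
  have e2 : (A.1 0 1).re = 0 := (mul_eq_zero.1 (hcoeff 2)).resolve_left hε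
  obtain ⟨a1, a2, a3, a4, a5⟩ := su2_entries A
  apply Subtype.ext
  ext i j
  fin_cases i <;> fin_cases j <;> apply Complex.ext <;> simp [*]

theorem range_hom (h : IsSu2Triple u ε) :
    (h.hom.range : Set L) = Submodule.span ℝ (Set.range u) := by
  ext x
  rw [SetLike.mem_coe, SetLike.mem_coe, LieHom.mem_range, Submodule.mem_span_range_iff_exists_fun]
  constructor
  · rintro ⟨A, rfl⟩
    exact ⟨![(A.1 0 1).im, (A.1 0 0).im, ε * (A.1 0 1).re], by
      simp [Fin.sum_univ_three, h.hom_apply]⟩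
  · rintro ⟨c, rfl⟩
    obtain ⟨A, h0, h1, h2⟩ := exists_su2_entries (c 0) (c 1) (ε * c 2)
    exact ⟨A, by rw [h.hom_apply, h0, h1, h2, ← mul_assoc, h.sign_mul_self, one_mul,
      Fin.sum_univ_three]⟩

theorem lieSpan_eq_range (h : IsSu2Triple u ε) :
    LieSubalgebra.lieSpan ℝ L (Set.range u) = h.hom.range := by
  apply le_antisymm
  · rw [LieSubalgebra.lieSpan_le, h.range_hom]
    exact Submodule.subset_span
  · intro x hx
    rw [← SetLike.mem_coe, h.range_hom] at hx
    exact LieSubalgebra.submodule_span_le_lieSpan hx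

theorem lieSpan_toSubmodule (h : IsSu2Triple u ε) :
    (LieSubalgebra.lieSpan ℝ L (Set.range u)).toSubmodule = Submodule.span ℝ (Set.range u) := by
  rw [h.lieSpan_eq_range]
  exact SetLike.coe_injective h.range_hom

theorem nonempty_lieSpan_equiv (h : IsSu2Triple u ε) (hu : LinearIndependent ℝ u) :
    Nonempty (LieSubalgebra.lieSpan ℝ L (Set.range u) ≃ₗ⁅ℝ⁆ su2) := by
  rw [h.lieSpan_eq_range]
  exact ⟨(LieEquiv.ofInjective h.hom (h.hom_injective hu)).symm⟩

end IsSu2Triple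

section Chiral

variable {𝔸 : Type*} [Ring 𝔸] {J K c : 𝔸}

theorem IsChiralPair.neg_chirality (h : IsChiralPair J K c) : IsChiralPair J K (-c) where
  toIsQuaternionPair := h.toIsQuaternionPair
  chirality_mul_self := by rw [neg_mul_neg, h.chirality_mul_self]
  commute_left := h.commute_left.neg_left
  commute_right := h.commute_right.neg_left

variable [Algebra ℝ 𝔸]

/-- The projection onto the eigenspace `c = 1` of an involution `c`. -/
noncomputable def chiralProj (c : 𝔸) : 𝔸 := (1 / 2 : ℝ) • (1 + c)

theorem chiralProj_mul (c x : 𝔸) : chiralProj c * x = (1 / 2 : ℝ) • (x + c * x) := by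
  rw [chiralProj, smul_mul_assoc, add_mul, one_mul]

theorem chiralProj_eq_zero_iff : chiralProj c = 0 ↔ c = -1 := by
  rw [chiralProj, smul_eq_zero_iff_right (by norm_num), add_comm, add_eq_zero_iff_eq_neg]

theorem chiralProj_mul_self (hc : c * c = 1) : chiralProj c * chiralProj c = chiralProj c := by
  simp only [chiralProj, smul_mul_smul_comm, add_mul, mul_add, one_mul, mul_one, hc]
  module

theorem chiralProj_mul_chiralProj_neg (hc : c * c = 1) : chiralProj c * chiralProj (-c) = 0 := by
  simp only [chiralProj, smul_mul_smul_comm, add_mul, mul_add, one_mul, mul_one, mul_neg, hc]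
  module

theorem commute_chiralProj {x : 𝔸} (h : Commute c x) : Commute (chiralProj c) x :=
  ((Commute.one_left x).add_left h).smul_left _

/-- The `su(2)` triple cut out of the imaginary quaternions `K`, `J`, `J * K` by the chirality
`c = 1`, with the orientation chosen by `ε`. -/
noncomputable def chiralTriple (J K c : 𝔸) (ε : ℝ) : Fin 3 → 𝔸 :=
  ![chiralProj c * K, chiralProj c * J, -ε • (chiralProj c * (J * K))]

theorem span_chiralTriple_le (J K c : 𝔸) (ε : ℝ) :
    Submodule.span ℝ (Set.range (chiralTriple J K c ε)) ≤
      Submodule.span ℝ {J, c * J, K, c * K, J * K, c * (J * K)} := by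
  have hmem {x : 𝔸} (hx : x ∈ Submodule.span ℝ {J, c * J, K, c * K, J * K, c * (J * K)})
      (hcx : c * x ∈ Submodule.span ℝ {J, c * J, K, c * K, J * K, c * (J * K)}) :
      chiralProj c * x ∈ Submodule.span ℝ {J, c * J, K, c * K, J * K, c * (J * K)} := by
    rw [chiralProj_mul]
    exact Submodule.smul_mem _ _ (add_mem hx hcx)
  rw [Submodule.span_le]
  rintro _ ⟨k, rfl⟩
  fin_cases k
  · exact hmem (Submodule.subset_span (by simp)) (Submodule.subset_span (by simp))
  · exact hmem (Submodule.subset_span (by simp)) (Submodule.subset_span (by simp))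
  · exact Submodule.smul_mem _ _
      (hmem (Submodule.subset_span (by simp)) (Submodule.subset_span (by simp)))

theorem span_chiral_neg (J K c : 𝔸) :
    Submodule.span ℝ {J, -c * J, K, -c * K, J * K, -c * (J * K)} =
      Submodule.span ℝ {J, c * J, K, c * K, J * K, c * (J * K)} := by
  simp only [neg_mul, Submodule.span_insert, ← Set.neg_singleton, Submodule.span_neg]

namespace IsChiralPair

theorem chiralProj_mul_mul (h : IsChiralPair J K c) {x : 𝔸} (hx : Commute c x) (y : 𝔸) :
    chiralProj c * x * (chiralProj c * y) = chiralProj c * (x * y) := by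
  rw [mul_assoc, ← (commute_chiralProj hx).left_comm, ← mul_assoc, ← mul_assoc,
    chiralProj_mul_self h.chirality_mul_self, mul_assoc]

theorem isSu2Triple_chiralTriple (h : IsChiralPair J K c) {ε : ℝ} (hε : ε * ε = 1) :
    IsSu2Triple (chiralTriple J K c ε) ε := by
  have hJK : Commute c (J * K) := h.commute_left.mul_right h.commute_right
  have hKJ : K * (J * K) = J := by
    rw [← mul_assoc, h.anticomm, neg_mul, mul_assoc, h.right_mul_self]; simp
  have hJKJ : J * K * J = K := by
    rw [mul_assoc, h.anticomm, mul_neg, ← mul_assoc, h.left_mul_self]; simp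
  have hJJK : J * (J * K) = -K := by rw [← mul_assoc, h.left_mul_self, neg_one_mul]
  have hJKK : J * K * K = -J := by rw [mul_assoc, h.right_mul_self, mul_neg_one]
  refine ⟨hε, ?_, ?_, ?_⟩ <;>
    simp only [chiralTriple, Matrix.cons_val_zero, Matrix.cons_val_one, Matrix.cons_val,
      Ring.lie_def, smul_mul_assoc, mul_smul_comm, h.chiralProj_mul_mul h.commute_left,
      h.chiralProj_mul_mul h.commute_right, h.chiralProj_mul_mul hJK, h.anticomm, hKJ, hJKJ, hJJK,
      hJKK, mul_neg, smul_smul]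
  · rw [mul_assoc, hε]
    module
  · module
  · module

theorem chiralProj_mul_of_mem_span (h : IsChiralPair J K c) {ε : ℝ} {x : 𝔸}
    (hx : x ∈ Submodule.span ℝ (Set.range (chiralTriple J K c ε))) : chiralProj c * x = x := by
  have hP := chiralProj_mul_self h.chirality_mul_self
  refine LinearMap.eqOn_span' (f := LinearMap.mulLeft ℝ (chiralProj c)) (g := .id) ?_ hx
  rintro _ ⟨k, rfl⟩
  fin_cases k <;> simp [chiralTriple, ← mul_assoc, hP]

theorem commute_of_mem_span (h : IsChiralPair J K c) {ε : ℝ} {x : 𝔸}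
    (hx : x ∈ Submodule.span ℝ (Set.range (chiralTriple J K c ε))) : Commute c x := by
  have hP : Commute c (chiralProj c) := ((Commute.one_right c).add_right rfl).smul_right _
  induction hx using Submodule.span_induction with
  | mem x hx =>
    obtain ⟨k, rfl⟩ := hx
    fin_cases k
    · exact hP.mul_right h.commute_right
    · exact hP.mul_right h.commute_left
    · exact (hP.mul_right (h.commute_left.mul_right h.commute_right)).smul_right _
  | zero => exact Commute.zero_right c
  | add x y _ _ hx hy => exact hx.add_right hy
  | smul r x _ hx => exact hx.smul_right r

theorem mul_eq_zero_of_mem_span (h : IsChiralPair J K c) {ε δ : ℝ} {x y : 𝔸}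
    (hx : x ∈ Submodule.span ℝ (Set.range (chiralTriple J K c ε)))
    (hy : y ∈ Submodule.span ℝ (Set.range (chiralTriple J K (-c) δ))) : x * y = 0 := by
  rw [← h.chiralProj_mul_of_mem_span hx, ← h.neg_chirality.chiralProj_mul_of_mem_span hy,
    (commute_chiralProj (h.commute_of_mem_span hx)).eq, mul_assoc, ← mul_assoc (chiralProj c),
    chiralProj_mul_chiralProj_neg h.chirality_mul_self, zero_mul, mul_zero]

theorem lie_eq_zero_of_mem_span (h : IsChiralPair J K c) {ε δ : ℝ} {x y : 𝔸}
    (hx : x ∈ Submodule.span ℝ (Set.range (chiralTriple J K c ε)))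
    (hy : y ∈ Submodule.span ℝ (Set.range (chiralTriple J K (-c) δ))) : ⁅x, y⁆ = 0 := by
  have hx' : x ∈ Submodule.span ℝ (Set.range (chiralTriple J K (- -c) ε)) := by rwa [neg_neg]
  rw [Ring.lie_def, h.mul_eq_zero_of_mem_span hx hy,
    h.neg_chirality.mul_eq_zero_of_mem_span hy hx', sub_zero]

theorem disjoint_span_chiralTriple (h : IsChiralPair J K c) (ε δ : ℝ) :
    Disjoint (Submodule.span ℝ (Set.range (chiralTriple J K c ε)))
      (Submodule.span ℝ (Set.range (chiralTriple J K (-c) δ))) := by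
  refine Submodule.disjoint_def.2 fun x hx hx' => ?_
  rw [← h.chiralProj_mul_of_mem_span hx, ← h.neg_chirality.chiralProj_mul_of_mem_span hx',
    ← mul_assoc, chiralProj_mul_chiralProj_neg h.chirality_mul_self, zero_mul]

theorem linearIndependent_chiralTriple (h : IsChiralPair J K c) (hc : chiralProj c ≠ 0) {ε : ℝ}
    (hε : ε ≠ 0) : LinearIndependent ℝ (chiralTriple J K c ε) := by
  rw [Fintype.linearIndependent_iff]
  intro g hg
  set q : ℍ[ℝ] := ⟨0, g 1, g 0, -(ε * g 2)⟩
  have hq0 : chiralProj c * h.lift q = 0 := by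
    rw [← hg, h.lift_apply, Fin.sum_univ_three]
    simp [q, chiralTriple, mul_add]
    module
  have hq : q = 0 := by
    by_contra hq
    refine hc ?_
    calc chiralProj c = chiralProj c * h.lift q * h.lift q⁻¹ := by
          rw [mul_assoc, ← map_mul, mul_inv_cancel₀ hq, map_one, mul_one]
      _ = 0 := by rw [hq0, zero_mul]
  intro k
  fin_cases k
  · exact congrArg QuaternionAlgebra.imJ hq
  · exact congrArg QuaternionAlgebra.imI hq
  · simpa [q, hε] using congrArg QuaternionAlgebra.imK hq

end IsChiralPair

theorem chiralProj_mul_add_chiralProj_neg_mul (c x : 𝔸) :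
    chiralProj c * x + chiralProj (-c) * x = x := by
  rw [chiralProj_mul, chiralProj_mul, neg_mul]
  module

theorem chiralProj_mul_sub_chiralProj_neg_mul (c x : 𝔸) :
    chiralProj c * x - chiralProj (-c) * x = c * x := by
  rw [chiralProj_mul, chiralProj_mul, neg_mul]
  module

theorem span_chiralTriple_sup (J K c : 𝔸) {ε δ : ℝ} (hε : ε ≠ 0) (hδ : δ ≠ 0) :
    Submodule.span ℝ (Set.range (chiralTriple J K c ε)) ⊔
      Submodule.span ℝ (Set.range (chiralTriple J K (-c) δ)) =
        Submodule.span ℝ {J, c * J, K, c * K, J * K, c * (J * K)} := by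
  rw [← Submodule.span_union]
  apply le_antisymm
  · rw [Submodule.span_union]
    refine sup_le (span_chiralTriple_le J K c ε) ?_
    rw [← span_chiral_neg]
    exact span_chiralTriple_le J K (-c) δ
  · set M := Submodule.span ℝ
      (Set.range (chiralTriple J K c ε) ∪ Set.range (chiralTriple J K (-c) δ))
    have hmem {x : 𝔸} (h : chiralProj c * x ∈ M) (h' : chiralProj (-c) * x ∈ M) :
        x ∈ M ∧ c * x ∈ M := by
      rw [← chiralProj_mul_sub_chiralProj_neg_mul c x]
      nth_rewrite 1 [← chiralProj_mul_add_chiralProj_neg_mul c x]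
      exact ⟨add_mem h h', sub_mem h h'⟩
    have hleft (k) : chiralTriple J K c ε k ∈ M := Submodule.subset_span (.inl ⟨k, rfl⟩)
    have hright (k) : chiralTriple J K (-c) δ k ∈ M := Submodule.subset_span (.inr ⟨k, rfl⟩)
    obtain ⟨hK, hcK⟩ := hmem (hleft 0) (hright 0)
    obtain ⟨hJ, hcJ⟩ := hmem (hleft 1) (hright 1)
    obtain ⟨hJK, hcJK⟩ := hmem ((M.smul_mem_iff (neg_ne_zero.2 hε)).1 (hleft 2))
      ((M.smul_mem_iff (neg_ne_zero.2 hδ)).1 (hright 2))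
    rw [Submodule.span_le]
    rintro x (rfl | rfl | rfl | rfl | rfl | rfl) <;> assumption

end Chiral

section CliffordChirality

variable {ι 𝔸 : Type*} [Ring 𝔸] {γ : ι → 𝔸} {S : Set ι} {a b c d : ι}

namespace IsClifford

theorem isChiralPair (h : IsClifford γ S) (ha : a ∈ S) (hb : b ∈ S) (hc : c ∈ S) (hd : d ∈ S)
    (hab : a ≠ b) (hac : a ≠ c) (had : a ≠ d) (hbc : b ≠ c) (hbd : b ≠ d) (hcd : c ≠ d) :
    IsChiralPair (γ a * γ b) (γ b * γ c) (-(γ a * γ b * (γ c * γ d))) := by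
  have hcomm : Commute (γ a * γ b) (γ c * γ d) :=
    h.commute_bivectors ha hb hc hd hac had hbc hbd
  refine ⟨h.isQuaternionPair ha hb hc hab hbc hac, ?_, ?_, ?_⟩
  · rw [neg_mul_neg, hcomm.symm.mul_mul_mul_comm, h.bivector_mul_self ha hb hab,
      h.bivector_mul_self hc hd hcd, neg_one_mul, neg_neg]
  · exact ((Commute.refl _).mul_left hcomm.symm).neg_left
  · have hrev : γ a * γ b * (γ c * γ d) = γ b * γ c * (γ a * γ d) := by
      rw [mul_assoc, ← mul_assoc (γ b), (h.commute_bivector hb hc ha hab.symm hac.symm).left_comm]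
    rw [hrev]
    exact ((Commute.refl _).mul_left
      (h.commute_bivectors ha hd hb hc hab hac hbd.symm hcd.symm)).neg_left

theorem chirality_mul_left (h : IsClifford γ S) (ha : a ∈ S) (hb : b ∈ S) (hc : c ∈ S)
    (hd : d ∈ S) (hab : a ≠ b) (hac : a ≠ c) (had : a ≠ d) (hbc : b ≠ c) (hbd : b ≠ d) :
    -(γ a * γ b * (γ c * γ d)) * (γ a * γ b) = γ c * γ d := by
  rw [(h.commute_bivectors ha hb hc hd hac had hbc hbd).eq, neg_mul, mul_assoc,
    h.bivector_mul_self ha hb hab, mul_neg_one, neg_neg]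

theorem chirality_mul_right (h : IsClifford γ S) (hb : b ∈ S) (hc : c ∈ S) (hd : d ∈ S)
    (hbc : b ≠ c) (hbd : b ≠ d) (hcd : c ≠ d) :
    -(γ a * γ b * (γ c * γ d)) * (γ b * γ c) = γ a * γ d := by
  have hrev : γ a * γ b * (γ c * γ d) = γ a * γ d * (γ b * γ c) := by
    rw [mul_assoc, ← mul_assoc (γ b), (h.commute_bivector hb hc hd hbd hcd).eq, ← mul_assoc]
  rw [hrev, neg_mul, mul_assoc, h.bivector_mul_self hb hc hbc, mul_neg_one, neg_neg]

end IsClifford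

end CliffordChirality

section TwoSites

variable {n j : ℕ}

theorem ZZ_eq (hj : j + 1 < n) : Z n (j + 1) * Z n (j + 2) =
    -(maj n (2 * j + 1) * maj n (2 * j + 2) * (maj n (2 * j + 3) * maj n (2 * j + 4))) := by
  rw [← I_smul_Z (by omega), show 2 * j + 3 = 2 * (j + 1) + 1 by ring,
    show 2 * j + 4 = 2 * (j + 1) + 2 by ring, ← I_smul_Z hj, smul_mul_smul_comm, Complex.I_mul_I,
    neg_one_smul, neg_neg]

theorem isChiralPair_pauli (hj : j + 1 < n) : IsChiralPair (Complex.I • Z n (j + 1))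
    (Complex.I • (X n (j + 1) * X n (j + 2))) (Z n (j + 1) * Z n (j + 2)) := by
  rw [ZZ_eq hj, I_smul_Z (by omega), I_smul_XX hj]
  apply (isClifford_maj n).isChiralPair <;> first | omega | exact ⟨by omega, by omega⟩

theorem ZZ_mul_I_smul_Z (hj : j + 1 < n) :
    Z n (j + 1) * Z n (j + 2) * (Complex.I • Z n (j + 1)) = Complex.I • Z n (j + 2) := by
  rw [ZZ_eq hj, I_smul_Z (by omega), I_smul_Z hj]
  apply (isClifford_maj n).chirality_mul_left <;> first | omega | exact ⟨by omega, by omega⟩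

theorem ZZ_mul_I_smul_XX (hj : j + 1 < n) :
    Z n (j + 1) * Z n (j + 2) * (Complex.I • (X n (j + 1) * X n (j + 2))) =
      -(Complex.I • (Y n (j + 1) * Y n (j + 2))) := by
  rw [ZZ_eq hj, I_smul_XX hj, I_smul_YY hj, neg_neg]
  apply (isClifford_maj n).chirality_mul_right <;> first | omega | exact ⟨by omega, by omega⟩

theorem I_smul_Z_mul_I_smul_XX (hj : j + 1 < n) :
    Complex.I • Z n (j + 1) * (Complex.I • (X n (j + 1) * X n (j + 2))) =
      -(Complex.I • (Y n (j + 1) * X n (j + 2))) := by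
  rw [I_smul_Z (by omega), I_smul_XX hj, I_smul_YX hj, neg_neg,
    (isClifford_maj n).bivector_mul_bivector ⟨by omega, by omega⟩]

theorem ZZ_mul_I_smul_Z_mul_I_smul_XX (hj : j + 1 < n) :
    Z n (j + 1) * Z n (j + 2) *
        (Complex.I • Z n (j + 1) * (Complex.I • (X n (j + 1) * X n (j + 2)))) =
      -(Complex.I • (X n (j + 1) * Y n (j + 2))) := by
  have hmem (k : ℕ) (hk : k < 4) : 2 * j + 1 + k ∈ Set.Icc 1 (2 * n) := ⟨by omega, by omega⟩
  have hγ := (isClifford_maj n).commute_bivector (hmem 2 (by omega)) (hmem 3 (by omega))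
    (hmem 1 (by omega)) (by omega) (by omega)
  rw [← mul_assoc, ZZ_mul_I_smul_Z hj, I_smul_Z hj, I_smul_XX hj, I_smul_XY hj]
  exact (hγ.left_comm _).trans (by
    rw [(isClifford_maj n).bivector_mul_left (hmem 2 (by omega)) (hmem 3 (by omega)) (by omega),
      mul_neg])

theorem span_chiral_pauli (hj : j + 1 < n) :
    Submodule.span ℝ {Complex.I • Z n (j + 1),
      Z n (j + 1) * Z n (j + 2) * (Complex.I • Z n (j + 1)),
      Complex.I • (X n (j + 1) * X n (j + 2)),
      Z n (j + 1) * Z n (j + 2) * (Complex.I • (X n (j + 1) * X n (j + 2))),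
      Complex.I • Z n (j + 1) * (Complex.I • (X n (j + 1) * X n (j + 2))),
      Z n (j + 1) * Z n (j + 2) *
        (Complex.I • Z n (j + 1) * (Complex.I • (X n (j + 1) * X n (j + 2))))} =
      (g2 n (j + 1)).toSubmodule := by
  rw [g2_toSubmodule_eq_span hj, ZZ_mul_I_smul_Z hj, ZZ_mul_I_smul_XX hj,
    ZZ_mul_I_smul_Z_mul_I_smul_XX hj, I_smul_Z_mul_I_smul_XX hj]
  simp only [g2Basis, Matrix.range_cons, Matrix.range_empty, Set.union_empty, Submodule.span_union,
    Submodule.span_insert, ← Set.neg_singleton, Submodule.span_neg]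
  ac_rfl

theorem I_div_two_smul (x : Op n) : (Complex.I / 2) • x = (1 / 2 : ℝ) • (Complex.I • x) := by
  rw [← Complex.coe_smul]
  push_cast
  module

theorem gPlusBasis_eq_chiralTriple (hj : j + 1 < n) : gPlusBasis n (j + 1) =
    chiralTriple (Complex.I • Z n (j + 1)) (Complex.I • (X n (j + 1) * X n (j + 2)))
      (-(Z n (j + 1) * Z n (j + 2))) (-1) := by
  rw [chiralTriple]
  simp only [chiralProj_mul, neg_mul, ZZ_mul_I_smul_Z hj, ZZ_mul_I_smul_XX hj,
    ZZ_mul_I_smul_Z_mul_I_smul_XX hj]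
  simp only [gPlusBasis, I_div_two_smul, I_smul_Z_mul_I_smul_XX hj, neg_neg, one_smul, smul_add,
    neg_add_eq_sub, ← sub_eq_add_neg, smul_sub]

theorem gMinusBasis_eq_chiralTriple (hj : j + 1 < n) : gMinusBasis n (j + 1) =
    chiralTriple (Complex.I • Z n (j + 1)) (Complex.I • (X n (j + 1) * X n (j + 2)))
      (Z n (j + 1) * Z n (j + 2)) 1 := by
  rw [chiralTriple]
  simp only [chiralProj_mul, ZZ_mul_I_smul_Z hj, ZZ_mul_I_smul_XX hj,
    ZZ_mul_I_smul_Z_mul_I_smul_XX hj]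
  simp only [gMinusBasis, I_div_two_smul, I_smul_Z_mul_I_smul_XX hj, neg_smul, one_smul,
    smul_neg, neg_neg, sub_eq_add_neg, smul_add,
    add_comm ((1 / 2 : ℝ) • Complex.I • (Y n (j + 1) * X n (j + 2)))]

theorem chiralProj_ZZ_ne_zero (hj : j + 1 < n) :
    chiralProj (Z n (j + 1) * Z n (j + 2)) ≠ 0 ∧
      chiralProj (-(Z n (j + 1) * Z n (j + 2))) ≠ 0 := by
  have hli := linearIndependent_g2Basis hj
  constructor <;> rw [Ne, chiralProj_eq_zero_iff] <;> intro h
  · have h0 : Complex.I • Z n (j + 1) + Complex.I • Z n (j + 2) = 0 := by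
      rw [← ZZ_mul_I_smul_Z hj, h, neg_one_mul, add_neg_cancel]
    have h1 := Fintype.linearIndependent_iff.1 hli ![0, 0, 0, 0, 1, 1] (by
      simpa [Fin.sum_univ_six, g2Basis] using h0) 4
    exact one_ne_zero h1
  · have h0 : Complex.I • Z n (j + 2) = Complex.I • Z n (j + 1) := by
      rw [← ZZ_mul_I_smul_Z hj, neg_inj.1 h, one_mul]
    exact absurd (hli.injective (a₁ := 5) (a₂ := 4) h0) (by decide)

theorem gPlus_toSubmodule (hj : j + 1 < n) :
    (gPlus n (j + 1)).toSubmodule = Submodule.span ℝ (Set.range (gPlusBasis n (j + 1))) := by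
  rw [gPlus, gPlusBasis_eq_chiralTriple hj]
  exact ((isChiralPair_pauli hj).neg_chirality.isSu2Triple_chiralTriple
    (by norm_num)).lieSpan_toSubmodule

theorem gMinus_toSubmodule (hj : j + 1 < n) :
    (gMinus n (j + 1)).toSubmodule = Submodule.span ℝ (Set.range (gMinusBasis n (j + 1))) := by
  rw [gMinus, gMinusBasis_eq_chiralTriple hj]
  exact ((isChiralPair_pauli hj).isSu2Triple_chiralTriple (by norm_num)).lieSpan_toSubmodule

theorem nonempty_gPlus_equiv_su2 (hj : j + 1 < n) : Nonempty (gPlus n (j + 1) ≃ₗ⁅ℝ⁆ su2) := by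
  have h := (isChiralPair_pauli hj).neg_chirality
  rw [gPlus, gPlusBasis_eq_chiralTriple hj]
  exact (h.isSu2Triple_chiralTriple (by norm_num)).nonempty_lieSpan_equiv
    (h.linearIndependent_chiralTriple (chiralProj_ZZ_ne_zero hj).2 (by norm_num))

theorem nonempty_gMinus_equiv_su2 (hj : j + 1 < n) : Nonempty (gMinus n (j + 1) ≃ₗ⁅ℝ⁆ su2) := by
  have h := isChiralPair_pauli hj
  rw [gMinus, gMinusBasis_eq_chiralTriple hj]
  exact (h.isSu2Triple_chiralTriple (by norm_num)).nonempty_lieSpan_equiv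
    (h.linearIndependent_chiralTriple (chiralProj_ZZ_ne_zero hj).1 (by norm_num))

theorem lie_gPlus_gMinus (hj : j + 1 < n) :
    ∀ x ∈ gPlus n (j + 1), ∀ y ∈ gMinus n (j + 1), ⁅x, y⁆ = 0 := by
  intro x hx y hy
  rw [← LieSubalgebra.mem_toSubmodule, gPlus_toSubmodule hj, gPlusBasis_eq_chiralTriple hj] at hx
  rw [← LieSubalgebra.mem_toSubmodule, gMinus_toSubmodule hj, gMinusBasis_eq_chiralTriple hj,
    ← neg_neg (Z n (j + 1) * Z n (j + 2))] at hy
  exact (isChiralPair_pauli hj).neg_chirality.lie_eq_zero_of_mem_span hx hy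

theorem gPlus_sup_gMinus (hj : j + 1 < n) :
    (gPlus n (j + 1)).toSubmodule ⊔ (gMinus n (j + 1)).toSubmodule =
      (g2 n (j + 1)).toSubmodule := by
  rw [gPlus_toSubmodule hj, gMinus_toSubmodule hj, gPlusBasis_eq_chiralTriple hj,
    gMinusBasis_eq_chiralTriple hj, sup_comm, span_chiralTriple_sup _ _ _ one_ne_zero (by norm_num),
    span_chiral_pauli hj]

theorem disjoint_gPlus_gMinus (hj : j + 1 < n) :
    Disjoint (gPlus n (j + 1)).toSubmodule (gMinus n (j + 1)).toSubmodule := by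
  rw [gPlus_toSubmodule hj, gMinus_toSubmodule hj, gPlusBasis_eq_chiralTriple hj,
    gMinusBasis_eq_chiralTriple hj]
  exact ((isChiralPair_pauli hj).disjoint_span_chiralTriple _ _).symm

end TwoSites

/-! ### Spin groups -/

section SpinGroup

open scoped Pointwise

variable {𝔸 : Type*} [NormedRing 𝔸] {γ : ℕ → 𝔸} {p q N M : ℕ} {J K : 𝔸}

theorem IsClifford.isQuaternionPair_adjacent {k : ℕ} (h : IsClifford γ (Set.Icc k (k + 2))) :
    IsQuaternionPair (γ k * γ (k + 1)) (γ (k + 1) * γ (k + 2)) := by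
  apply h.isQuaternionPair <;> first | omega | exact ⟨by omega, by omega⟩

variable [NormedAlgebra ℝ 𝔸]

theorem IsQuaternionPair.range_exp_mul_subset (h : IsQuaternionPair J K) :
    (Set.range fun t : ℝ => exp (t • J)) * (Set.range fun t : ℝ => exp (t • K)) *
        Set.range (fun t : ℝ => exp (t • J)) ⊆
      (Set.range fun t : ℝ => exp (t • K)) * (Set.range fun t : ℝ => exp (t • J)) *
        Set.range fun t : ℝ => exp (t • K) := by
  rintro _ ⟨_, ⟨_, ⟨α, rfl⟩, _, ⟨β, rfl⟩, rfl⟩, _, ⟨δ, rfl⟩, rfl⟩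
  obtain ⟨a, b, c, habc⟩ := h.exists_exp_mul_exp_mul_exp_eq α β δ
  exact ⟨_, ⟨_, ⟨a, rfl⟩, _, ⟨b, rfl⟩, rfl⟩, _, ⟨c, rfl⟩, habc.symm⟩

/-- The rotations generated by the bivector `γ k * γ (k + 1)` of adjacent generators. -/
def adjacentRotations (γ : ℕ → 𝔸) (k : ℕ) : Set 𝔸 :=
  Set.range fun t : ℝ => exp (t • (γ k * γ (k + 1)))

/-- The group generated by the rotations of the `N` adjacent pairs among the `N + 1` generators
`γ (p + 1), …, γ (p + N + 1)`. -/
def spinGroup (γ : ℕ → 𝔸) (p N : ℕ) : Submonoid 𝔸 :=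
  Submonoid.closure {x | ∃ k, 1 ≤ k ∧ k ≤ N ∧ x ∈ adjacentRotations γ (p + k)}

theorem one_mem_adjacentRotations (γ : ℕ → 𝔸) (k : ℕ) : 1 ∈ adjacentRotations γ k := ⟨0, by simp⟩

theorem adjacentRotations_subset_spinGroup {k : ℕ} (h₁ : p + 1 ≤ k) (h₂ : k ≤ p + N) :
    adjacentRotations γ k ⊆ spinGroup γ p N := fun _ hx =>
  Submonoid.subset_closure ⟨k - p, by omega, by omega, by rwa [show p + (k - p) = k by omega]⟩

theorem spinGroup_le_iff {S : Submonoid 𝔸} :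
    spinGroup γ p N ≤ S ↔ ∀ k, p + 1 ≤ k → k ≤ p + N → adjacentRotations γ k ⊆ S := by
  refine ⟨fun h k h₁ h₂ => (adjacentRotations_subset_spinGroup h₁ h₂).trans h, fun h => ?_⟩
  rw [spinGroup, Submonoid.closure_le]
  rintro x ⟨k, h₁, h₂, hx⟩
  exact h (p + k) (by omega) (by omega) hx

theorem spinGroup_mono (h₁ : q ≤ p) (h₂ : p + N ≤ q + M) : spinGroup γ p N ≤ spinGroup γ q M :=
  spinGroup_le_iff.2 fun _ h₃ h₄ => adjacentRotations_subset_spinGroup (by omega) (by omega)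

theorem spinGroup_mul_three_subset (γ : ℕ → 𝔸) {q' : ℕ} (h₁ : p ≤ q) (h₂ : q + M ≤ p + N)
    (h₁' : p ≤ q') (h₂' : q' + M ≤ p + N) :
    (spinGroup γ q M : Set 𝔸) * spinGroup γ q' M * spinGroup γ q M ⊆ spinGroup γ p N := by
  rintro _ ⟨_, ⟨x, hx, y, hy, rfl⟩, z, hz, rfl⟩
  exact mul_mem (mul_mem (spinGroup_mono h₁ h₂ hx) (spinGroup_mono h₁' h₂' hy))
    (spinGroup_mono h₁ h₂ hz)

namespace IsClifford

theorem commute_adjacentRotations {k l : ℕ} (h : IsClifford γ (Set.Icc k (l + 1)))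
    (hkl : k + 1 < l) {x y : 𝔸} (hx : x ∈ adjacentRotations γ k)
    (hy : y ∈ adjacentRotations γ l) : Commute x y := by
  let _ : NormedAlgebra ℚ 𝔸 := .restrictScalars ℚ ℝ 𝔸
  obtain ⟨s, rfl⟩ := hx
  obtain ⟨t, rfl⟩ := hy
  have hbiv : Commute (γ k * γ (k + 1)) (γ l * γ (l + 1)) := by
    apply h.commute_bivectors <;> first | omega | exact ⟨by omega, by omega⟩
  exact ((hbiv.smul_left s).smul_right t).exp

theorem commute_of_mem_spinGroup (h : IsClifford γ (Set.Icc (p + 1) (q + M + 1)))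
    (hpq : p + N + 1 ≤ q) {x y : 𝔸} (hx : x ∈ spinGroup γ p N) (hy : y ∈ spinGroup γ q M) :
    Commute x y := by
  have hcomm {k l : ℕ} (hk : p + 1 ≤ k) (hk' : k ≤ p + N) (hl : q + 1 ≤ l) (hl' : l ≤ q + M)
      {u v : 𝔸} (hu : u ∈ adjacentRotations γ k) (hv : v ∈ adjacentRotations γ l) : Commute u v :=
    (h.mono (Set.Icc_subset_Icc hk (by omega))).commute_adjacentRotations (by omega) hu hv
  have hle : spinGroup γ p N ≤ Submonoid.centralizer (spinGroup γ q M) := by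
    refine spinGroup_le_iff.2 fun k hk hk' u hu => ?_
    have hle' : spinGroup γ q M ≤ Submonoid.centralizer {u} :=
      spinGroup_le_iff.2 fun l hl hl' v hv => Submonoid.mem_centralizer_iff.2 fun w hw =>
        hw ▸ hcomm hk hk' hl hl' hu hv
    exact Submonoid.mem_centralizer_iff.2 fun v hv =>
      (Submonoid.mem_centralizer_iff.1 (hle' hv) u rfl).symm
  exact (Submonoid.mem_centralizer_iff.1 (hle hx) y hy).symm

end IsClifford

variable [CompleteSpace 𝔸]

theorem exp_smul_mul_exp_smul (x : 𝔸) (s t : ℝ) :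
    exp (s • x) * exp (t • x) = exp ((s + t) • x) := by
  let _ : NormedAlgebra ℚ 𝔸 := .restrictScalars ℚ ℝ 𝔸
  rw [add_smul, exp_add_of_commute (((Commute.refl x).smul_left s).smul_right t)]

theorem range_exp_smul_mul_self (x : 𝔸) :
    (Set.range fun t : ℝ => exp (t • x)) * Set.range (fun t : ℝ => exp (t • x)) =
      Set.range fun t : ℝ => exp (t • x) := by
  apply Set.Subset.antisymm
  · rintro _ ⟨_, ⟨s, rfl⟩, _, ⟨t, rfl⟩, rfl⟩
    exact ⟨s + t, (exp_smul_mul_exp_smul x s t).symm⟩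
  · rintro _ ⟨t, rfl⟩
    exact ⟨_, ⟨0, rfl⟩, _, ⟨t, rfl⟩, by simp⟩

/-- A quarter turn generated by `J` carries `K` to `J * K`, because `(1 + J) K = J K (1 + J)`. -/
theorem IsQuaternionPair.exp_pi_div_four_conj (h : IsQuaternionPair J K) (t : ℝ) :
    exp ((Real.pi / 4) • J) * exp (t • K) * exp ((-(Real.pi / 4)) • J) = exp (t • (J * K)) := by
  let _ : NormedAlgebra ℚ 𝔸 := .restrictScalars ℚ ℝ 𝔸
  have hsemiconj : SemiconjBy (exp ((Real.pi / 4) • J)) (t • K) (t • (J * K)) := by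
    rw [SemiconjBy, exp_smul_of_mul_self_eq_neg_one h.left_mul_self, Real.cos_pi_div_four,
      Real.sin_pi_div_four, ← smul_add, mul_smul_comm, smul_mul_assoc, smul_mul_assoc,
      mul_smul_comm, add_mul, mul_add, one_mul, mul_one, mul_assoc J K J, h.anticomm, mul_neg,
      ← mul_assoc, h.left_mul_self, neg_one_mul, neg_neg, add_comm]
  rw [(hsemiconj.exp_right).eq, mul_assoc, exp_smul_mul_exp_smul, add_neg_cancel, zero_smul,
    exp_zero, mul_one]

namespace IsClifford

theorem isHecke_adjacentRotations (h : IsClifford γ (Set.Icc (p + 1) (p + N + 1))) :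
    IsHecke N fun k => adjacentRotations γ (p + k) where
  idem _ _ _ := range_exp_smul_mul_self _
  comm i j _ _ _ := set_mul_comm_of_commute fun _ hx _ hy =>
    (h.mono (Set.Icc_subset_Icc (by omega) (by omega))).commute_adjacentRotations (by omega) hx hy
  braid i _ _ := by
    have hpair := (h.mono (Set.Icc_subset_Icc (by omega) (by omega))).isQuaternionPair_adjacent
      (k := p + i)
    exact Set.Subset.antisymm hpair.range_exp_mul_subset hpair.symm.range_exp_mul_subset

theorem spinGroup_eq_word (h : IsClifford γ (Set.Icc (p + 1) (p + N + 1))) :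
    (spinGroup γ p N : Set 𝔸) = word (fun k => adjacentRotations γ (p + k)) (triangleIdx N) :=
  h.isHecke_adjacentRotations.closure_eq_triangle fun _ _ _ => one_mem_adjacentRotations γ _

theorem isCompact_spinGroup (h : IsClifford γ (Set.Icc (p + 1) (p + N + 1))) :
    IsCompact (spinGroup γ p N : Set 𝔸) := by
  rw [h.spinGroup_eq_word]
  refine isCompact_word fun k hk => isCompact_range_exp_smul ?_
  have := mem_triangleIdx hk
  exact h.bivector_mul_self ⟨by omega, by omega⟩ ⟨by omega, by omega⟩ (by omega)

theorem exp_bivector_mem_spinGroup (h : IsClifford γ (Set.Icc (p + 1) (p + N + 1))) {a b : ℕ}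
    (ha : p + 1 ≤ a) (hab : a < b) (hb : b ≤ p + N + 1) (t : ℝ) :
    exp (t • (γ a * γ b)) ∈ spinGroup γ p N := by
  induction b, hab using Nat.le_induction generalizing t with
  | base => exact adjacentRotations_subset_spinGroup ha (by omega) ⟨t, rfl⟩
  | succ b hab ih =>
    have hpair : IsQuaternionPair (γ a * γ b) (γ b * γ (b + 1)) := by
      apply h.isQuaternionPair <;> first | omega | exact ⟨by omega, by omega⟩
    rw [← h.bivector_mul_bivector (b := b) ⟨by omega, by omega⟩, ← hpair.exp_pi_div_four_conj]
    exact mul_mem (mul_mem (ih (by omega) _)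
      (adjacentRotations_subset_spinGroup (by omega) (by omega) ⟨t, rfl⟩)) (ih (by omega) _)

theorem exp_mem_spinGroup [NormOneClass 𝔸] (h : IsClifford γ (Set.Icc (p + 1) (p + N + 1))) {x : 𝔸}
    (hx : x ∈ bivSpan γ (Set.Icc (p + 1) (p + N + 1))) : exp x ∈ spinGroup γ p N := by
  refine exp_mem_of_mem_span h.isCompact_spinGroup.isClosed ?_ hx
  rintro _ ⟨a, ha, b, hb, hab, rfl⟩ t
  rcases hab.lt_or_gt with hab | hab
  · exact h.exp_bivector_mem_spinGroup ha.1 hab hb.2 t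
  · rw [h.anticomm ha hb hab.ne', smul_neg, ← neg_smul]
    exact h.exp_bivector_mem_spinGroup hb.1 hab ha.2 (-t)

end IsClifford

theorem IsClifford.spinGroup_five_eq_right (h : IsClifford γ (Set.Icc (p + 1) (p + 6))) :
    (spinGroup γ p 5 : Set 𝔸) =
      spinGroup γ (p + 2) 3 * spinGroup γ p 3 * spinGroup γ (p + 2) 3 := by
  apply Set.Subset.antisymm
  · rw [h.spinGroup_eq_word, h.isHecke_adjacentRotations.triangle_five]
    refine Set.mul_subset_mul (Set.mul_subset_mul ?_ ?_) ?_ <;>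
    · refine word_subset_submonoid _ fun k hk => ?_
      simp only [List.mem_cons, List.not_mem_nil, or_false] at hk
      exact adjacentRotations_subset_spinGroup (by omega) (by omega)
  · exact spinGroup_mul_three_subset γ (by omega) (by omega) (by omega) (by omega)

theorem IsClifford.spinGroup_five_eq_left (h : IsClifford γ (Set.Icc (p + 1) (p + 6))) :
    (spinGroup γ p 5 : Set 𝔸) =
      spinGroup γ p 3 * spinGroup γ (p + 2) 3 * spinGroup γ p 3 := by
  apply Set.Subset.antisymm
  · have hrefl := (h.isHecke_adjacentRotations (N := 5)).reflect
    have hle : (spinGroup γ p 5 : Set 𝔸) ⊆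
        word (fun k => adjacentRotations γ (p + (5 + 1 - k))) (triangleIdx 5) := by
      rw [← hrefl.closure_eq_triangle fun _ _ _ => one_mem_adjacentRotations γ _]
      refine SetLike.coe_subset_coe.2 (spinGroup_le_iff.2 fun k hk hk' x hx =>
        Submonoid.subset_closure ⟨p + 6 - k, by omega, by omega, ?_⟩)
      rwa [show p + (5 + 1 - (p + 6 - k)) = k by omega]
    refine hle.trans ?_
    rw [hrefl.triangle_five]
    refine Set.mul_subset_mul (Set.mul_subset_mul ?_ ?_) ?_ <;>
    · refine word_subset_submonoid _ fun k hk => ?_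
      simp only [List.mem_cons, List.not_mem_nil, or_false] at hk
      exact adjacentRotations_subset_spinGroup (by omega) (by omega)
  · exact spinGroup_mul_three_subset γ (by omega) (by omega) (by omega) (by omega)

end SpinGroup

section Blocks

open scoped Pointwise

attribute [local instance] Matrix.linftyOpNormedRing Matrix.linftyOpNormedAlgebra
  Matrix.linfty_opNormOneClass

variable {n i j : ℕ}

theorem rot_eq_exp (P : Op n) (t : ℝ) : rot P t = exp ((-t) • (Complex.I • P)) := by
  rw [rot, ← Complex.coe_smul, smul_smul]
  congr 2
  push_cast
  ring

theorem range_rot (P : Op n) :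
    Set.range (rot P) = Set.range fun t : ℝ => exp (t • (Complex.I • P)) := by
  rw [funext (rot_eq_exp P)]
  exact neg_surjective.range_comp fun t : ℝ => exp (t • (Complex.I • P))

theorem expGroup_eq_spinGroup {p N : ℕ} (h : p + N + 1 ≤ 2 * n) {g : LieSubalgebra ℝ (Op n)}
    (hg : g.toSubmodule = bivSpan (maj n) (Set.Icc (p + 1) (p + N + 1))) :
    expGroup g = spinGroup (maj n) p N := by
  have hγ := isClifford_maj_Icc (n := n) (p := p + 1) (q := p + N + 1) (by omega) h
  apply le_antisymm
  · rw [expGroup, Submonoid.closure_le]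
    rintro _ ⟨x, hx, rfl⟩
    rw [← LieSubalgebra.mem_toSubmodule, hg] at hx
    exact hγ.exp_mem_spinGroup hx
  · refine spinGroup_le_iff.2 fun k hk hk' => ?_
    rintro _ ⟨t, rfl⟩
    refine Submonoid.subset_closure ⟨_, g.smul_mem t ?_, rfl⟩
    rw [← LieSubalgebra.mem_toSubmodule, hg]
    exact mul_mem_bivSpan ⟨by omega, by omega⟩ ⟨by omega, by omega⟩ (by omega)

theorem expGroup_g2 (hj : j + 1 < n) : expGroup (g2 n (j + 1)) = spinGroup (maj n) (2 * j) 3 :=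
  expGroup_eq_spinGroup (by omega) (g2_toSubmodule hj)

theorem expGroup_g3 (hj : j + 2 < n) : expGroup (g3 n (j + 1)) = spinGroup (maj n) (2 * j) 5 :=
  expGroup_eq_spinGroup (by omega) (g3_toSubmodule hj)

theorem block_eq_chiralBlock (hj : j + 1 < n) (θ : Fin 6 → ℝ) : block n (j + 1) θ =
    chiralBlock (Complex.I • Z n (j + 1)) (Complex.I • (X n (j + 1) * X n (j + 2)))
      (Z n (j + 1) * Z n (j + 2)) (-θ) := by
  simp only [block, chiralBlock, rot_eq_exp, ZZ_mul_I_smul_Z hj, ZZ_mul_I_smul_XX hj, neg_neg,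
    Pi.neg_apply]
  rfl

theorem range_block_eq_range_chiralBlock (hj : j + 1 < n) : Set.range (block n (j + 1)) =
    Set.range (chiralBlock (Complex.I • Z n (j + 1)) (Complex.I • (X n (j + 1) * X n (j + 2)))
      (Z n (j + 1) * Z n (j + 2))) := by
  rw [funext (block_eq_chiralBlock hj)]
  exact neg_surjective.range_comp (chiralBlock _ _ _)

theorem exists_block_eq_exp (hj : j + 1 < n) (θ : Fin 6 → ℝ) :
    ∃ k ∈ g2 n (j + 1), block n (j + 1) θ = exp k := by
  obtain ⟨k, hk, hexp⟩ := (isChiralPair_pauli hj).exists_chiralBlock_eq_exp (-θ)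
  rw [span_chiral_pauli hj] at hk
  exact ⟨k, hk, (block_eq_chiralBlock hj θ).trans hexp⟩

theorem range_block (hj : j + 1 < n) :
    Set.range (block n (j + 1)) = (spinGroup (maj n) (2 * j) 3 : Set (Op n)) := by
  apply Set.Subset.antisymm
  · rintro _ ⟨θ, rfl⟩
    obtain ⟨k, hk, hexp⟩ := exists_block_eq_exp hj θ
    rw [hexp, SetLike.mem_coe, ← expGroup_g2 hj]
    exact Submonoid.subset_closure ⟨k, hk, rfl⟩
  · rw [range_block_eq_range_chiralBlock hj, (isChiralPair_pauli hj).range_chiralBlock]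
    refine SetLike.coe_subset_coe.2 (spinGroup_le_iff.2 fun k hk hk' => ?_)
    rw [← IsChiralPair.range_chiralBlock]
    rintro _ ⟨t, rfl⟩
    obtain ⟨hJ, hK, hcJ⟩ := exp_smul_mem_range_chiralBlock (Complex.I • Z n (j + 1))
      (Complex.I • (X n (j + 1) * X n (j + 2))) (Z n (j + 1) * Z n (j + 2)) t
    rw [ZZ_mul_I_smul_Z hj] at hcJ
    obtain rfl | rfl | rfl : k = 2 * j + 1 ∨ k = 2 * j + 2 ∨ k = 2 * (j + 1) + 1 := by omega
    · exact I_smul_Z (n := n) (j := j) (by omega) ▸ hJ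
    · exact I_smul_XX hj ▸ hK
    · exact I_smul_Z hj ▸ hcJ

theorem range_block_eq_expGroup (hi : 1 ≤ i) (hin : i + 1 ≤ n) :
    Set.range (block n i) = (expGroup (g2 n i) : Set (Op n)) := by
  obtain ⟨j, rfl⟩ := Nat.exists_eq_add_of_le' hi
  rw [range_block hin, expGroup_g2 hin]

end Blocks

section ThreeSites

open scoped Pointwise

attribute [local instance] Matrix.linftyOpNormedRing Matrix.linftyOpNormedAlgebra

variable {n i j : ℕ}

theorem blockProducts_left_right_left (hi : 1 ≤ i) (hin : i + 2 ≤ n) :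
    blockProducts (block n) [i, i + 1, i] = (expGroup (g3 n i) : Set (Op n)) := by
  obtain ⟨j, rfl⟩ := Nat.exists_eq_add_of_le' hi
  rw [blockProducts_three, range_block (show j + 1 < n by omega), range_block (by omega),
    expGroup_g3 (by omega), (isClifford_maj_Icc (by omega) (by omega)).spinGroup_five_eq_left,
    mul_add]

theorem blockProducts_right_left_right (hi : 1 ≤ i) (hin : i + 2 ≤ n) :
    blockProducts (block n) [i + 1, i, i + 1] = (expGroup (g3 n i) : Set (Op n)) := by
  obtain ⟨j, rfl⟩ := Nat.exists_eq_add_of_le' hi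
  rw [blockProducts_three, range_block (show j + 1 < n by omega), range_block (by omega),
    expGroup_g3 (by omega), (isClifford_maj_Icc (by omega) (by omega)).spinGroup_five_eq_right,
    mul_add]

theorem range_tfimBlock {k : ℕ} (hk : 1 ≤ k) (hkn : k + 1 ≤ 2 * n) :
    Set.range (tfimBlock n k) = adjacentRotations (maj n) k := by
  rcases Nat.even_or_odd' k with ⟨m, rfl | rfl⟩
  · obtain ⟨j, rfl⟩ := Nat.exists_eq_add_of_le' (show 1 ≤ m by omega)
    have hblock : tfimBlock n (2 * (j + 1)) = rot (X n (j + 1) * X n (j + 2)) := by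
      funext θ
      rw [tfimBlock, if_neg (by omega), show 2 * (j + 1) / 2 = j + 1 by omega]
    rw [hblock, range_rot, I_smul_XX (by omega)]
    rfl
  · have hblock : tfimBlock n (2 * m + 1) = rot (Z n (m + 1)) := by
      funext θ
      rw [tfimBlock, if_pos (by omega), show (2 * m + 1 + 1) / 2 = m + 1 by omega]
    rw [hblock, range_rot, I_smul_Z (by omega)]
    rfl

theorem blockProducts_tfim_triangle (hi : 1 ≤ i) (hin : i + 2 ≤ n) :
    blockProducts (fun k => tfimBlock n (2 * i - 2 + k)) (triangleIdx 5) =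
      (expGroup (g3 n i) : Set (Op n)) := by
  obtain ⟨j, rfl⟩ := Nat.exists_eq_add_of_le' hi
  rw [expGroup_g3 (by omega), (isClifford_maj_Icc (by omega) (by omega)).spinGroup_eq_word,
    blockProducts_eq_word]
  refine word_congr fun k hk => ?_
  have hk := mem_triangleIdx hk
  rw [range_tfimBlock (by omega) (by omega), show 2 * (j + 1) - 2 + k = 2 * j + k by omega]

theorem rot_mul_rot {P Q : Op n} (h : Commute (Complex.I • P) (Complex.I • Q)) (s t : ℝ) :
    rot P s * rot Q t = exp ((-s) • (Complex.I • P) + (-t) • (Complex.I • Q)) := by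
  rw [rot_eq_exp, rot_eq_exp, Matrix.exp_add_of_commute _ _ ((h.smul_left _).smul_right _)]

theorem rot_mem_expGroup {g : LieSubalgebra ℝ (Op n)} {P : Op n} (hP : Complex.I • P ∈ g) (t : ℝ) :
    rot P t ∈ expGroup g :=
  Submonoid.subset_closure ⟨(-t) • (Complex.I • P), g.smul_mem _ hP, (rot_eq_exp P t).symm⟩

theorem exists_rot_XX_mul_rot_YY_eq_exp (hj : j + 1 < n) (s t : ℝ) :
    ∃ h ∈ Submodule.span ℝ {Complex.I • (X n (j + 1) * X n (j + 2)),
      Complex.I • (Y n (j + 1) * Y n (j + 2))},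
      rot (X n (j + 1) * X n (j + 2)) s * rot (Y n (j + 1) * Y n (j + 2)) t = exp h := by
  refine ⟨_, add_mem (Submodule.smul_mem _ (-s) (Submodule.subset_span (by simp)))
      (Submodule.smul_mem _ (-t) (Submodule.subset_span (by simp))), rot_mul_rot ?_ s t⟩
  rw [← neg_neg (Complex.I • (Y n (j + 1) * Y n (j + 2))), ← ZZ_mul_I_smul_XX hj]
  exact ((isChiralPair_pauli hj).commute_right.symm.mul_right (Commute.refl _)).neg_right

theorem rot_Z_mul_rot_Z_comm (i k : ℕ) (s t : ℝ) :
    rot (Z n i) s * rot (Z n k) t = rot (Z n k) t * rot (Z n i) s := by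
  have hcomm : Commute (Z n i) (Z n k) := by
    by_cases hik : i = k
    · rw [hik]
    · exact site_commute hik _ _
  have hcomm' := (hcomm.smul_left Complex.I).smul_right Complex.I
  rw [rot_mul_rot hcomm', rot_mul_rot hcomm'.symm, add_comm]

theorem commute_of_conj_eq_self {T x : Op n} (hT : T * T = 1) (h : T * x * T = x) :
    Commute x T := by
  change x * T = T * x
  calc x * T = T * x * T * T := by rw [h]
    _ = T * x := by rw [mul_assoc, hT, mul_one]

theorem exists_exp_eq_mul_rot_and_rot_mul (hj : j + 1 < n) {T : Op n}
    (hT : ∀ x ∈ g2 n (j + 1), Commute x T) {U : Op n} (hU : U ∈ expGroup (g2 n (j + 1))) (t : ℝ) :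
    ∃ k ∈ (g2 n (j + 1)).toSubmodule ⊔ Submodule.span ℝ {Complex.I • T},
      U * rot T t = exp k ∧ rot T t * U = exp k := by
  rw [← SetLike.mem_coe, ← range_block_eq_expGroup (by omega) hj] at hU
  obtain ⟨θ, rfl⟩ := hU
  obtain ⟨x, hx, hexp⟩ := exists_block_eq_exp hj θ
  have hcomm : Commute x ((-t) • (Complex.I • T)) := ((hT x hx).smul_right _).smul_right _
  refine ⟨x + (-t) • (Complex.I • T), Submodule.add_mem_sup hx
    (Submodule.smul_mem _ _ (Submodule.mem_span_singleton_self _)), ?_, ?_⟩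
  · rw [hexp, rot_eq_exp, Matrix.exp_add_of_commute _ _ hcomm]
  · rw [hexp, rot_eq_exp, add_comm, Matrix.exp_add_of_commute _ _ hcomm.symm]

theorem Z_mul_self (n i : ℕ) : Z n i * Z n i = 1 := by
  rw [Z, site_mul, pZ_mul_pZ, site_one]

theorem cartan_right (hi : 1 ≤ i) (hin : i + 2 ≤ n) {G : Op n} (hG : G ∈ expGroup (g3 n i)) :
    ∃ k₁ ∈ g3 n i, ∃ k₂ ∈ g3 n i,
      Z n (i + 2) * k₁ * Z n (i + 2) = k₁ ∧ Z n (i + 2) * k₂ * Z n (i + 2) = k₂ ∧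
      ∃ h ∈ Submodule.span ℝ {Complex.I • (X n (i + 1) * X n (i + 2)),
          Complex.I • (Y n (i + 1) * Y n (i + 2))},
        G = exp k₁ * exp h * exp k₂ := by
  rw [← SetLike.mem_coe, ← blockProducts_left_right_left hi hin, blockProducts_three] at hG
  obtain ⟨j, rfl⟩ := Nat.exists_eq_add_of_le' hi
  rw [range_block_eq_expGroup hi (by omega)] at hG
  obtain ⟨_, ⟨b₁, hb₁, _, ⟨θ, rfl⟩, rfl⟩, b₂, hb₂, rfl⟩ := hG
  have hfix := fixedPoints_g3_right (show j + 2 < n by omega)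
  have hcomm : ∀ x ∈ g2 n (j + 1), Commute x (Z n (j + 3)) := fun x hx =>
    commute_of_conj_eq_self (Z_mul_self n _) ((hfix x).2 (Submodule.mem_sup_left hx)).2
  have hZ (t) : rot (Z n (j + 2)) t ∈ expGroup (g2 n (j + 1)) :=
    rot_mem_expGroup (LieSubalgebra.subset_lieSpan (by simp [exponents])) t
  obtain ⟨k₁, hk₁, hexp₁, -⟩ :=
    exists_exp_eq_mul_rot_and_rot_mul (by omega) hcomm (mul_mem hb₁ (hZ (θ 0))) (θ 1)
  obtain ⟨k₂, hk₂, -, hexp₂⟩ :=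
    exists_exp_eq_mul_rot_and_rot_mul (by omega) hcomm (mul_mem (hZ (θ 4)) hb₂) (θ 5)
  obtain ⟨h, hh, hexp⟩ :=
    exists_rot_XX_mul_rot_YY_eq_exp (show j + 1 + 1 < n by omega) (θ 2) (θ 3)
  refine ⟨k₁, ((hfix k₁).2 hk₁).1, k₂, ((hfix k₂).2 hk₂).1, ((hfix k₁).2 hk₁).2,
    ((hfix k₂).2 hk₂).2, h, hh, ?_⟩
  rw [← hexp₁, ← hexp₂, ← hexp, ← mul_assoc (rot (Z n (j + 3)) (θ 5)),
    rot_Z_mul_rot_Z_comm (j + 3) (j + 2), block]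
  simp only [mul_assoc]

theorem cartan_left (hi : 1 ≤ i) (hin : i + 2 ≤ n) {G : Op n} (hG : G ∈ expGroup (g3 n i)) :
    ∃ k₁ ∈ g3 n i, ∃ k₂ ∈ g3 n i,
      Z n i * k₁ * Z n i = k₁ ∧ Z n i * k₂ * Z n i = k₂ ∧
      ∃ h ∈ Submodule.span ℝ {Complex.I • (X n i * X n (i + 1)),
          Complex.I • (Y n i * Y n (i + 1))},
        G = exp k₁ * exp h * exp k₂ := by
  rw [← SetLike.mem_coe, ← blockProducts_right_left_right hi hin, blockProducts_three] at hG
  obtain ⟨j, rfl⟩ := Nat.exists_eq_add_of_le' hi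
  rw [range_block_eq_expGroup (by omega) hin] at hG
  obtain ⟨_, ⟨b₁, hb₁, _, ⟨θ, rfl⟩, rfl⟩, b₂, hb₂, rfl⟩ := hG
  have hfix := fixedPoints_g3_left (show j + 2 < n by omega)
  have hcomm : ∀ x ∈ g2 n (j + 2), Commute x (Z n (j + 1)) := fun x hx =>
    commute_of_conj_eq_self (Z_mul_self n _) ((hfix x).2 (Submodule.mem_sup_left hx)).2
  have hZ (t) : rot (Z n (j + 2)) t ∈ expGroup (g2 n (j + 2)) :=
    rot_mem_expGroup (LieSubalgebra.subset_lieSpan (by simp [exponents])) t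
  obtain ⟨k₁, hk₁, hexp₁, -⟩ :=
    exists_exp_eq_mul_rot_and_rot_mul (by omega) hcomm (mul_mem hb₁ (hZ (θ 1))) (θ 0)
  obtain ⟨k₂, hk₂, -, hexp₂⟩ :=
    exists_exp_eq_mul_rot_and_rot_mul (by omega) hcomm (mul_mem (hZ (θ 5)) hb₂) (θ 4)
  obtain ⟨h, hh, hexp⟩ := exists_rot_XX_mul_rot_YY_eq_exp (show j + 1 < n by omega) (θ 2) (θ 3)
  refine ⟨k₁, ((hfix k₁).2 hk₁).1, k₂, ((hfix k₂).2 hk₂).1, ((hfix k₁).2 hk₁).2,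
    ((hfix k₂).2 hk₂).2, h, hh, ?_⟩
  rw [← hexp₁, ← hexp₂, ← hexp, mul_assoc b₁, rot_Z_mul_rot_Z_comm (j + 2) (j + 1), block]
  simp only [mul_assoc]

end ThreeSites

/-! ### Compression of circuits -/

section Compression

open scoped Pointwise

attribute [local instance] Matrix.linftyOpNormedRing Matrix.linftyOpNormedAlgebra

variable {n i k : ℕ}

theorem block_commute (hi : 1 ≤ i) (hik : i + 1 < k) (hk : k + 1 ≤ n) (α β : Fin 6 → ℝ) :
    Commute (block n i α) (block n k β) := by
  obtain ⟨a, rfl⟩ := Nat.exists_eq_add_of_le' hi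
  obtain ⟨b, rfl⟩ := Nat.exists_eq_add_of_le' (show 1 ≤ k by omega)
  refine (isClifford_maj_Icc (n := n) (by omega) (by omega)).commute_of_mem_spinGroup
    (p := 2 * a) (q := 2 * b) (N := 3) (M := 3) (by omega) ?_ ?_
  · exact (range_block (by omega)).subset ⟨α, rfl⟩
  · exact (range_block (by omega)).subset ⟨β, rfl⟩

theorem isHecke_block (n : ℕ) : IsHecke (n - 1) fun k => Set.range (block n k) where
  idem i h₁ h₂ := by
    obtain ⟨a, rfl⟩ := Nat.exists_eq_add_of_le' h₁
    rw [range_block (by omega), coe_mul_coe]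
  comm i k h₁ h₂ h₃ := by
    refine set_mul_comm_of_commute ?_
    rintro _ ⟨α, rfl⟩ _ ⟨β, rfl⟩
    exact block_commute h₁ h₂ (by omega) α β
  braid i h₁ h₂ := by
    rw [← blockProducts_three, ← blockProducts_three,
      blockProducts_left_right_left h₁ (by omega), blockProducts_right_left_right h₁ (by omega)]

theorem one_mem_range_block (n k : ℕ) : (1 : Op n) ∈ Set.range (block n k) :=
  ⟨0, by simp [block, rot]⟩

theorem exists_block_mul_block_eq (hi : 1 ≤ i) (hin : i + 1 ≤ n) (α β : Fin 6 → ℝ) :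
    ∃ a, block n i α * block n i β = block n i a := by
  obtain ⟨a, ha⟩ := ((isHecke_block n).idem i hi (by omega)).subset
    (Set.mul_mem_mul ⟨α, rfl⟩ ⟨β, rfl⟩)
  exact ⟨a, ha.symm⟩

theorem isBlock_block (n : ℕ) : IsBlock (n - 1) (block n) where
  fusion i h₁ h₂ := exists_block_mul_block_eq h₁ (by omega)
  commutation i k h₁ h₂ h₃ h₄ h α β := by
    rcases h with h | h
    · exact block_commute h₁ h (by omega) α β
    · exact (block_commute h₃ h (by omega) β α).symm
  turnover i h₁ h₂ α β γ := by
    obtain ⟨_, ⟨_, ⟨a, rfl⟩, _, ⟨b, rfl⟩, rfl⟩, _, ⟨c, rfl⟩, h⟩ :=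
      ((isHecke_block n).braid i h₁ h₂).subset
        (Set.mul_mem_mul (Set.mul_mem_mul ⟨α, rfl⟩ ⟨β, rfl⟩) ⟨γ, rfl⟩)
    exact ⟨a, b, c, h.symm⟩

theorem block_turnover_reverse (hi : 1 ≤ i) (hin : i + 2 ≤ n) (α β γ : Fin 6 → ℝ) :
    ∃ a b c, block n (i + 1) α * block n i β * block n (i + 1) γ =
      block n i a * block n (i + 1) b * block n i c := by
  obtain ⟨_, ⟨_, ⟨a, rfl⟩, _, ⟨b, rfl⟩, rfl⟩, _, ⟨c, rfl⟩, h⟩ :=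
    ((isHecke_block n).braid i hi (by omega)).superset
      (Set.mul_mem_mul (Set.mul_mem_mul ⟨α, rfl⟩ ⟨β, rfl⟩) ⟨γ, rfl⟩)
  exact ⟨a, b, c, h.symm⟩

theorem blockProducts_triangle_eq_square (n : ℕ) :
    blockProducts (block n) (triangleIdx (n - 1)) =
      blockProducts (block n) (squareIdx (n - 1)) := by
  rw [blockProducts_eq_word, blockProducts_eq_word, (isHecke_block n).triangle_eq_square]

theorem blockProducts_subset_triangle {idx : List ℕ} (h : ∀ k ∈ idx, 1 ≤ k ∧ k + 1 ≤ n) :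
    blockProducts (block n) idx ⊆ blockProducts (block n) (triangleIdx (n - 1)) := by
  rw [blockProducts_eq_word, blockProducts_eq_word]
  refine (isHecke_block n).word_subset_triangle (fun k _ _ => one_mem_range_block n k)
    fun k hk => ?_
  have := h k hk
  omega

theorem blockProducts_subset_square {idx : List ℕ} (h : ∀ k ∈ idx, 1 ≤ k ∧ k + 1 ≤ n) :
    blockProducts (block n) idx ⊆ blockProducts (block n) (squareIdx (n - 1)) :=
  (blockProducts_subset_triangle h).trans (blockProducts_triangle_eq_square n).subset

/-- The operators implemented by circuits of arbitrary length made of the blocks of the chain.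
Blocks are closed under inverses, so this submonoid is the group they generate. -/
noncomputable def circuitGroup (n : ℕ) : Submonoid (Op n) :=
  Submonoid.closure {x | ∃ k, 1 ≤ k ∧ k ≤ n - 1 ∧ x ∈ Set.range (block n k)}

theorem circuitGroup_eq_triangle (n : ℕ) :
    (circuitGroup n : Set (Op n)) = blockProducts (block n) (triangleIdx (n - 1)) := by
  rw [blockProducts_eq_word]
  exact (isHecke_block n).closure_eq_triangle fun k _ _ => one_mem_range_block n k

theorem mem_triangle_inter_square {U : Op n} (hU : U ∈ circuitGroup n) :
    U ∈ blockProducts (block n) (triangleIdx (n - 1)) ∩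
      blockProducts (block n) (squareIdx (n - 1)) := by
  rw [← blockProducts_triangle_eq_square, Set.inter_self, ← circuitGroup_eq_triangle]
  exact hU

theorem expGroup_g2_le_circuitGroup (hi : 1 ≤ i) (hin : i + 1 ≤ n) :
    expGroup (g2 n i) ≤ circuitGroup n := by
  rw [← SetLike.coe_subset_coe, ← range_block_eq_expGroup hi hin]
  exact fun _ hx => Submonoid.subset_closure ⟨i, hi, by omega, hx⟩

end Compression

section Trotter

open scoped Pointwise

variable {n i j : ℕ}

/-- The Pauli strings whose rotations are absorbed by the block `k` in a zigzag Trotter step. The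
field on the last qubit has no bond to its right and is absorbed by the block `n - 1`. -/
def bondTerms (n k : ℕ) : List (Kind × ℕ) :=
  [(Kind.xx, k), (Kind.yy, k), (Kind.xy, k), (Kind.yx, k), (Kind.z, k)] ++
    if k + 1 = n then [(Kind.z, n)] else []

theorem mem_bondTerms {k i : ℕ} {κ : Kind} : (κ, i) ∈ bondTerms n k ↔
    i = k ∨ (κ = Kind.z ∧ i = n ∧ k + 1 = n) := by
  rw [bondTerms]
  split_ifs with h <;> cases κ <;> simp [h]

theorem nodup_bondTerms (n k : ℕ) : (bondTerms n k).Nodup := by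
  rw [bondTerms]
  split_ifs with h
  · simp; omega
  · simp

theorem I_smul_pauliTerm_mem (hj : j + 1 < n) {τ : Kind × ℕ} (hτ : τ ∈ bondTerms n (j + 1)) :
    Complex.I • pauliTerm n τ ∈ g2 n (j + 1) := by
  obtain ⟨κ, i⟩ := τ
  have hmem := g2Basis_mem_g2 hj
  obtain rfl | ⟨rfl, rfl, rfl⟩ := mem_bondTerms.1 hτ
  · cases κ
    exacts [hmem 0, hmem 1, hmem 2, hmem 3, hmem 4]
  · exact hmem 5

theorem rot_pauliTerm_mem_expGroup (hi : 1 ≤ i) (hin : i + 1 ≤ n) {τ : Kind × ℕ}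
    (hτ : τ ∈ bondTerms n i) (t : ℝ) : rot (pauliTerm n τ) t ∈ expGroup (g2 n i) := by
  obtain ⟨j, rfl⟩ := Nat.exists_eq_add_of_le' hi
  exact rot_mem_expGroup (I_smul_pauliTerm_mem hin hτ) t

theorem isTerm_iff_exists_mem_bondTerms (hn : 2 ≤ n) (τ : Kind × ℕ) :
    IsTerm n τ ↔ ∃ k, (1 ≤ k ∧ k ≤ n - 1) ∧ τ ∈ bondTerms n k := by
  obtain ⟨κ, i⟩ := τ
  simp only [mem_bondTerms]
  constructor
  · intro h
    by_cases hi : i ≤ n - 1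
    · exact ⟨i, ⟨by cases κ <;> exact h.1, hi⟩, Or.inl rfl⟩
    · have hκ : κ = Kind.z ∧ i = n := by
        cases κ <;> simp only [IsTerm] at h <;> first | omega | exact ⟨rfl, by omega⟩
      exact ⟨n - 1, by omega, Or.inr ⟨hκ.1, hκ.2, by omega⟩⟩
  · rintro ⟨k, hk, rfl | ⟨rfl, rfl, -⟩⟩
    · cases κ <;> simp only [IsTerm] <;> omega
    · simp only [IsTerm]; omega

theorem mem_zigzagIdx {N k : ℕ} : k ∈ zigzagIdx N ↔ 1 ≤ k ∧ k ≤ N := by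
  simp only [zigzagIdx, List.mem_append, List.mem_filter, List.mem_range'_1, decide_eq_true_eq]
  omega

theorem nodup_zigzagIdx (N : ℕ) : (zigzagIdx N).Nodup := by
  have h : (List.range' 1 N).Nodup := List.nodup_range'
  refine List.nodup_append'.2 ⟨h.filter _, h.filter _, fun k hodd heven => ?_⟩
  simp only [List.mem_filter, decide_eq_true_eq] at hodd heven
  omega

theorem isTermOrder_zigzag (hn : 2 ≤ n) :
    IsTermOrder n ((zigzagIdx (n - 1)).flatMap (bondTerms n)) := by
  refine ⟨List.nodup_flatMap.2 ⟨fun k _ => nodup_bondTerms n k, ?_⟩, fun τ => ?_⟩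
  · refine (nodup_zigzagIdx (n - 1)).imp_of_mem fun ha hb hab => ?_
    rw [mem_zigzagIdx] at ha hb
    rintro ⟨κ, i⟩ hτa hτb
    rw [mem_bondTerms] at hτa hτb
    omega
  · simp only [List.mem_flatMap, mem_zigzagIdx, isTerm_iff_exists_mem_bondTerms hn]

theorem prod_map_flatMap_mem_word {M ι : Type*} [Monoid M] {r : ℕ → Set M} {idx : List ℕ}
    {g : ℕ → List ι} {f : ι → M} (h : ∀ k ∈ idx, ((g k).map f).prod ∈ r k) :
    ((idx.flatMap g).map f).prod ∈ word r idx := by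
  induction idx with
  | nil => simp
  | cons k l ih =>
    rw [List.flatMap_cons, List.map_append, List.prod_append, word_cons]
    exact Set.mul_mem_mul (h k (by simp)) (ih fun m hm => h m (by simp [hm]))

theorem trotterStep_zigzag (h : Kind × ℕ → ℝ) (dt : ℝ) :
    trotterStep n h dt ((zigzagIdx (n - 1)).flatMap (bondTerms n)) ∈
      blockProducts (block n) (zigzagIdx (n - 1)) := by
  rw [blockProducts_eq_word, trotterStep]
  refine prod_map_flatMap_mem_word fun k hk => ?_
  rw [mem_zigzagIdx] at hk
  rw [range_block_eq_expGroup hk.1 (by omega)]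
  refine list_prod_mem fun x hx => ?_
  obtain ⟨τ, hτ, rfl⟩ := List.mem_map.1 hx
  exact rot_pauliTerm_mem_expGroup hk.1 (by omega) hτ _

theorem trotterStep_mem_circuitGroup (hn : 2 ≤ n) (h : Kind × ℕ → ℝ) (dt : ℝ)
    {l : List (Kind × ℕ)} (hl : IsTermOrder n l) : trotterStep n h dt l ∈ circuitGroup n := by
  refine list_prod_mem fun x hx => ?_
  obtain ⟨τ, hτ, rfl⟩ := List.mem_map.1 hx
  obtain ⟨k, hk, hτ⟩ := (isTerm_iff_exists_mem_bondTerms hn τ).1 ((hl.2 τ).1 hτ)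
  exact expGroup_g2_le_circuitGroup hk.1 (by omega)
    (rot_pauliTerm_mem_expGroup hk.1 (by omega) hτ _)

theorem list_ofFn_reverse_prod_mem {M : Type*} [Monoid M] {S : Submonoid M} {r : ℕ} {f : Fin r → M}
    (h : ∀ k, f k ∈ S) : (List.ofFn f).reverse.prod ∈ S :=
  list_prod_mem fun x hx => by
    obtain ⟨k, rfl⟩ := List.mem_ofFn.1 (List.mem_reverse.1 hx)
    exact h k

end Trotter

section FreeFermions

variable {n j : ℕ}

theorem annih_eq (hj : j < n) :
    annih n (j + 1) = (1 / 2 : ℂ) • (maj n (2 * j + 1) + Complex.I • maj n (2 * j + 2)) := by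
  have h : annih n (j + 1) = strOp n (j + 1) ((1 / 2 : ℂ) • (pX + Complex.I • pY)) := by
    rw [annih, strOp, zString, site, tensorOp_mul]
    congr 1; funext k
    split_ifs <;> first | omega | simp
  rw [h, maj_odd, maj_even, strOp, site_smul (by omega) (by omega), site_add (by omega) (by omega),
    site_smul (by omega) (by omega), strOp, strOp, mul_smul_comm, mul_add, mul_smul_comm]

theorem strOp_conjTranspose (n i : ℕ) (A : Matrix (Fin 2) (Fin 2) ℂ) :
    (strOp n i A).conjTranspose = strOp n i A.conjTranspose := by
  rw [strOp, Matrix.conjTranspose_mul, site_conjTranspose, zString_conjTranspose,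
    ← (zString_commute_site le_rfl _).eq, strOp]

theorem maj_conjTranspose (n a : ℕ) : (maj n a).conjTranspose = maj n a := by
  rw [maj]
  split_ifs
  · rw [strOp_conjTranspose, pX_conjTranspose]
  · rw [strOp_conjTranspose, pY_conjTranspose]

theorem creat_eq (hj : j < n) :
    creat n (j + 1) = (1 / 2 : ℂ) • (maj n (2 * j + 1) - Complex.I • maj n (2 * j + 2)) := by
  rw [creat, annih_eq hj, Matrix.conjTranspose_smul, Matrix.conjTranspose_add,
    Matrix.conjTranspose_smul, maj_conjTranspose, maj_conjTranspose]
  simp [sub_eq_add_neg]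

theorem creat_mul_annih_self (hj : j < n) :
    creat n (j + 1) * annih n (j + 1) = (1 / 2 : ℝ) • ((1 : Op n) - Z n (j + 1)) := by
  have hanti := (isClifford_maj n).anticomm (a := 2 * j + 2) (b := 2 * j + 1)
    ⟨by omega, by omega⟩ ⟨by omega, by omega⟩ (by omega)
  rw [creat_eq hj, annih_eq hj]
  simp only [smul_mul_assoc, mul_smul_comm, sub_mul, mul_add, hanti, maj_mul_self, ← I_smul_Z hj,
    ← Complex.coe_smul]
  push_cast
  match_scalars <;> ring_nf <;> simp only [Complex.I_sq] <;> ring_nf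

theorem hopPair_eq (hj : j + 1 < n) (α β : ℂ) : hopPair n (j + 1) α β =
    ((α.re - β.re) / 2) • (X n (j + 1) * X n (j + 2)) +
      ((α.re + β.re) / 2) • (Y n (j + 1) * Y n (j + 2)) +
      ((β.im - α.im) / 2) • (X n (j + 1) * Y n (j + 2)) +
      ((β.im + α.im) / 2) • (Y n (j + 1) * X n (j + 2)) := by
  have hanti {a b : ℕ} (ha : 1 ≤ a) (hab : a < b) (hb : b ≤ 4) :
      maj n (2 * j + b) * maj n (2 * j + a) = -(maj n (2 * j + a) * maj n (2 * j + b)) :=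
    (isClifford_maj n).anticomm ⟨by omega, by omega⟩ ⟨by omega, by omega⟩ (by omega)
  have hYX : maj n (2 * j + 1) * maj n (2 * j + 3) =
      -(Complex.I • (Y n (j + 1) * X n (j + 2))) := by rw [I_smul_YX hj, neg_neg]
  have hYY : maj n (2 * j + 1) * maj n (2 * j + 4) =
      -(Complex.I • (Y n (j + 1) * Y n (j + 2))) := by rw [I_smul_YY hj, neg_neg]
  have hj' : j < n := by omega
  rw [hopPair, creat_eq hj, annih_eq hj, creat_eq hj', annih_eq hj']
  rw [show 2 * (j + 1) + 1 = 2 * j + 3 by ring, show 2 * (j + 1) + 2 = 2 * j + 4 by ring]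
  simp only [smul_mul_assoc, mul_smul_comm, sub_mul, mul_add, add_mul, mul_sub,
    hanti (a := 1) (b := 3), hanti (a := 1) (b := 4), hanti (a := 2) (b := 3),
    hanti (a := 2) (b := 4), le_refl, Nat.one_le_ofNat, Nat.one_lt_ofNat, Nat.lt_add_one,
    Nat.reduceLT, Nat.reduceLeDiff, hYX, hYY, ← I_smul_XX hj, ← I_smul_XY hj, ← Complex.coe_smul]
  match_scalars <;> apply Complex.ext <;> simp <;> ring

/-- The coefficients of the Pauli strings in the Jordan–Wigner transform of the free-fermion
Hamiltonian with hopping `α`, pairing `β` and chemical potential `γ`. -/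
noncomputable def tfxyCoeff (α β : ℕ → ℂ) (γ : ℕ → ℝ) : Kind × ℕ → ℝ
  | (Kind.xx, i) => ((α i).re - (β i).re) / 2
  | (Kind.yy, i) => ((α i).re + (β i).re) / 2
  | (Kind.xy, i) => ((β i).im - (α i).im) / 2
  | (Kind.yx, i) => ((β i).im + (α i).im) / 2
  | (Kind.z, i) => -(γ i / 2)

theorem exists_tfxyCoeff_eq (h : Kind × ℕ → ℝ) : ∃ α β γ, tfxyCoeff α β γ = h := by
  refine ⟨fun i => ⟨h (Kind.xx, i) + h (Kind.yy, i), h (Kind.yx, i) - h (Kind.xy, i)⟩,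
    fun i => ⟨h (Kind.yy, i) - h (Kind.xx, i), h (Kind.yx, i) + h (Kind.xy, i)⟩,
    fun i => -2 * h (Kind.z, i), ?_⟩
  funext ⟨κ, i⟩
  cases κ <;> simp only [tfxyCoeff] <;> ring

theorem fermionHamiltonian_eq (n : ℕ) (α β : ℕ → ℂ) (γ : ℕ → ℝ) :
    fermionHamiltonian n α β γ =
      tfxyHamiltonian n (tfxyCoeff α β γ) + (∑ i ∈ Finset.Icc 1 n, γ i / 2) • (1 : Op n) := by
  rw [tfxyHamiltonian, fermionHamiltonian, add_assoc, Finset.sum_smul, ← Finset.sum_add_distrib]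
  congr 1 <;> refine Finset.sum_congr rfl fun i hi => ?_ <;> rw [Finset.mem_Icc] at hi <;>
    obtain ⟨j, rfl⟩ := Nat.exists_eq_add_of_le' hi.1
  · exact hopPair_eq (by omega) _ _
  · rw [creat_mul_annih_self (by omega), tfxyCoeff]
    module

theorem exists_tfxyHamiltonian_eq_fermionHamiltonian (n : ℕ) (h : Kind × ℕ → ℝ) :
    ∃ (α β : ℕ → ℂ) (γ : ℕ → ℝ) (e : ℝ),
      tfxyHamiltonian n h = fermionHamiltonian n α β γ + e • (1 : Op n) := by
  obtain ⟨α, β, γ, rfl⟩ := exists_tfxyCoeff_eq h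
  refine ⟨α, β, γ, -∑ i ∈ Finset.Icc 1 n, γ i / 2, ?_⟩
  rw [fermionHamiltonian_eq, neg_smul, add_neg_cancel_right]

section Exp

attribute [local instance] Matrix.linftyOpNormedRing Matrix.linftyOpNormedAlgebra

theorem exp_smul_one (z : ℂ) : NormedSpace.exp (z • (1 : Op n)) = Complex.exp z • 1 := by
  have h : algebraMap ℂ (Op n) (NormedSpace.exp z) = NormedSpace.exp (algebraMap ℂ (Op n) z) :=
    NormedSpace.algebraMap_exp_comm z
  rw [← Algebra.algebraMap_eq_smul_one, ← h, Algebra.algebraMap_eq_smul_one, Complex.exp_eq_exp_ℂ]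

end Exp

theorem rot_add_smul_one (T : Op n) (e t : ℝ) :
    rot (T + e • (1 : Op n)) t = Complex.exp (Complex.I * ((-(t * e) : ℝ) : ℂ)) • rot T t := by
  have h : (-(Complex.I * (t : ℂ))) • (T + e • (1 : Op n)) = (-(Complex.I * (t : ℂ))) • T +
      (Complex.I * ((-(t * e) : ℝ) : ℂ)) • (1 : Op n) := by
    rw [← Complex.coe_smul]
    push_cast
    module
  rw [rot, h, Matrix.exp_add_of_commute _ _ ((Commute.one_right _).smul_right _), exp_smul_one,
    mul_smul_comm, mul_one, rot]

/-- The operators implemented by circuits of blocks up to a global phase. -/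
noncomputable def phaseCircuitGroup (n : ℕ) : Submonoid (Op n) where
  carrier := {x | ∃ φ : ℝ, ∃ U ∈ circuitGroup n, x = Complex.exp (Complex.I * φ) • U}
  mul_mem' := by
    rintro _ _ ⟨φ, U, hU, rfl⟩ ⟨ψ, V, hV, rfl⟩
    refine ⟨φ + ψ, U * V, mul_mem hU hV, ?_⟩
    rw [smul_mul_smul_comm, ← Complex.exp_add]
    congr 2; push_cast; ring
  one_mem' := ⟨0, 1, one_mem _, by simp⟩

theorem exists_of_mem_phaseCircuitGroup {x : Op n} (hx : x ∈ phaseCircuitGroup n) :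
    ∃ (φ : ℝ) (U : Op n), U ∈ blockProducts (block n) (triangleIdx (n - 1)) ∩
      blockProducts (block n) (squareIdx (n - 1)) ∧ x = Complex.exp (Complex.I * φ) • U := by
  obtain ⟨φ, U, hU, h⟩ := hx
  exact ⟨φ, U, mem_triangle_inter_square hU, h⟩

theorem exists_bondTerm_op_eq_add_smul_one {p : BondTerm} (hp : 1 ≤ p.bond) (hpn : p.bond + 1 ≤ n) :
    ∃ (T : Op n) (e : ℝ), Complex.I • T ∈ g2 n p.bond ∧ p.op n = T + e • (1 : Op n) := by
  obtain ⟨b, α, β, l, r⟩ := p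
  obtain ⟨j, rfl⟩ := Nat.exists_eq_add_of_le' hp
  have hj : j + 1 < n := hpn
  refine ⟨((α.re - β.re) / 2) • (X n (j + 1) * X n (j + 2)) +
      ((α.re + β.re) / 2) • (Y n (j + 1) * Y n (j + 2)) +
      ((β.im - α.im) / 2) • (X n (j + 1) * Y n (j + 2)) +
      ((β.im + α.im) / 2) • (Y n (j + 1) * X n (j + 2)) + (-(l / 2)) • Z n (j + 1) +
      (-(r / 2)) • Z n (j + 2), (l + r) / 2, ?_, ?_⟩
  · have hmem := g2Basis_mem_g2 hj
    simp only [smul_add, smul_comm Complex.I (_ : ℝ)]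
    refine add_mem (add_mem (add_mem (add_mem (add_mem ?_ ?_) ?_) ?_) ?_) ?_ <;>
      refine (g2 n (j + 1)).smul_mem _ ?_
    exacts [hmem 0, hmem 1, hmem 2, hmem 3, hmem 4, hmem 5]
  · simp only [BondTerm.op]
    rw [hopPair_eq hj, creat_mul_annih_self (j := j) (by omega), creat_mul_annih_self hj]
    module

theorem rot_bondTerm_mem_phaseCircuitGroup {p : BondTerm} (hp : 1 ≤ p.bond)
    (hpn : p.bond + 1 ≤ n) (t : ℝ) : rot (p.op n) t ∈ phaseCircuitGroup n := by
  obtain ⟨T, e, hT, hop⟩ := exists_bondTerm_op_eq_add_smul_one hp hpn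
  rw [hop, rot_add_smul_one]
  exact ⟨_, _, expGroup_g2_le_circuitGroup hp hpn (rot_mem_expGroup hT t), rfl⟩

theorem fermionTrotterStep_mem_phaseCircuitGroup {l : List BondTerm} {H : Op n}
    (hl : IsBondSplitting n l H) (dt : ℝ) : fermionTrotterStep n dt l ∈ phaseCircuitGroup n := by
  refine list_prod_mem fun x hx => ?_
  obtain ⟨p, hp, rfl⟩ := List.mem_map.1 hx
  exact rot_bondTerm_mem_phaseCircuitGroup (hl.1 p hp).1 (hl.1 p hp).2 dt

end FreeFermions

end TFXY

theorem mainTheorem9 (n : ℕ) (hn : 2 ≤ n) :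
    -- the TFXY mapping is a block, and the turnover also holds in the reverse direction
    IsBlock (n - 1) (block n) ∧
    (∀ i, 1 ≤ i → i + 2 ≤ n → ∀ α β γ, ∃ a b c,
      block n (i + 1) α * block n i β * block n (i + 1) γ =
        block n i a * block n (i + 1) b * block n i c) ∧
    -- the two-site algebra splits as `su(2) ⊕ su(2)`, and blocks are exactly the elements of
    -- its group
    (∀ i, 1 ≤ i → i + 1 ≤ n →
      LinearIndependent ℝ (g2Basis n i) ∧
      (g2 n i).toSubmodule = Submodule.span ℝ (Set.range (g2Basis n i)) ∧
      (gPlus n i).toSubmodule = Submodule.span ℝ (Set.range (gPlusBasis n i)) ∧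
      (gMinus n i).toSubmodule = Submodule.span ℝ (Set.range (gMinusBasis n i)) ∧
      Nonempty (gPlus n i ≃ₗ⁅ℝ⁆ su2) ∧ Nonempty (gMinus n i ≃ₗ⁅ℝ⁆ su2) ∧
      (∀ x ∈ gPlus n i, ∀ y ∈ gMinus n i, ⁅x, y⁆ = 0) ∧
      (gPlus n i).toSubmodule ⊔ (gMinus n i).toSubmodule = (g2 n i).toSubmodule ∧
      Disjoint (gPlus n i).toSubmodule (gMinus n i).toSubmodule ∧
      Set.range (block n i) = ((expGroup (g2 n i) : Submonoid (Op n)) : Set (Op n))) ∧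
    -- the three-site algebra, its two Cartan decompositions, and the three descriptions of its
    -- group: `B_i B_{i+1} B_i`, `B_{i+1} B_i B_{i+1}` and TFIM triangles on three qubits
    (∀ i, 1 ≤ i → i + 2 ≤ n →
      LinearIndependent ℝ (g3Basis n i) ∧
      (g3 n i).toSubmodule = Submodule.span ℝ (Set.range (g3Basis n i)) ∧
      (∀ x, (x ∈ g3 n i ∧ Z n (i + 2) * x * Z n (i + 2) = x) ↔
        x ∈ (g2 n i).toSubmodule ⊔ Submodule.span ℝ {Complex.I • Z n (i + 2)}) ∧
      (∀ x, (x ∈ g3 n i ∧ Z n i * x * Z n i = x) ↔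
        x ∈ (g2 n (i + 1)).toSubmodule ⊔ Submodule.span ℝ {Complex.I • Z n i}) ∧
      (∀ G ∈ expGroup (g3 n i), ∃ k₁ ∈ g3 n i, ∃ k₂ ∈ g3 n i,
        Z n (i + 2) * k₁ * Z n (i + 2) = k₁ ∧ Z n (i + 2) * k₂ * Z n (i + 2) = k₂ ∧
        ∃ h ∈ Submodule.span ℝ {Complex.I • (X n (i + 1) * X n (i + 2)),
            Complex.I • (Y n (i + 1) * Y n (i + 2))},
          G = NormedSpace.exp k₁ * NormedSpace.exp h * NormedSpace.exp k₂) ∧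
      (∀ G ∈ expGroup (g3 n i), ∃ k₁ ∈ g3 n i, ∃ k₂ ∈ g3 n i,
        Z n i * k₁ * Z n i = k₁ ∧ Z n i * k₂ * Z n i = k₂ ∧
        ∃ h ∈ Submodule.span ℝ {Complex.I • (X n i * X n (i + 1)),
            Complex.I • (Y n i * Y n (i + 1))},
          G = NormedSpace.exp k₁ * NormedSpace.exp h * NormedSpace.exp k₂) ∧
      blockProducts (block n) [i, i + 1, i] = expGroup (g3 n i) ∧
      blockProducts (block n) [i + 1, i, i + 1] = expGroup (g3 n i) ∧
      blockProducts (fun k => tfimBlock n (2 * i - 2 + k)) (triangleIdx 5) =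
        expGroup (g3 n i)) ∧
    -- size and depth of the triangle and of the square
    (triangleIdx (n - 1)).length = n * (n - 1) / 2 ∧
    (squareIdx (n - 1)).length = n * (n - 1) / 2 ∧
    HasDepthLE (triangleIdx (n - 1)) (2 * n - 3) ∧
    HasDepthLE (squareIdx (n - 1)) n ∧
    -- every circuit made of blocks compresses to a triangle and to a square
    (∀ idx : List ℕ, (∀ k ∈ idx, 1 ≤ k ∧ k + 1 ≤ n) →
      blockProducts (block n) idx ⊆ blockProducts (block n) (triangleIdx (n - 1)) ∧
      blockProducts (block n) idx ⊆ blockProducts (block n) (squareIdx (n - 1))) ∧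
    -- a suitably ordered Trotter step of the generalized TFXY Hamiltonian is a zigzag
    (∃ l, IsTermOrder n l ∧ ∀ (h : Kind × ℕ → ℝ) (dt : ℝ),
      trotterStep n h dt l ∈ blockProducts (block n) (zigzagIdx (n - 1))) ∧
    -- time-dependent Trotter circuits with any number of steps and any orders compress
    (∀ (r : ℕ) (h : Fin r → Kind × ℕ → ℝ) (dt : Fin r → ℝ) (l : Fin r → List (Kind × ℕ)),
      (∀ k, IsTermOrder n (l k)) →
      (List.ofFn fun k => trotterStep n (h k) (dt k) (l k)).reverse.prod ∈
        blockProducts (block n) (triangleIdx (n - 1)) ∩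
          blockProducts (block n) (squareIdx (n - 1))) ∧
    -- the generalized TFXY Hamiltonians are the nearest-neighbour free-fermion Hamiltonians, up to
    -- a multiple of the identity
    (∀ h : Kind × ℕ → ℝ, ∃ (α β : ℕ → ℂ) (γ : ℕ → ℝ) (e : ℝ),
      tfxyHamiltonian n h = fermionHamiltonian n α β γ + e • (1 : Op n)) ∧
    (∀ (α β : ℕ → ℂ) (γ : ℕ → ℝ), ∃ (h : Kind × ℕ → ℝ) (e : ℝ),
      fermionHamiltonian n α β γ = tfxyHamiltonian n h + e • (1 : Op n)) ∧
    -- Trotter circuits of free-fermion Hamiltonians compress, up to a global phase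
    (∀ (r : ℕ) (α β : Fin r → ℕ → ℂ) (γ : Fin r → ℕ → ℝ) (dt : Fin r → ℝ)
      (l : Fin r → List BondTerm),
      (∀ k, IsBondSplitting n (l k) (fermionHamiltonian n (α k) (β k) (γ k))) →
      ∃ (φ : ℝ) (U : Op n),
        U ∈ blockProducts (block n) (triangleIdx (n - 1)) ∩
          blockProducts (block n) (squareIdx (n - 1)) ∧
        (List.ofFn fun k => fermionTrotterStep n (dt k) (l k)).reverse.prod =
          Complex.exp (Complex.I * φ) • U) := by
  have hn1 : n - 1 + 1 = n := by omega
  refine ⟨isBlock_block n, fun i => block_turnover_reverse, fun i hi hin => ?_, fun i hi hin => ?_,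
    by rw [length_triangleIdx, hn1], by rw [length_squareIdx, hn1],
    (hasDepthLE_triangleIdx (n - 1)).mono (by omega), (hasDepthLE_squareIdx (n - 1)).mono hn1.le,
    fun idx h => ⟨blockProducts_subset_triangle h, blockProducts_subset_square h⟩,
    ⟨_, isTermOrder_zigzag hn, trotterStep_zigzag⟩,
    fun r h dt l hl => mem_triangle_inter_square <| list_ofFn_reverse_prod_mem fun k =>
      trotterStep_mem_circuitGroup hn (h k) (dt k) (hl k),
    exists_tfxyHamiltonian_eq_fermionHamiltonian n,
    fun α β γ => ⟨_, _, fermionHamiltonian_eq n α β γ⟩,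
    fun r α β γ dt l hl => exists_of_mem_phaseCircuitGroup <| list_ofFn_reverse_prod_mem fun k =>
      fermionTrotterStep_mem_phaseCircuitGroup (hl k) (dt k)⟩
  all_goals obtain ⟨j, rfl⟩ := Nat.exists_eq_add_of_le' hi
  · exact ⟨linearIndependent_g2Basis hin, g2_toSubmodule_eq_span hin, gPlus_toSubmodule hin,
      gMinus_toSubmodule hin, nonempty_gPlus_equiv_su2 hin, nonempty_gMinus_equiv_su2 hin,
      lie_gPlus_gMinus hin, gPlus_sup_gMinus hin, disjoint_gPlus_gMinus hin,
      range_block_eq_expGroup hi hin⟩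
  · exact ⟨linearIndependent_g3Basis hin, g3_toSubmodule_eq_span hin, fixedPoints_g3_right hin,
      fixedPoints_g3_left hin, fun _ => cartan_right hi hin, fun _ => cartan_left hi hin,
      blockProducts_left_right_left hi hin, blockProducts_right_left_right hi hin,
      blockProducts_tfim_triangle hi hin⟩
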